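/- Let $X$ be a projective variety over $\mathbb{C}$ (an integral closed subscheme of a projective space, not assumed smooth), let $L$ be a line bundle on $X$, and let $V \subseteq H^0(X, L)$ be a linear subspace such that the linear system $|D| = \mathbb{P}(V)$ of zero divisors of nonzero sections in $V$ is basepoint-free, i.e. for every point $x \in X$ some $s \in V$ does not vanish at $x$. Choose a basis $b_0, \dots, b_{n-1}$ of $V$, so that $|D| \cong \mathbb{P}^{n-1}_{\mathbb{C}}$ with homogeneous coordinates $x_0, \dots, x_{n-1}$, and let $$\mathcal{D} \subseteq X \times |D|$$ be the universal divisor, that is, the zero scheme of the section $\sum_i b_i x_i$ of $L \boxtimes \mathcal{O}(1)$, with projections $q : \mathcal{D} \to X$ and $\pi : \mathcal{D} \to |D|$. Then the relative Picard group $$\operatorname{Pic}(\mathcal{D}) / \pi^* \operatorname{Pic}(|D|)$$ of line bundles on $\mathcal{D}$ modulo those pulled back from $|D|$ is generated by the image of $\operatorname{Pic}(X)$ under $q^*$. Equivalently, every line bundle on $\mathcal{D}$ is isomorphic to $q^*N \otimes \pi^*M$ for some $N \in \operatorname{Pic}(X)$ and $M \in \operatorname{Pic}(|D|)$. -/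

import Mathlib

open CategoryTheory Limits AlgebraicGeometry TopologicalSpace

universe u

noncomputable section

namespace LinSys

/-- Restriction of functions from an open `U` to a smaller open `V`. -/
abbrev res {X : Scheme.{u}} {U V : X.Opens} (h : V ≤ U) : Γ(X, U) →+* Γ(X, V) :=
  (X.presheaf.map (homOfLE h).op).hom

theorem res_res {X : Scheme.{u}} {U V W : X.Opens} (h : V ≤ U) (h' : W ≤ V) (a : Γ(X, U)) :
    res h' (res h a) = res (h'.trans h) a := by
  simp only [res, ← CommRingCat.comp_apply, ← Functor.map_comp]
  rfl

/-- Pull-back of functions along `f : X ⟶ Y`, from an open `U` of `Y` to an open `V` of `X`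
which is mapped into `U`. -/
abbrev pull {X Y : Scheme.{u}} (f : X ⟶ Y) {U : Y.Opens} {V : X.Opens} (h : V ≤ f ⁻¹ᵁ U) :
    Γ(Y, U) →+* Γ(X, V) :=
  (f.appLE U V h).hom

theorem le_preimage_inf {X Y : Scheme.{u}} (f : X ⟶ Y) {U U' : Y.Opens} {V : X.Opens}
    (h : V ≤ f ⁻¹ᵁ U) (h' : V ≤ f ⁻¹ᵁ U') : V ≤ f ⁻¹ᵁ (U ⊓ U') :=
  fun _ hp => ⟨h hp, h' hp⟩

theorem res_pull {X Y : Scheme.{u}} (f : X ⟶ Y) {U : Y.Opens} {V W : X.Opens}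
    (h : V ≤ f ⁻¹ᵁ U) (h' : W ≤ V) (a : Γ(Y, U)) :
    res h' (pull f h a) = pull f (h'.trans h) a := by
  simp only [res, pull, ← CommRingCat.comp_apply, Scheme.Hom.appLE_map]

theorem pull_res {X Y : Scheme.{u}} (f : X ⟶ Y) {U U' : Y.Opens} {V : X.Opens}
    (h : V ≤ f ⁻¹ᵁ U) (h' : U ≤ U') (a : Γ(Y, U')) :
    pull f h (res h' a) = pull f (h.trans (fun _ hx => h' hx)) a := by
  simp only [res, pull, ← CommRingCat.comp_apply, Scheme.Hom.map_appLE]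

/-- A line bundle on a scheme `X`, given by local trivializations and transition functions:
every point `x` has a chosen open neighbourhood `U x` over which the line bundle is trivialized,
and `g x y` is the transition function on `U x ∩ U y`. A section given by functions `s x` on the
opens `U x` has to satisfy `s x = g x y * s y`. The cocycle condition makes every `g x y`
invertible, with inverse `g y x`. -/
structure LineBundle (X : Scheme.{u}) : Type u where
  U : X → X.Opens
  mem : ∀ x, x ∈ U x
  g : ∀ x y, Γ(X, U x ⊓ U y)
  g_self : ∀ x, g x x = 1
  cocycle : ∀ x y z,
    res (V := U x ⊓ U y ⊓ U z) inf_le_left (g x y) *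
      res (le_inf (inf_le_left.trans inf_le_right) inf_le_right) (g y z) =
    res (le_inf (inf_le_left.trans inf_le_left) inf_le_right) (g x z)

namespace LineBundle

variable {X Y Z : Scheme.{u}}

theorem cocycle' (L : LineBundle X) (x y z : X) {V : X.Opens} (hxy : V ≤ L.U x ⊓ L.U y)
    (hyz : V ≤ L.U y ⊓ L.U z) (hxz : V ≤ L.U x ⊓ L.U z) :
    res hxy (L.g x y) * res hyz (L.g y z) = res hxz (L.g x z) := by
  have := congrArg (res (le_inf hxy (hyz.trans inf_le_right))) (L.cocycle x y z)
  simpa only [map_mul, res_res] using this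

theorem g_mul_g (L : LineBundle X) (x y : X) {V : X.Opens} (hxy : V ≤ L.U x ⊓ L.U y)
    (hyx : V ≤ L.U y ⊓ L.U x) : res hxy (L.g x y) * res hyx (L.g y x) = 1 := by
  rw [L.cocycle' x y x hxy hyx (le_inf (hxy.trans inf_le_left) (hxy.trans inf_le_left)),
    L.g_self, map_one]

/-- An isomorphism between two line bundles: after shrinking the trivializing neighbourhoods to
opens `W x`, invertible functions `h x` on `W x` carry the transition functions of the first
line bundle to those of the second. -/
def Iso (L L' : LineBundle X) : Prop :=
  ∃ (W : X → X.Opens) (_ : ∀ x, x ∈ W x) (hW : ∀ x, W x ≤ L.U x) (hW' : ∀ x, W x ≤ L'.U x)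
    (h : ∀ x, Γ(X, W x)ˣ), ∀ x y,
      res (V := W x ⊓ W y) (inf_le_inf (hW' x) (hW' y)) (L'.g x y) * res inf_le_right (h y).1 =
      res inf_le_left (h x).1 * res (inf_le_inf (hW x) (hW y)) (L.g x y)

theorem Iso.refl (L : LineBundle X) : Iso L L :=
  ⟨L.U, L.mem, fun _ => le_rfl, fun _ => le_rfl, fun _ => 1, fun x y => by simp⟩

theorem Iso.symm {L L' : LineBundle X} : Iso L L' → Iso L' L := by
  rintro ⟨W, hm, hW, hW', h, H⟩
  refine ⟨W, hm, hW', hW, fun x => (h x)⁻¹, fun x y => ?_⟩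
  have e1 : res (V := W x ⊓ W y) inf_le_left (h x).1 * res inf_le_left ((h x)⁻¹).1 = 1 := by
    rw [← map_mul, Units.mul_inv, map_one]
  have e2 : res (V := W x ⊓ W y) inf_le_right (h y).1 * res inf_le_right ((h y)⁻¹).1 = 1 := by
    rw [← map_mul, Units.mul_inv, map_one]
  have := H x y
  linear_combination (-(res (V := W x ⊓ W y) inf_le_left ((h x)⁻¹).1 *
    res inf_le_right ((h y)⁻¹).1)) * this
    + (res inf_le_left ((h x)⁻¹).1 * res (inf_le_inf (hW' x) (hW' y)) (L'.g x y)) * e2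
    - (res inf_le_right ((h y)⁻¹).1 * res (inf_le_inf (hW x) (hW y)) (L.g x y)) * e1

theorem Iso.trans {L L' L'' : LineBundle X} : Iso L L' → Iso L' L'' → Iso L L'' := by
  rintro ⟨W, hm, hW, hW', h, H⟩ ⟨W₁, hm₁, hW₁, hW₁', h₁, H₁⟩
  refine ⟨fun x => W x ⊓ W₁ x, fun x => ⟨hm x, hm₁ x⟩, fun x => inf_le_left.trans (hW x),
    fun x => inf_le_right.trans (hW₁' x),
    fun x => (Units.map (res inf_le_left).toMonoidHom (h x)) *
      (Units.map (res inf_le_right).toMonoidHom (h₁ x)), fun x y => ?_⟩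
  have e := congrArg (res (V := W x ⊓ W₁ x ⊓ (W y ⊓ W₁ y))
    (inf_le_inf inf_le_left inf_le_left)) (H x y)
  have e₁ := congrArg (res (V := W x ⊓ W₁ x ⊓ (W y ⊓ W₁ y))
    (inf_le_inf inf_le_right inf_le_right)) (H₁ x y)
  simp only [map_mul, res_res, Units.val_mul, Units.coe_map, MonoidHom.coe_coe,
    RingHom.toMonoidHom_eq_coe] at e e₁ ⊢
  linear_combination (res (inf_le_right.trans inf_le_left) (h y).1) * e₁ +
    (res (inf_le_left.trans inf_le_right) (h₁ x).1) * e

/-- The trivial line bundle. -/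
def triv (X : Scheme.{u}) : LineBundle X where
  U _ := ⊤
  mem _ := trivial
  g _ _ := 1
  g_self _ := rfl
  cocycle _ _ _ := by simp

/-- The tensor product of two line bundles. -/
def tensor (L L' : LineBundle X) : LineBundle X where
  U x := L.U x ⊓ L'.U x
  mem x := ⟨L.mem x, L'.mem x⟩
  g x y := res (inf_le_inf inf_le_left inf_le_left) (L.g x y) *
    res (inf_le_inf inf_le_right inf_le_right) (L'.g x y)
  g_self x := by simp [L.g_self, L'.g_self]
  cocycle x y z := by
    simp only [map_mul, res_res]
    rw [mul_mul_mul_comm, L.cocycle', L'.cocycle']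

/-- The dual (inverse) of a line bundle. -/
def dual (L : LineBundle X) : LineBundle X where
  U := L.U
  mem := L.mem
  g x y := res (le_inf inf_le_right inf_le_left) (L.g y x)
  g_self x := by simp [L.g_self]
  cocycle x y z := by
    simp only [res_res]
    rw [mul_comm, L.cocycle']

/-- The pull-back of a line bundle along a morphism of schemes. -/
def pullback (f : X ⟶ Y) (L : LineBundle Y) : LineBundle X where
  U x := f ⁻¹ᵁ L.U (f x)
  mem x := L.mem (f x)
  g x y := pull f (le_preimage_inf f inf_le_left inf_le_right) (L.g (f x) (f y))
  g_self x := by rw [L.g_self]; exact map_one _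
  cocycle x y z := by
    have := congrArg (pull f (U := L.U (f x) ⊓ L.U (f y) ⊓ L.U (f z))
      (V := f ⁻¹ᵁ L.U (f x) ⊓ f ⁻¹ᵁ L.U (f y) ⊓ f ⁻¹ᵁ L.U (f z))
      (le_preimage_inf f (le_preimage_inf f (inf_le_left.trans inf_le_left)
        (inf_le_left.trans inf_le_right)) inf_le_right)) (L.cocycle (f x) (f y) (f z))
    rw [map_mul, pull_res, pull_res, pull_res] at this
    exact (congrArg₂ _ (res_pull f _ _ _) (res_pull f _ _ _)).trans
      (this.trans (res_pull f _ _ _).symm)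

theorem res_g_triv (x y : X) {V : X.Opens} (hV : V ≤ (triv X).U x ⊓ (triv X).U y) :
    res hV ((triv X).g x y) = 1 :=
  map_one (res hV)

theorem res_g_tensor (L L' : LineBundle X) (x y : X) {V : X.Opens}
    (hV : V ≤ (L.tensor L').U x ⊓ (L.tensor L').U y) :
    res hV ((L.tensor L').g x y) =
      res (U := L.U x ⊓ L.U y) (hV.trans (inf_le_inf inf_le_left inf_le_left)) (L.g x y) *
      res (U := L'.U x ⊓ L'.U y) (hV.trans (inf_le_inf inf_le_right inf_le_right)) (L'.g x y) :=
  (map_mul (res hV) _ _).trans (congrArg₂ _ (res_res _ _ _) (res_res _ _ _))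

theorem res_g_dual (L : LineBundle X) (x y : X) {V : X.Opens}
    (hV : V ≤ L.dual.U x ⊓ L.dual.U y) :
    res hV (L.dual.g x y) =
      res (U := L.U y ⊓ L.U x) (hV.trans (le_inf inf_le_right inf_le_left)) (L.g y x) :=
  res_res _ _ _

theorem res_g_pullback (f : X ⟶ Y) (L : LineBundle Y) (x y : X) {V : X.Opens}
    (hV : V ≤ (L.pullback f).U x ⊓ (L.pullback f).U y) :
    res hV ((L.pullback f).g x y) =
      pull f (U := L.U (f x) ⊓ L.U (f y))
        (le_preimage_inf f (hV.trans inf_le_left) (hV.trans inf_le_right)) (L.g (f x) (f y)) :=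
  res_pull f _ _ _

theorem Iso.tensor {L₁ L₁' L₂ L₂' : LineBundle X} :
    Iso L₁ L₁' → Iso L₂ L₂' → Iso (L₁.tensor L₂) (L₁'.tensor L₂') := by
  rintro ⟨W, hm, hW, hW', h, H⟩ ⟨W₁, hm₁, hW₁, hW₁', h₁, H₁⟩
  refine ⟨fun x => W x ⊓ W₁ x, fun x => ⟨hm x, hm₁ x⟩, fun x => inf_le_inf (hW x) (hW₁ x),
    fun x => inf_le_inf (hW' x) (hW₁' x),
    fun x => (Units.map (res inf_le_left).toMonoidHom (h x)) *
      (Units.map (res inf_le_right).toMonoidHom (h₁ x)), fun x y => ?_⟩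
  have e := congrArg (res (V := W x ⊓ W₁ x ⊓ (W y ⊓ W₁ y))
    (inf_le_inf inf_le_left inf_le_left)) (H x y)
  have e₁ := congrArg (res (V := W x ⊓ W₁ x ⊓ (W y ⊓ W₁ y))
    (inf_le_inf inf_le_right inf_le_right)) (H₁ x y)
  simp only [res_g_tensor, map_mul, res_res, Units.val_mul, Units.coe_map, MonoidHom.coe_coe,
    RingHom.toMonoidHom_eq_coe] at e e₁ ⊢
  rw [mul_mul_mul_comm, e, e₁, mul_mul_mul_comm]

theorem Iso.dual {L L' : LineBundle X} : Iso L L' → Iso L.dual L'.dual := by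
  rintro ⟨W, hm, hW, hW', h, H⟩
  refine ⟨W, hm, hW, hW', fun x => (h x)⁻¹, fun x y => ?_⟩
  have e1 : res (V := W x ⊓ W y) inf_le_left (h x).1 * res inf_le_left ((h x)⁻¹).1 = 1 := by
    rw [← map_mul, Units.mul_inv, map_one]
  have e2 : res (V := W x ⊓ W y) inf_le_right (h y).1 * res inf_le_right ((h y)⁻¹).1 = 1 := by
    rw [← map_mul, Units.mul_inv, map_one]
  have := congrArg (res (V := W x ⊓ W y) (le_inf inf_le_right inf_le_left)) (H y x)
  simp only [res_g_dual, map_mul, res_res] at this ⊢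
  linear_combination ((res (V := W x ⊓ W y) inf_le_left ((h x)⁻¹).1 *
    res inf_le_right ((h y)⁻¹).1)) * this
    - (res inf_le_right ((h y)⁻¹).1 * res (le_inf (inf_le_right.trans (hW' y))
        (inf_le_left.trans (hW' x))) (L'.g y x)) * e1
    + (res inf_le_left ((h x)⁻¹).1 * res (le_inf (inf_le_right.trans (hW y))
        (inf_le_left.trans (hW x))) (L.g y x)) * e2

theorem Iso.pullback (f : X ⟶ Y) {L L' : LineBundle Y} :
    Iso L L' → Iso (L.pullback f) (L'.pullback f) := by
  rintro ⟨W, hm, hW, hW', h, H⟩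
  refine ⟨fun x => f ⁻¹ᵁ W (f x), fun x => hm (f x), fun x _ hp => hW (f x) hp,
    fun x _ hp => hW' (f x) hp,
    fun x => Units.map (pull f le_rfl).toMonoidHom (h (f x)), fun x y => ?_⟩
  have e := congrArg (pull f (U := W (f x) ⊓ W (f y)) (V := f ⁻¹ᵁ W (f x) ⊓ f ⁻¹ᵁ W (f y))
    (le_preimage_inf f inf_le_left inf_le_right))
    (H (f x) (f y))
  rw [map_mul, map_mul, pull_res, pull_res, pull_res, pull_res] at e
  simp only [res_g_pullback, res_pull, Units.coe_map, MonoidHom.coe_coe,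
    RingHom.toMonoidHom_eq_coe]
  exact e

/-- Two line bundles with the same transition functions after shrinking are isomorphic. -/
theorem Iso.of_g {L L' : LineBundle X} (W : X → X.Opens) (hm : ∀ x, x ∈ W x)
    (hW : ∀ x, W x ≤ L.U x) (hW' : ∀ x, W x ≤ L'.U x)
    (H : ∀ x y, res (V := W x ⊓ W y) (inf_le_inf (hW' x) (hW' y)) (L'.g x y) =
      res (inf_le_inf (hW x) (hW y)) (L.g x y)) : Iso L L' :=
  ⟨W, hm, hW, hW', fun _ => 1, fun x y => by simp [H x y]⟩

instance setoid (X : Scheme.{u}) : Setoid (LineBundle X) where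
  r := Iso
  iseqv := ⟨Iso.refl, Iso.symm, Iso.trans⟩

end LineBundle

/-- The Picard group of a scheme: isomorphism classes of line bundles. -/
def Pic (X : Scheme.{u}) : Type u := Quotient (LineBundle.setoid X)

namespace Pic

variable {X Y : Scheme.{u}}

/-- The isomorphism class of a line bundle. -/
def mk (L : LineBundle X) : Pic X := Quotient.mk _ L

/-- The group structure of the Picard group is given by the tensor product. -/
instance : CommGroup (Pic X) where
  mul := Quotient.map₂ LineBundle.tensor fun _ _ h _ _ h' => LineBundle.Iso.tensor h h'
  one := mk (LineBundle.triv X)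
  inv := Quotient.map LineBundle.dual fun _ _ h => LineBundle.Iso.dual h
  mul_assoc := by
    rintro ⟨L⟩ ⟨L'⟩ ⟨L''⟩
    refine Quotient.sound (LineBundle.Iso.of_g (fun x => L.U x ⊓ L'.U x ⊓ L''.U x)
      (fun x => ⟨⟨L.mem x, L'.mem x⟩, L''.mem x⟩) (fun _ => le_rfl)
      (fun x => (inf_assoc _ _ _).le) fun x y => ?_)
    simp only [LineBundle.res_g_tensor, mul_assoc]
  one_mul := by
    rintro ⟨L⟩
    refine Quotient.sound (LineBundle.Iso.of_g L.U L.mem (fun _ => le_inf le_top le_rfl)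
      (fun x => le_rfl) fun x y => ?_)
    rw [LineBundle.res_g_tensor, LineBundle.res_g_triv, one_mul]
  mul_one := by
    rintro ⟨L⟩
    refine Quotient.sound (LineBundle.Iso.of_g L.U L.mem (fun _ => le_inf le_rfl le_top)
      (fun x => le_rfl) fun x y => ?_)
    rw [LineBundle.res_g_tensor, LineBundle.res_g_triv, mul_one]
  mul_comm := by
    rintro ⟨L⟩ ⟨L'⟩
    refine Quotient.sound (LineBundle.Iso.of_g (fun x => L.U x ⊓ L'.U x)
      (fun x => ⟨L.mem x, L'.mem x⟩) (fun _ => le_rfl)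
      (fun x => (inf_comm _ _).le) fun x y => ?_)
    rw [LineBundle.res_g_tensor, LineBundle.res_g_tensor, mul_comm]
  inv_mul_cancel := by
    rintro ⟨L⟩
    refine Quotient.sound (LineBundle.Iso.of_g L.U L.mem (fun _ => le_inf le_rfl le_rfl)
      (fun x => le_top) fun x y => ?_)
    rw [LineBundle.res_g_tensor, LineBundle.res_g_triv, LineBundle.res_g_dual]
    exact (L.g_mul_g y x _ _).symm

/-- Pull-back of line bundles as a homomorphism of Picard groups. -/
def map (f : X ⟶ Y) : Pic Y →* Pic X where
  toFun := Quotient.map (LineBundle.pullback f) fun _ _ h => LineBundle.Iso.pullback f h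
  map_one' := by
    refine Quotient.sound (LineBundle.Iso.of_g (fun _ => ⊤) (fun _ => trivial)
      (fun _ _ _ => trivial) (fun _ => le_rfl) fun x y => ?_)
    rw [LineBundle.res_g_pullback, LineBundle.res_g_triv]
    exact (map_one _).symm
  map_mul' := by
    rintro ⟨L⟩ ⟨L'⟩
    refine Quotient.sound (LineBundle.Iso.of_g (fun x => f ⁻¹ᵁ (L.U (f x) ⊓ L'.U (f x)))
      (fun x => ⟨L.mem _, L'.mem _⟩)
      (fun _ => le_rfl) (fun _ => le_rfl) fun x y => ?_)
    rw [LineBundle.res_g_pullback, LineBundle.res_g_tensor, LineBundle.res_g_pullback,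
      LineBundle.res_g_pullback]
    exact ((map_mul _ _ _).trans (congrArg₂ _ (pull_res _ _ _ _) (pull_res _ _ _ _))).symm

end Pic

/-- The relative Picard group of `f : D ⟶ S`: line bundles on the total space `D` modulo those
pulled back from the base `S`. -/
abbrev RelPic {D S : Scheme.{u}} (f : D ⟶ S) : Type u := Pic D ⧸ (Pic.map f).range

namespace LineBundle

variable {X Y : Scheme.{u}}

/-- The global sections of a line bundle: a function `s x` on every trivializing open `U x`,
compatible with the transition functions. -/
def sections (L : LineBundle X) : AddSubgroup (∀ x, Γ(X, L.U x)) where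
  carrier := {s | ∀ x y, res (V := L.U x ⊓ L.U y) inf_le_left (s x) =
    L.g x y * res inf_le_right (s y)}
  zero_mem' x y := by simp
  add_mem' hs ht x y := by
    simp only [Pi.add_apply, map_add, hs x y, ht x y, mul_add]
  neg_mem' hs x y := by
    simp only [Pi.neg_apply, map_neg, hs x y, mul_neg]

theorem sections_compat {L : LineBundle X} (s : L.sections) (x y : X) {V : X.Opens}
    (hx : V ≤ L.U x) (hy : V ≤ L.U y) :
    res hx (s.1 x) = res (le_inf hx hy) (L.g x y) * res hy (s.1 y) := by
  have := congrArg (res (le_inf hx hy)) (s.2 x y)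
  simpa only [map_mul, res_res] using this

/-- The pull-back of a section of a line bundle. -/
def pullbackSection (f : X ⟶ Y) {L : LineBundle Y} (s : L.sections) :
    (L.pullback f).sections :=
  ⟨fun x => pull f (V := f ⁻¹ᵁ L.U (f x)) le_rfl (s.1 (f x)), fun x y => by
    have := congrArg (pull f (V := f ⁻¹ᵁ L.U (f x) ⊓ f ⁻¹ᵁ L.U (f y))
      (le_preimage_inf f inf_le_left inf_le_right)) (s.2 (f x) (f y))
    rw [map_mul, pull_res, pull_res] at this
    exact (res_pull f _ _ _).trans (this.trans (congrArg _ (res_pull f _ _ _).symm))⟩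

/-- The product of sections of two line bundles, a section of the tensor product. -/
def mulSection {L L' : LineBundle X} (s : L.sections) (t : L'.sections) :
    (L.tensor L').sections :=
  ⟨fun x => res (U := L.U x) (V := L.U x ⊓ L'.U x) inf_le_left (s.1 x) *
      res (U := L'.U x) (V := L.U x ⊓ L'.U x) inf_le_right (t.1 x), fun x y => by
    have h := congrArg₂ (· * ·)
      (sections_compat s x y (V := L.U x ⊓ L'.U x ⊓ (L.U y ⊓ L'.U y))
        (inf_le_left.trans inf_le_left) (inf_le_right.trans inf_le_left))
      (sections_compat t x y (V := L.U x ⊓ L'.U x ⊓ (L.U y ⊓ L'.U y))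
        (inf_le_left.trans inf_le_right) (inf_le_right.trans inf_le_right))
    refine ((map_mul _ _ _).trans (congrArg₂ _ (res_res _ _ _) (res_res _ _ _))).trans
      (h.trans ((mul_mul_mul_comm _ _ _ _).trans ?_))
    exact congrArg _ ((map_mul _ _ _).trans (congrArg₂ _ (res_res _ _ _) (res_res _ _ _))).symm⟩

/-- The stalk at `z` of the ideal sheaf of the zero scheme of a section: the ideal generated by
the local expression of the section. -/
def zeroStalk {L : LineBundle X} (s : L.sections) (z : X) : Ideal (X.presheaf.stalk z) :=
  Ideal.span {X.presheaf.germ (L.U z) z (L.mem z) (s.1 z)}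

theorem germ_res_eq {U V : X.Opens} (h : V ≤ U) (z : X) (hz : z ∈ V) (a : Γ(X, U)) :
    X.presheaf.germ V z hz (res h a) = X.presheaf.germ U z (h hz) a :=
  X.presheaf.germ_res_apply (homOfLE h) z hz a

/-- The stalk ideal can be computed in any of the trivializations. -/
theorem zeroStalk_eq {L : LineBundle X} (s : L.sections) (y z : X) {V : X.Opens}
    (hV : V ≤ L.U y) (hz : z ∈ V) :
    zeroStalk s z = Ideal.span {X.presheaf.germ V z hz (res hV (s.1 y))} := by
  have hz' : z ∈ L.U z ⊓ L.U y := ⟨L.mem z, hV hz⟩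
  have h1 : X.presheaf.germ (L.U z) z (L.mem z) (s.1 z) =
      X.presheaf.germ (L.U z ⊓ L.U y) z hz' (L.g z y) *
        X.presheaf.germ (L.U y) z (hV hz) (s.1 y) := by
    have := congrArg (X.presheaf.germ (L.U z ⊓ L.U y) z hz') (s.2 z y)
    rwa [map_mul, germ_res_eq, germ_res_eq] at this
  have h2 : IsUnit (X.presheaf.germ (L.U z ⊓ L.U y) z hz' (L.g z y)) := by
    have := congrArg (X.presheaf.germ (L.U z ⊓ L.U y) z hz')
      (L.g_mul_g z y le_rfl (inf_comm _ _).le)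
    rw [map_mul, map_one, germ_res_eq] at this
    exact IsUnit.of_mul_eq_one _ this
  rw [zeroStalk, h1, germ_res_eq, Ideal.span_singleton_mul_left_unit h2]

/-- Sections of the ideal sheaf of the zero scheme over an open `W`. -/
def zeroIdealOn {L : LineBundle X} (s : L.sections) (W : X.Opens) : Ideal Γ(X, W) :=
  ⨅ z : W, (zeroStalk s z.1).comap (X.presheaf.germ W z.1 z.2).hom

theorem mem_zeroIdealOn {L : LineBundle X} (s : L.sections) (W : X.Opens) (a : Γ(X, W)) :
    a ∈ zeroIdealOn s W ↔ ∀ z (hz : z ∈ W), X.presheaf.germ W z hz a ∈ zeroStalk s z := by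
  simp only [zeroIdealOn, Submodule.mem_iInf, Ideal.mem_comap, Subtype.forall]

theorem zeroIdealOn_eq_span {L : LineBundle X} (s : L.sections) (y : X) {W : X.Opens}
    (hW : IsAffineOpen W) (h : W ≤ L.U y) :
    zeroIdealOn s W = Ideal.span {res h (s.1 y)} := by
  apply le_antisymm
  · intro a ha
    rw [hW.mem_ideal_iff]
    intro z hz
    rw [Ideal.map_span, Set.image_singleton]
    have := (mem_zeroIdealOn s W a).1 ha z hz
    rwa [zeroStalk_eq s y z h hz] at this
  · rw [Ideal.span_singleton_le_iff_mem, mem_zeroIdealOn]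
    intro z hz
    rw [zeroStalk_eq s y z h hz]
    exact Ideal.mem_span_singleton_self _

theorem res_mem_zeroIdealOn {L : LineBundle X} (s : L.sections) {V W : X.Opens} (h : V ≤ W)
    {a : Γ(X, W)} (ha : a ∈ zeroIdealOn s W) : res h a ∈ zeroIdealOn s V := by
  rw [mem_zeroIdealOn] at ha ⊢
  intro z hz
  rw [germ_res_eq]
  exact ha z (h hz)

/-- Around every point, a power of `f` moves a function whose restriction to `D(f)` is in the
ideal into the ideal. -/
theorem exists_pow_local {L : LineBundle X} (s : L.sections) {W : X.Opens} (hW : IsAffineOpen W)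
    (f a : Γ(X, W)) (ha : res (X.basicOpen_le f) a ∈ zeroIdealOn s (X.basicOpen f))
    (y : X) (hy : y ∈ W) :
    ∃ (V : X.Opens) (hV : V ≤ W) (N : ℕ), y ∈ V ∧ res hV (f ^ N * a) ∈ zeroIdealOn s V := by
  obtain ⟨h, hh, hyh⟩ := hW.exists_basicOpen_le (V := L.U y) ⟨y, L.mem y⟩ hy
  have hV : X.basicOpen h ≤ W := X.basicOpen_le h
  have hVa : IsAffineOpen (X.basicOpen h) := hW.basicOpen h
  have hle : X.basicOpen (res hV f) ≤ X.basicOpen f := by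
    rw [Scheme.basicOpen_res]; exact inf_le_right
  have ha' := res_mem_zeroIdealOn s hle ha
  rw [zeroIdealOn_eq_span s y (hVa.basicOpen _) ((X.basicOpen_le _).trans hh), res_res] at ha'
  have := hVa.isLocalization_basicOpen (res hV f)
  have key : algebraMap Γ(X, X.basicOpen h) Γ(X, X.basicOpen (res hV f)) (res hV a) ∈
      (Ideal.span {res hh (s.1 y)}).map
        (algebraMap Γ(X, X.basicOpen h) Γ(X, X.basicOpen (res hV f))) := by
    rw [Ideal.map_span, Set.image_singleton]
    change res (X.basicOpen_le _) (res hV a) ∈ Ideal.span {res (X.basicOpen_le _) (res hh (s.1 y))}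
    rw [res_res, res_res]
    exact ha'
  rw [IsLocalization.algebraMap_mem_map_algebraMap_iff (.powers (res hV f))] at key
  obtain ⟨_, ⟨N, rfl⟩, hN⟩ := key
  refine ⟨X.basicOpen h, hV, N, hyh, ?_⟩
  rw [zeroIdealOn_eq_span s y hVa hh, map_mul, map_pow]
  exact hN

theorem exists_pow {L : LineBundle X} (s : L.sections) {W : X.Opens} (hW : IsAffineOpen W)
    (f a : Γ(X, W)) (ha : res (X.basicOpen_le f) a ∈ zeroIdealOn s (X.basicOpen f)) :
    ∃ N : ℕ, f ^ N * a ∈ zeroIdealOn s W := by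
  choose V hV N hmem hN using exists_pow_local s hW f a ha
  obtain ⟨t, hcov⟩ := hW.isCompact.elim_nhds_subcover' (fun y hy => (V y hy : Set X))
    (fun y hy => (V y hy).isOpen.mem_nhds (hmem y hy))
  refine ⟨t.sup fun y => N y.1 y.2, ?_⟩
  rw [mem_zeroIdealOn]
  intro z hz
  obtain ⟨y, hyt, hzy⟩ := Set.mem_iUnion₂.1 (hcov hz)
  have h := (mem_zeroIdealOn s _ _).1 (hN y.1 y.2) z hzy
  rw [germ_res_eq] at h
  obtain ⟨k, hk⟩ := Nat.exists_eq_add_of_le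
    (Finset.le_sup (f := fun y : (W : Set X) => N y.1 y.2) hyt)
  rw [hk, add_comm, pow_add, mul_assoc, map_mul]
  exact Ideal.mul_mem_left _ _ h

theorem zeroIdealOn_quasicoherent {L : LineBundle X} (s : L.sections) (W : X.affineOpens)
    (f : Γ(X, W)) : (zeroIdealOn s W.1).map (res (X.basicOpen_le f)) =
      zeroIdealOn s (X.basicOpen f) := by
  apply le_antisymm
  · rw [Ideal.map_le_iff_le_comap]
    exact fun a ha => res_mem_zeroIdealOn s _ ha
  · intro c hc
    have := W.2.isLocalization_basicOpen f
    obtain ⟨a, ⟨_, m, rfl⟩, rfl⟩ := IsLocalization.exists_mk'_eq (.powers f) c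
    have ha : res (X.basicOpen_le f) a ∈ zeroIdealOn s (X.basicOpen f) := by
      have := Ideal.mul_mem_left _ (algebraMap _ _ (f ^ m)) hc
      have e := IsLocalization.mk'_spec' Γ(X, X.basicOpen f) a
        (⟨f ^ m, m, rfl⟩ : Submonoid.powers f)
      exact (congrArg (· ∈ zeroIdealOn s (X.basicOpen f)) e).mp this
    obtain ⟨N, hN⟩ := exists_pow s W.2 f a ha
    exact (IsLocalization.mk'_mem_map_algebraMap_iff (.powers f) _ _ _ _).2 ⟨f ^ N, ⟨N, rfl⟩, hN⟩

/-- The ideal sheaf of the zero scheme of a section `s` of a line bundle: a function `a` on an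
affine open `W` belongs to it if at every point of `W` the germ of `a` is a multiple of the local
expression of `s`. -/
def zeroIdeal {L : LineBundle X} (s : L.sections) : X.IdealSheafData where
  ideal W := zeroIdealOn s W.1
  map_ideal_basicOpen := zeroIdealOn_quasicoherent s

end LineBundle

/-- The grading of the polynomial ring `ℂ[x₀, …, xₙ₋₁]` by degree. -/
abbrev grading (n : ℕ) : ℕ → Submodule ℂ (MvPolynomial (Fin n) ℂ) :=
  MvPolynomial.homogeneousSubmodule (Fin n) ℂ

instance (n : ℕ) : GradedAlgebra (grading n) := MvPolynomial.gradedAlgebra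

/-- The projective space `ℙⁿ⁻¹ = Proj ℂ[x₀, …, xₙ₋₁]` of lines in `ℂⁿ`. -/
def PSpace (n : ℕ) : Scheme.{0} := Proj (grading n)

/-- The structure morphism of projective space over `ℂ`. -/
def PSpace.toSpec (n : ℕ) : PSpace n ⟶ Spec (.of ℂ) :=
  Proj.toSpecZero (grading n) ≫ Spec.map (CommRingCat.ofHom (algebraMap ℂ (grading n 0)))

namespace PSpace

variable {n : ℕ}

/-- The standard affine chart `xⱼ ≠ 0`. -/
def chart (j : Fin n) : (PSpace n).Opens := Proj.basicOpen (grading n) (MvPolynomial.X j)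

/-- The function `xᵢ / xⱼ` on the chart `xⱼ ≠ 0`. -/
def ratio (i j : Fin n) : Γ(PSpace n, chart j) :=
  Proj.awayToSection (grading n) (MvPolynomial.X j)
    (HomogeneousLocalization.Away.mk (grading n) (d := 1) (MvPolynomial.isHomogeneous_X ℂ j) 1
      (MvPolynomial.X i) (by simpa using MvPolynomial.isHomogeneous_X ℂ i))

theorem exists_chart (y : PSpace n) : ∃ j : Fin n, y ∈ chart j := by
  have h := Proj.iSup_basicOpen_eq_top' (grading n) (fun j => MvPolynomial.X j)
    (fun j => ⟨1, MvPolynomial.isHomogeneous_X ℂ j⟩) (by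
      rw [eq_top_iff]
      intro q _
      induction q using MvPolynomial.induction_on with
      | C c =>
        exact Subalgebra.algebraMap_mem _ (⟨MvPolynomial.C c, MvPolynomial.isHomogeneous_C _ c⟩ :
          grading n 0)
      | add q q' hq hq' => exact add_mem (hq trivial) (hq' trivial)
      | mul_X q j hq => exact mul_mem (hq trivial) (Algebra.subset_adjoin ⟨j, rfl⟩))
  exact Opens.mem_iSup.1 (h.ge (Opens.mem_top y))

/-- A point of projective space as a homogeneous prime ideal. -/
abbrev pt (y : PSpace n) : ProjectiveSpectrum (grading n) := y

/-- The value of a function on projective space in the local ring at a point. -/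
def evalAt {V : (PSpace n).Opens} (a : Γ(PSpace n, V)) (y : PSpace n) (hy : y ∈ V) :
    Localization (pt y).asHomogeneousIdeal.toIdeal.primeCompl :=
  HomogeneousLocalization.val (𝒜 := grading n) (a.1 ⟨y, hy⟩)

theorem evalAt_ext {V : (PSpace n).Opens} {a b : Γ(PSpace n, V)}
    (h : ∀ y (hy : y ∈ V), evalAt a y hy = evalAt b y hy) : a = b :=
  Subtype.ext (funext fun y => HomogeneousLocalization.val_injective _ (h y.1 y.2))

theorem evalAt_one {V : (PSpace n).Opens} (y : PSpace n) (hy : y ∈ V) :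
    evalAt (1 : Γ(PSpace n, V)) y hy = 1 :=
  HomogeneousLocalization.val_one (𝒜 := grading n)

theorem evalAt_mul {V : (PSpace n).Opens} (a b : Γ(PSpace n, V)) (y : PSpace n) (hy : y ∈ V) :
    evalAt (a * b) y hy = evalAt a y hy * evalAt b y hy :=
  HomogeneousLocalization.val_mul (𝒜 := grading n) _ _

theorem evalAt_res {U V : (PSpace n).Opens} (h : V ≤ U) (a : Γ(PSpace n, U)) (y : PSpace n)
    (hy : y ∈ V) : evalAt (res h a) y hy = evalAt a y (h hy) :=
  rfl

theorem evalAt_ratio (i j : Fin n) (y : PSpace n) (hy : y ∈ chart j) :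
    evalAt (ratio i j) y hy = Localization.mk (MvPolynomial.X i) ⟨MvPolynomial.X j, hy⟩ := by
  have h : evalAt (ratio i j) y hy = Localization.mk (MvPolynomial.X i)
      (⟨MvPolynomial.X j ^ 1, Submonoid.pow_mem _ hy 1⟩ :
        (pt y).asHomogeneousIdeal.toIdeal.primeCompl) := rfl
  simpa only [pow_one] using h

theorem ratio_self (j : Fin n) : ratio j j = 1 :=
  evalAt_ext fun y hy => by
    rw [evalAt_ratio, evalAt_one]
    exact Localization.mk_self ⟨_, hy⟩

theorem ratio_mul (i j k : Fin n) {V : (PSpace n).Opens} (hj : V ≤ chart j) (hk : V ≤ chart k) :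
    res hj (ratio i j) = res hj (ratio k j) * res hk (ratio i k) :=
  evalAt_ext fun y hy => by
    rw [evalAt_mul, evalAt_res, evalAt_res, evalAt_res, evalAt_ratio, evalAt_ratio, evalAt_ratio,
      Localization.mk_mul, Localization.mk_eq_mk_iff, Localization.r_iff_exists]
    exact ⟨1, by simp only [Submonoid.coe_mul, OneMemClass.coe_one]; ring⟩

/-- A chart containing the given point. -/
def chartAt (y : PSpace n) : Fin n := (exists_chart y).choose

/-- The line bundle `𝒪(1)` on projective space, trivialized over the chart `xⱼ ≠ 0` by the section
`xⱼ`; the transition functions are `xₖ / xⱼ`. -/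
def twist (n : ℕ) : LineBundle (PSpace n) where
  U y := chart (chartAt y)
  mem y := (exists_chart y).choose_spec
  g y z := res inf_le_left (ratio (chartAt z) (chartAt y))
  g_self y := by rw [ratio_self, map_one]
  cocycle x y z := by
    simp only [res_res]
    exact (ratio_mul _ _ _ _ _).symm

/-- The homogeneous coordinate `xᵢ` as a section of `𝒪(1)`. -/
def coord (i : Fin n) : (twist n).sections :=
  ⟨fun y => ratio i (chartAt y), fun _ _ => ratio_mul _ _ _ _ _⟩

end PSpace

section

variable {X : Scheme.{0}} (p : X ⟶ Spec (.of ℂ))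

/-- `X` is a projective variety over `ℂ`: an integral scheme over `ℂ` which admits a closed
immersion over `ℂ` into a projective space. -/
structure IsProjectiveVariety : Prop where
  isIntegral : IsIntegral X
  exists_closedImmersion : ∃ (n : ℕ) (i : X ⟶ PSpace n), IsClosedImmersion i ∧
    i ≫ PSpace.toSpec n = p

/-- Complex numbers as constant functions on an open subset of a scheme over `ℂ`. -/
def const (U : X.Opens) : ℂ →+* Γ(X, U) :=
  (pull p (U := ⊤) (V := U) (fun _ _ => trivial)).comp (Scheme.ΓSpecIso (.of ℂ)).inv.hom

theorem res_const {U V : X.Opens} (h : V ≤ U) (c : ℂ) : res h (const p U c) = const p V c :=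
  res_pull p (U := ⊤) (fun _ _ => trivial) h _

/-- The complex vector space `H⁰(X, L)` of global sections of a line bundle on a scheme
over `ℂ`. -/
def H0 (_ : X ⟶ Spec (.of ℂ)) (L : LineBundle X) : Type := L.sections

instance (L : LineBundle X) : AddCommGroup (H0 p L) := inferInstanceAs (AddCommGroup L.sections)

instance (L : LineBundle X) : Module ℂ (H0 p L) where
  smul c s := ⟨fun x => const p (L.U x) c * s.1 x, fun x y => by
    rw [map_mul, map_mul, res_const, res_const, s.2 x y, mul_left_comm]⟩
  one_smul s := Subtype.ext (funext fun x => by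
    change const p _ 1 * _ = _
    rw [map_one, one_mul])
  mul_smul a b s := Subtype.ext (funext fun x => by
    change const p _ (a * b) * _ = const p _ a * (const p _ b * _)
    rw [map_mul, mul_assoc])
  smul_zero a := Subtype.ext (funext fun x => mul_zero _)
  smul_add a s t := Subtype.ext (funext fun x => mul_add _ _ _)
  add_smul a b s := Subtype.ext (funext fun x => by
    change const p _ (a + b) * _ = const p _ a * _ + const p _ b * _
    rw [map_add, add_mul])
  zero_smul s := Subtype.ext (funext fun x => by
    change const p _ 0 * _ = 0
    rw [map_zero, zero_mul])

/-- A linear system on a scheme over `ℂ`: a line bundle `L` together with a linear subspace `V` of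
`H⁰(X, L)`; its members are the zero divisors of the nonzero elements of `V`. -/
structure LinearSystem where
  L : LineBundle X
  V : Submodule ℂ (H0 p L)

namespace LinearSystem

variable {p} (D : LinearSystem p)

/-- The linear system is basepoint-free: at every point, some section in `V` does not vanish. -/
def BasepointFree : Prop := ∀ x : X, ∃ s ∈ D.V, x ∈ X.basicOpen (s.1 x)

variable {n : ℕ} (b : Module.Basis (Fin n) ℂ D.V)

/-- The projection from `X × |D|` to `X`. A basis `b₀, …, bₙ₋₁` of `V` identifies the space of lines in
`V`, that is `|D|`, with `ℙⁿ⁻¹`: the point `[a₀ : … : aₙ₋₁]` is the divisor `∑ aᵢ bᵢ = 0`. -/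
def pr1 (p : X ⟶ Spec (.of ℂ)) (n : ℕ) : Limits.pullback p (PSpace.toSpec n) ⟶ X :=
  Limits.pullback.fst _ _

/-- The projection from `X × |D|` to `|D|`. -/
def pr2 (p : X ⟶ Spec (.of ℂ)) (n : ℕ) : Limits.pullback p (PSpace.toSpec n) ⟶ PSpace n :=
  Limits.pullback.snd _ _

/-- The universal section `∑ bᵢ xᵢ` of the line bundle `L ⊠ 𝒪(1)` on `X × |D|`. -/
def universalSection :
    ((D.L.pullback (pr1 p n)).tensor ((PSpace.twist n).pullback (pr2 p n))).sections :=
  ∑ i, LineBundle.mulSection (LineBundle.pullbackSection (pr1 p n) (L := D.L) (b i).1)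
    (LineBundle.pullbackSection (pr2 p n) (PSpace.coord i))

/-- The universal divisor over `|D|`: the closed subscheme of `X × |D|` which is the zero scheme of
the universal section. -/
def universalDivisor : Scheme.{0} := (LineBundle.zeroIdeal (D.universalSection b)).subscheme

/-- The natural morphism from the universal divisor to `X`. -/
def toX : D.universalDivisor b ⟶ X :=
  (LineBundle.zeroIdeal (D.universalSection b)).subschemeι ≫ pr1 p n

/-- The natural morphism from the universal divisor to `|D|`. -/
def toBase : D.universalDivisor b ⟶ PSpace n :=
  (LineBundle.zeroIdeal (D.universalSection b)).subschemeι ≫ pr2 p n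

/-- The natural homomorphism from `Pic X` to the relative Picard group of the universal divisor. -/
def picToRelPic : Pic X →* RelPic (D.toBase b) :=
  (QuotientGroup.mk' _).comp (Pic.map (D.toX b))

end LinearSystem

end

end LinSys

end

/-!
The universal divisor `𝒟` of a basepoint-free linear system with basis `b₀, …, bₙ₋₁` is Zariski
locally over `X` a projective bundle: where `bⱼ` does not vanish, the equation `∑ bᵢ xᵢ = 0`
expresses `xⱼ` by the other coordinates, so over an affine open `W = Spec A` on which the line
bundle is trivial the part of `𝒟` in the chart `xₖ ≠ 0`, `k ≠ j`, is the spectrum of the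
polynomial ring over `A` in the quotients `xᵢ / xₖ`, `i ≠ j, k` (`divEval_bijective`). Charts with
`k ≠ j` cover this part of `𝒟`, and any two charts meet, so `𝒟` is integral as soon as `n ≥ 2`
(`isIntegral_universalDivisor`). For `n = 1` the universal divisor is empty, and `n = 0` is
excluded by basepoint-freeness.

On an integral scheme a line bundle is given by a Cartier divisor, here a family `φ z` of rational
functions which locally is constant up to units of the local rings (`LocPrincipal`, `Represents`).
No normality is assumed on `X`, so that Weil divisors are not available. Instead, `φ` is
trivialized over small opens of `X` as follows. Each chart `xₗ ≠ 0` contains the section on which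
`xᵢ = 0` for all `i ≠ j, l`. Near its point over a given `x ∈ X` the divisor `φ` is principal,
hence it is principal where a polynomial with constant term `1` does not vanish
(`exists_trivialNear`). Seen from another chart `xₖ ≠ 0`, this polynomial becomes monic in `xₗ /
xₖ` after multiplication with a power of `xₗ / xₖ` (`exists_monic_homogenization`). Thus `φ`
becomes an invertible ideal of `B[t]` dividing a monic polynomial, and as in Horrocks' theorem,
but here for rank one and by an elementary argument, such an ideal is principal
(`isPrincipal_of_mul_eq_span_monic`).

So `φ` is given on each of the charts over a small open `W ∋ x` by one rational function. The
quotient of two of these is a unit of `A[xᵢ / xₖ]` after inverting `xₗ / xₖ`, hence a unit of `A`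
times a power of `xₗ / xₖ` (`exists_transition`), and comparison of three charts shows that the
exponent `d` is the same for all pairs. Over `W` the bundle is therefore a twist by the `d`-th
power of the pull-back of `𝒪(-1)`, the exponent does not depend on `W`
(`exists_forall_isTwistOn`), and the remaining factors `κ x` differ by units on open subsets of
`X`: they are the transition functions of a line bundle on `X` (`exists_pic_eq`).
-/

noncomputable section

namespace LinSys

/-! ### Invertible ideals in polynomial rings -/

section Horrocks

open Polynomial IsLocalRing

/-- Let `q` generate the image of `I` in polynomials over the residue field. By Nakayama's lemma for
the finite module `B[X] / I`, the powers of `X` below the degree of `q` generate it, so that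
`I` contains a monic polynomial of that degree. -/
theorem exists_monic_mem_of_isLocalRing {B : Type*} [CommRing B] [IsLocalRing B] {I : Ideal B[X]}
    {F : B[X]} (hF : F.Monic) (hFI : F ∈ I) {q : (ResidueField B)[X]} (hq : q ≠ 0)
    (hI : I.map (mapRingHom (residue B)) = Ideal.span {q}) :
    ∃ g ∈ I, g.Monic ∧ g.natDegree = q.natDegree := by
  set e := q.natDegree with he
  have hsurj : Function.Surjective (mapRingHom (residue B)) :=
    Polynomial.map_surjective _ Ideal.Quotient.mk_surjective
  obtain ⟨q', hq', hqm⟩ : ∃ q', Ideal.span {q'} = Ideal.span {q} ∧ q'.Monic ∧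
      q'.natDegree = e := by
    refine ⟨q * C q.leadingCoeff⁻¹, ?_, monic_mul_leadingCoeff_inv hq,
      natDegree_mul_leadingCoeff_self_inv q⟩
    rw [Ideal.span_singleton_mul_right_unit]
    exact isUnit_C.2 (inv_ne_zero (leadingCoeff_ne_zero.2 hq)).isUnit
  obtain ⟨g₀, hg₀, hg₀d, hg₀m⟩ := lifts_and_natDegree_eq_and_monic
    (f := residue B) (p := q') ((mem_lifts q').2 (hsurj q')) hqm.1
  obtain ⟨i, hi, hiq⟩ : ∃ i ∈ I, mapRingHom (residue B) i = q' :=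
    (Ideal.mem_map_iff_of_surjective _ hsurj).1
      (by rw [hI, ← hq']; exact Ideal.mem_span_singleton_self _)
  have hfin : Module.Finite B (B[X] ⧸ I) := by
    have : Module.Finite B (B[X] ⧸ Ideal.span {F}) := hF.finite_adjoinRoot
    refine Module.Finite.of_surjective (M := B[X] ⧸ Ideal.span {F})
      (Ideal.Quotient.factorₐ B (I := Ideal.span {F}) (J := I)
        ((Ideal.span_singleton_le_iff_mem _).2 hFI)).toLinearMap
      (Ideal.Quotient.factor_surjective ((Ideal.span_singleton_le_iff_mem _).2 hFI))
  let mk : B[X] →ₗ[B] (B[X] ⧸ I) := (Ideal.Quotient.mkₐ B I).toLinearMap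
  have key : (⊤ : Submodule B (B[X] ⧸ I)) ≤ (degreeLT B e).map mk := by
    refine Submodule.le_of_le_smul_of_le_jacobson_bot (I := maximalIdeal B) Module.Finite.fg_top
      (maximalIdeal_le_jacobson _) ?_
    rintro x -
    obtain ⟨p, rfl⟩ := Ideal.Quotient.mk_surjective x
    have hp : p = p %ₘ g₀ + (g₀ - i) * (p /ₘ g₀) + i * (p /ₘ g₀) := by
      conv_lhs => rw [← modByMonic_add_div p g₀]
      ring
    have h0 : mk p = mk (p %ₘ g₀) + mk ((g₀ - i) * (p /ₘ g₀)) := by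
      conv_lhs => rw [hp]
      rw [map_add, map_add]
      have : mk (i * (p /ₘ g₀)) = 0 := Ideal.Quotient.eq_zero_iff_mem.2 (I.mul_mem_right _ hi)
      rw [this, add_zero]
    change mk p ∈ _
    rw [h0]
    refine Submodule.add_mem_sup ⟨_, ?_, rfl⟩ ?_
    · rw [SetLike.mem_coe, mem_degreeLT]
      have := degree_modByMonic_lt p hg₀m
      rwa [degree_eq_natDegree hg₀m.ne_zero, hg₀d, hqm.2] at this
    · have hk : ∀ n, ((g₀ - i) * (p /ₘ g₀)).coeff n ∈ maximalIdeal B := by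
        intro n
        rw [← residue_eq_zero_iff, ← coeff_map, ← coe_mapRingHom, map_mul, map_sub, hiq]
        simp [hg₀]
      generalize (g₀ - i) * (p /ₘ g₀) = r at hk
      rw [r.as_sum_range_C_mul_X_pow, map_sum]
      refine Submodule.sum_mem _ fun n _ => ?_
      rw [← smul_eq_C_mul, map_smul]
      exact Submodule.smul_mem_smul (hk n) trivial
  obtain ⟨r, hr, hrX⟩ := key (show mk (X ^ e) ∈ ⊤ from trivial)
  rw [SetLike.mem_coe, mem_degreeLT] at hr
  refine ⟨X ^ e - r, (Ideal.Quotient.eq).1 hrX.symm, monic_X_pow_sub hr, ?_⟩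
  rw [sub_eq_add_neg, add_comm, natDegree_add_eq_right_of_degree_lt, natDegree_X_pow]
  rwa [degree_neg, degree_X_pow]

/-- Over a local ring, the factors of a principal ideal generated by a monic polynomial are
generated by monic polynomials: the expected degrees of the generators are read off over the
residue field, Nakayama's lemma produces monic elements of these degrees, and their product has to
be the given polynomial. -/
theorem exists_monic_span_eq_of_isLocalRing {B : Type*} [CommRing B] [IsLocalRing B]
    {I J : Ideal B[X]} {F : B[X]} (hF : F.Monic) (hIJ : I * J = Ideal.span {F}) :
    ∃ g : B[X], g.Monic ∧ I = Ideal.span {g} := by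
  have hFm : F ∈ I * J := by
    rw [hIJ]
    exact Ideal.mem_span_singleton_self F
  have hFI : F ∈ I := (Ideal.mul_le_left : I * J ≤ I) hFm
  have hFJ : F ∈ J := (Ideal.mul_le_right : I * J ≤ J) hFm
  obtain ⟨q, hq⟩ : ∃ q, I.map (mapRingHom (residue B)) = Ideal.span {q} :=
    (IsPrincipalIdealRing.principal _).principal
  obtain ⟨q', hq'⟩ : ∃ q, J.map (mapRingHom (residue B)) = Ideal.span {q} :=
    (IsPrincipalIdealRing.principal _).principal
  have hass : Associated (q * q') (F.map (residue B)) := by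
    rw [← Ideal.span_singleton_eq_span_singleton, ← Ideal.span_singleton_mul_span_singleton, ← hq,
      ← hq', ← Ideal.map_mul, hIJ, Ideal.map_span, Set.image_singleton, coe_mapRingHom]
  have hne : q * q' ≠ 0 := fun h => (hF.map (residue B)).ne_zero (by
    rw [h] at hass; exact (associated_zero_iff_eq_zero _).1 hass.symm)
  obtain ⟨g, hgI, hgm, hgd⟩ := exists_monic_mem_of_isLocalRing hF hFI (left_ne_zero_of_mul hne) hq
  obtain ⟨g', hgJ, hgm', hgd'⟩ :=
    exists_monic_mem_of_isLocalRing hF hFJ (right_ne_zero_of_mul hne) hq'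
  have hdvd : F ∣ g * g' := by
    rw [← Ideal.mem_span_singleton, ← hIJ]
    exact Ideal.mul_mem_mul hgI hgJ
  have heq : g * g' = F := by
    refine eq_of_monic_of_dvd_of_natDegree_le hF (hgm.mul hgm') hdvd ?_
    rw [hgm.natDegree_mul hgm', hgd, hgd', ← natDegree_mul (left_ne_zero_of_mul hne)
      (right_ne_zero_of_mul hne), natDegree_eq_of_degree_eq (degree_eq_degree_of_associated hass),
      hF.natDegree_map]
  refine ⟨g, hgm, le_antisymm (fun a ha => ?_) ((Ideal.span_singleton_le_iff_mem _).2 hgI)⟩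
  have : a * g' ∈ Ideal.span {F} := by
    rw [← hIJ]
    exact Ideal.mul_mem_mul ha hgJ
  obtain ⟨c, hc⟩ := Ideal.mem_span_singleton.1 this
  refine Ideal.mem_span_singleton.2 ⟨c, ?_⟩
  refine hgm'.isRegular.right ?_
  change a * g' = g * c * g'
  rw [hc, ← heq]
  ring

attribute [local instance] Polynomial.algebra Polynomial.isLocalization in
/-- Membership in an ideal of `B[X]` can be checked locally on `Spec B`. -/
theorem mem_of_forall_mem_map_localization {B : Type*} [CommRing B] {I : Ideal B[X]} {a : B[X]}
    (h : ∀ (m : Ideal B) [m.IsMaximal], a.map (algebraMap B (Localization.AtPrime m)) ∈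
      I.map (mapRingHom (algebraMap B (Localization.AtPrime m)))) : a ∈ I := by
  have : (Ideal.comap C (I.colon {a})) = ⊤ := by
    by_contra hne
    obtain ⟨m, hm, hle⟩ := Ideal.exists_le_maximal _ hne
    have h1 := h m
    rw [← coe_mapRingHom] at h1
    have h2 := (IsLocalization.algebraMap_mem_map_algebraMap_iff
      (Submonoid.map C m.primeCompl) (Localization.AtPrime m)[X] I a).1 h1
    obtain ⟨_, ⟨b, hb, rfl⟩, hba⟩ := h2
    exact hb (hle (Submodule.mem_colon_singleton.2 hba))
  have h1 : (1 : B) ∈ (Ideal.comap C (I.colon {a})) := this ▸ trivial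
  have := Submodule.mem_colon_singleton.1 h1
  simpa using this

/-- Over a domain `B`, an invertible ideal of `B[t]` containing a monic polynomial is principal:
its monic generator over the fraction field has coefficients in every localization of `B` at a
maximal ideal. -/
theorem isPrincipal_of_mul_eq_span_monic {B : Type*} [CommRing B] [IsDomain B]
    {I J : Ideal B[X]} {F : B[X]} (hF : F.Monic) (hIJ : I * J = Ideal.span {F}) :
    ∃ g : B[X], I = Ideal.span {g} := by
  have base : ∀ {S : Type _} [CommRing S] [IsLocalRing S] (f : B →+* S),
      ∃ g : S[X], g.Monic ∧ I.map (mapRingHom f) = Ideal.span {g} := by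
    intro S _ _ f
    refine exists_monic_span_eq_of_isLocalRing (J := J.map (mapRingHom f)) (hF.map f) ?_
    rw [← Ideal.map_mul, hIJ, Ideal.map_span, Set.image_singleton, coe_mapRingHom]
  let L := FractionRing B
  obtain ⟨gL, hgLm, hgL⟩ := base (algebraMap B L)
  have loc : ∀ (m : Ideal B) [m.IsMaximal], ∃ (ι : Localization.AtPrime m →+* L)
      (g : (Localization.AtPrime m)[X]), Function.Injective ι ∧
      ι.comp (algebraMap B (Localization.AtPrime m)) = algebraMap B L ∧
      I.map (mapRingHom (algebraMap B (Localization.AtPrime m))) = Ideal.span {g} ∧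
      g.map ι = gL := by
    intro m _
    obtain ⟨g, hgm, hg⟩ := base (algebraMap B (Localization.AtPrime m))
    have hu : ∀ s : m.primeCompl, IsUnit (algebraMap B L s) := fun s =>
      IsUnit.mk0 _ fun h => s.2 (by
        rw [(map_eq_zero_iff _ (IsFractionRing.injective B L)).1 h]; exact m.zero_mem)
    have hcomp : (IsLocalization.lift (S := Localization.AtPrime m) hu).comp
        (algebraMap B (Localization.AtPrime m)) = algebraMap B L := IsLocalization.lift_comp hu
    refine ⟨IsLocalization.lift hu, g, (IsLocalization.lift_injective_iff hu).2 fun x y => ?_,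
      hcomp, hg, eq_of_monic_of_associated (hgm.map _) hgLm ?_⟩
    · rw [(IsLocalization.injective _ m.primeCompl_le_nonZeroDivisors).eq_iff,
        (IsFractionRing.injective B L).eq_iff]
    · rw [← Ideal.span_singleton_eq_span_singleton, ← hgL, ← coe_mapRingHom, ← Set.image_singleton,
        ← Ideal.map_span, ← hg, Ideal.map_map, mapRingHom_comp, hcomp]
  have hlift : gL ∈ lifts (algebraMap B L) := by
    rw [lifts_iff_coeff_lifts]
    intro n
    let c : Ideal B :=
      { carrier := {b | algebraMap B L b * gL.coeff n ∈ Set.range (algebraMap B L)}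
        add_mem' := by
          rintro b b' ⟨d, hd⟩ ⟨d', hd'⟩
          exact ⟨d + d', by rw [map_add, map_add, hd, hd', add_mul]⟩
        zero_mem' := ⟨0, by simp⟩
        smul_mem' := by
          rintro r b ⟨d, hd⟩
          exact ⟨r * d, by rw [map_mul, hd, smul_eq_mul, map_mul, mul_assoc]⟩ }
    have hc : c = ⊤ := by
      by_contra hne
      obtain ⟨m, hm, hle⟩ := Ideal.exists_le_maximal _ hne
      obtain ⟨ι, g, -, hι, -, hg⟩ := loc m
      obtain ⟨⟨b, s⟩, hbs⟩ := IsLocalization.surj m.primeCompl (g.coeff n)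
      refine s.2 (hle ⟨b, ?_⟩)
      rw [← hg, coeff_map, ← hι, RingHom.comp_apply, RingHom.comp_apply, ← map_mul, mul_comm, hbs]
    have h1 : (1 : B) ∈ c := hc ▸ trivial
    simpa [c] using h1
  obtain ⟨g, hg⟩ := (mem_lifts _).1 hlift
  have hmap : ∀ (m : Ideal B) [m.IsMaximal],
      I.map (mapRingHom (algebraMap B (Localization.AtPrime m))) =
        (Ideal.span {g}).map (mapRingHom (algebraMap B (Localization.AtPrime m))) := by
    intro m _
    obtain ⟨ι, g', hι, hcomp, hg', hgg⟩ := loc m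
    rw [hg', Ideal.map_span, Set.image_singleton, coe_mapRingHom]
    congr 2
    refine map_injective _ hι ?_
    rw [hgg, map_map, hcomp, hg]
  refine ⟨g, le_antisymm (fun a ha => ?_) (fun a ha => ?_)⟩
  · refine mem_of_forall_mem_map_localization fun m _ => ?_
    rw [← hmap, ← coe_mapRingHom]
    exact Ideal.mem_map_of_mem _ ha
  · refine mem_of_forall_mem_map_localization fun m _ => ?_
    rw [hmap, ← coe_mapRingHom]
    exact Ideal.mem_map_of_mem _ ha

end Horrocks

section MvPoly

open MvPolynomial

variable {A σ : Type*} [CommRing A] [IsDomain A]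

/-- A divisor of a power of a variable is a unit times a power of this variable. -/
theorem exists_eq_C_mul_X_pow {p p' : MvPolynomial σ A} {l : σ} {N : ℕ}
    (h : p * p' = X l ^ N) : ∃ (c : Aˣ) (i : ℕ), p = C (c : A) * X l ^ i := by
  obtain ⟨i, -, hi⟩ := (dvd_prime_pow (X_prime (R := A) (i := l)) N).1 ⟨p', h.symm⟩
  obtain ⟨u, hu⟩ := hi.symm
  obtain ⟨c, hc, hcu⟩ := isUnit_iff_eq_C_of_isReduced.1 u.isUnit
  refine ⟨hc.unit, i, ?_⟩
  rw [← hu, hcu, mul_comm]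
  rfl

end MvPoly

/-! ### Rational functions and Cartier divisors on integral schemes -/

/-- Sheaf gluing for sections that are determined by their images in a fixed ring `R`: an element of
`R` that lifts to a section near every point of `V` lifts to a section over `V`. -/
theorem exists_section_of_local {X : Scheme.{u}} {R : Type*} [CommRing R] {η : X}
    (ρ : ∀ W : X.Opens, η ∈ W → Γ(X, W) →+* R)
    (hres : ∀ (W W' : X.Opens) (h : W' ≤ W) (hW' : η ∈ W') (s : Γ(X, W)),
      ρ W' hW' (res h s) = ρ W (h hW') s)
    (hinj : ∀ W hW, Function.Injective (ρ W hW))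
    {V : X.Opens} (hV : η ∈ V) (a : R)
    (ha : ∀ z ∈ V, ∃ (W : X.Opens) (_ : z ∈ W) (hW : η ∈ W) (s : Γ(X, W)), ρ W hW s = a) :
    ∃ s, ρ V hV s = a := by
  choose! W hz hW s hs using ha
  let U : V → X.Opens := fun z => W z.1 ⊓ V
  have hUη : ∀ z : V, η ∈ U z := fun z => ⟨hW z.1 z.2, hV⟩
  let sf : ∀ z : V, Γ(X, U z) := fun z => res inf_le_left (s z.1)
  have hsf : ∀ z : V, ρ (U z) (hUη z) (sf z) = a := fun z => by
    rw [hres]; exact hs z.1 z.2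
  obtain ⟨t, ht, -⟩ := X.sheaf.existsUnique_gluing' U V (fun z => homOfLE inf_le_right)
    (fun z hz' => Opens.mem_iSup.2 ⟨⟨z, hz'⟩, hz z hz', hz'⟩) sf (by
      intro z z'
      have hη' : η ∈ U z ⊓ U z' := ⟨hUη z, hUη z'⟩
      refine hinj (U z ⊓ U z') hη' ?_
      exact ((hres _ _ inf_le_left hη' (sf z)).trans (hsf z)).trans
        ((hres _ _ inf_le_right hη' (sf z')).trans (hsf z')).symm)
  refine ⟨t, ?_⟩
  have h1 := hres V (U ⟨η, hV⟩) inf_le_right (hUη _) t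
  rw [← h1, ← hsf ⟨η, hV⟩]
  exact congrArg _ (ht ⟨η, hV⟩)

/-- A prime ideal of the ring of functions on an affine open is a point of that open. -/
theorem exists_point_of_isPrime {X : Scheme.{u}} {E : X.Opens} (hE : IsAffineOpen E)
    (P : Ideal Γ(X, E)) [P.IsPrime] :
    ∃ z ∈ E, ∀ r : Γ(X, E), z ∈ X.basicOpen r ↔ r ∉ P := by
  refine ⟨hE.fromSpec ⟨P, inferInstance⟩, ?_, fun r => ?_⟩
  · have := Set.mem_range_self (f := hE.fromSpec) ⟨P, inferInstance⟩
    rwa [hE.range_fromSpec] at this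
  · have := hE.fromSpec_preimage_basicOpen r
    change (⟨P, inferInstance⟩ : PrimeSpectrum Γ(X, E)) ∈ hE.fromSpec ⁻¹ᵁ X.basicOpen r ↔ _
    rw [this]
    rfl

theorem mem_inf {X : Scheme.{u}} {U V : X.Opens} {z : X} (hU : z ∈ U) (hV : z ∈ V) : z ∈ U ⊓ V :=
  ⟨hU, hV⟩

section FunctionField

variable {Y : Scheme.{u}} [IsIntegral Y]

theorem genericPoint_mem {V : Y.Opens} {z : Y} (hz : z ∈ V) : genericPoint Y ∈ V :=
  ((genericPoint_spec Y).mem_open_set_iff V.isOpen).2 ⟨z, trivial, hz⟩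

/-- The rational function defined by a function on a nonempty open subset. -/
def toK (V : Y.Opens) (hV : genericPoint Y ∈ V) : Γ(Y, V) →+* Y.functionField :=
  (Y.presheaf.germ V (genericPoint Y) hV).hom

theorem toK_injective (V : Y.Opens) (hV : genericPoint Y ∈ V) : Function.Injective (toK V hV) :=
  germ_injective_of_isIntegral Y _ hV

theorem toK_res {V W : Y.Opens} (h : W ≤ V) (hW : genericPoint Y ∈ W) (s : Γ(Y, V)) :
    toK W hW (res h s) = toK V (h hW) s :=
  LineBundle.germ_res_eq h _ hW s

/-- The rational functions that are regular at the point `z`. -/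
def regAt (z : Y) : Subring Y.functionField :=
  (algebraMap (Y.presheaf.stalk z) Y.functionField).range

theorem mem_regAt {z : Y} {a : Y.functionField} :
    a ∈ regAt z ↔
      ∃ (V : Y.Opens) (hz : z ∈ V) (s : Γ(Y, V)), toK V (genericPoint_mem hz) s = a := by
  constructor
  · rintro ⟨t, rfl⟩
    obtain ⟨V, hz, s, rfl⟩ := Y.presheaf.exists_germ_eq t
    have : Nonempty V := ⟨⟨z, hz⟩⟩
    exact ⟨V, hz, s, (Scheme.algebraMap_germ_eq_germToFunctionField Y hz s).symm⟩
  · rintro ⟨V, hz, s, rfl⟩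
    have : Nonempty V := ⟨⟨z, hz⟩⟩
    exact ⟨_, Scheme.algebraMap_germ_eq_germToFunctionField Y hz s⟩

theorem toK_mem_regAt {V : Y.Opens} (hV : genericPoint Y ∈ V) (s : Γ(Y, V)) {z : Y} (hz : z ∈ V) :
    toK V hV s ∈ regAt z :=
  mem_regAt.2 ⟨V, hz, s, rfl⟩

/-- A rational function regular at all points of an open subset is a function on it. -/
theorem exists_toK_eq {V : Y.Opens} (hV : genericPoint Y ∈ V) {a : Y.functionField}
    (ha : ∀ z ∈ V, a ∈ regAt z) : ∃ s, toK V hV s = a := by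
  refine exists_section_of_local (η := genericPoint Y) toK (fun _ _ h hW s => toK_res h hW s)
    toK_injective hV a fun z hz => ?_
  obtain ⟨W, hzW, s, hs⟩ := mem_regAt.1 (ha z hz)
  exact ⟨W, hzW, _, s, hs⟩

/-- The rational function `a` is a unit of the local ring at `z`. -/
def UnitAt (z : Y) (a : Y.functionField) : Prop := a ≠ 0 ∧ a ∈ regAt z ∧ a⁻¹ ∈ regAt z

namespace UnitAt

variable {z : Y} {a b : Y.functionField}

theorem one : UnitAt z 1 := ⟨one_ne_zero, one_mem _, by rw [inv_one]; exact one_mem _⟩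

theorem mul (ha : UnitAt z a) (hb : UnitAt z b) : UnitAt z (a * b) :=
  ⟨mul_ne_zero ha.1 hb.1, mul_mem ha.2.1 hb.2.1, by
    rw [mul_inv]; exact mul_mem ha.2.2 hb.2.2⟩

theorem inv (ha : UnitAt z a) : UnitAt z a⁻¹ :=
  ⟨inv_ne_zero ha.1, ha.2.2, by rw [inv_inv]; exact ha.2.1⟩

theorem div (ha : UnitAt z a) (hb : UnitAt z b) : UnitAt z (a / b) := by
  rw [div_eq_mul_inv]; exact ha.mul hb.inv

theorem pow (ha : UnitAt z a) (n : ℕ) : UnitAt z (a ^ n) := by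
  induction n with
  | zero => rw [pow_zero]; exact one
  | succ n ih => rw [pow_succ]; exact ih.mul ha

theorem zpow (ha : UnitAt z a) (n : ℤ) : UnitAt z (a ^ n) := by
  cases n with
  | ofNat n => rw [Int.ofNat_eq_natCast, zpow_natCast]; exact ha.pow n
  | negSucc n => rw [zpow_negSucc]; exact (ha.pow _).inv

end UnitAt

/-- A function is a unit of the local ring at `z` if and only if it does not vanish at `z`. -/
theorem unitAt_toK_iff {V : Y.Opens} (hV : genericPoint Y ∈ V) (s : Γ(Y, V)) {z : Y} (hz : z ∈ V) :
    UnitAt z (toK V hV s) ↔ z ∈ Y.basicOpen s := by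
  rw [Scheme.mem_basicOpen _ _ _ hz]
  have hinj : Function.Injective (algebraMap (Y.presheaf.stalk z) Y.functionField) :=
    IsFractionRing.injective _ _
  have e : algebraMap (Y.presheaf.stalk z) Y.functionField (Y.presheaf.germ V z hz s) =
      toK V hV s := by
    have : Nonempty V := ⟨⟨z, hz⟩⟩
    exact Scheme.algebraMap_germ_eq_germToFunctionField Y hz s
  rw [← e]
  constructor
  · rintro ⟨h0, -, t, ht⟩
    refine IsUnit.of_mul_eq_one t (hinj ?_)
    rw [map_mul, ht, map_one, mul_inv_cancel₀ h0]
  · intro h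
    obtain ⟨u, hu⟩ := h
    rw [← hu]
    refine ⟨(u.isUnit.map _).ne_zero, ⟨_, rfl⟩, ⟨(u⁻¹ : (Y.presheaf.stalk z)ˣ), ?_⟩⟩
    refine eq_inv_of_mul_eq_one_left ?_
    rw [← map_mul, Units.inv_mul, map_one]

theorem UnitAt.of_isUnit {V : Y.Opens} (hV : genericPoint Y ∈ V) {s : Γ(Y, V)} (hs : IsUnit s)
    {z : Y} (hz : z ∈ V) : UnitAt z (toK V hV s) := by
  rw [unitAt_toK_iff hV s hz, Scheme.basicOpen_of_isUnit _ hs]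
  exact hz

/-- A rational function that is a unit at all points of an open subset is an invertible function
on it. -/
theorem exists_units_toK_eq {V : Y.Opens} (hV : genericPoint Y ∈ V) {a : Y.functionField}
    (ha : ∀ z ∈ V, UnitAt z a) : ∃ s : Γ(Y, V)ˣ, toK V hV s = a := by
  obtain ⟨s, hs⟩ := exists_toK_eq hV fun z hz => (ha z hz).2.1
  obtain ⟨t, ht⟩ := exists_toK_eq hV fun z hz => (ha z hz).2.2
  have h : s * t = 1 := toK_injective V hV (by
    rw [map_mul, hs, ht, map_one, mul_inv_cancel₀ (ha _ hV).1])
  exact ⟨⟨s, t, h, by rw [mul_comm, h]⟩, hs⟩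

/-- A rational function regular on the basic open set `D(f)` of an affine open becomes regular on
the whole affine open after multiplication with a power of `f`. -/
theorem exists_pow_mul_eq_toK {E : Y.Opens} (hE : IsAffineOpen E) (hη : genericPoint Y ∈ E)
    (f : Γ(Y, E)) {a : Y.functionField} (ha : ∀ z ∈ Y.basicOpen f, a ∈ regAt z) :
    ∃ (N : ℕ) (r : Γ(Y, E)), toK E hη r = toK E hη f ^ N * a := by
  by_cases hf0 : f = 0
  · exact ⟨1, 0, by rw [hf0, map_zero, pow_one, zero_mul]⟩
  · have hf : genericPoint Y ∈ Y.basicOpen f := by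
      obtain ⟨z, hz⟩ := (Opens.ne_bot_iff_nonempty _).1 (mt (basicOpen_eq_bot_iff f).1 hf0)
      exact genericPoint_mem hz
    obtain ⟨s, rfl⟩ := exists_toK_eq hf ha
    have := hE.isLocalization_basicOpen f
    obtain ⟨⟨r, _, N, rfl⟩, hr⟩ := IsLocalization.surj (.powers f) s
    refine ⟨N, r, ?_⟩
    have h := congrArg (toK _ hf) hr
    rw [map_mul] at h
    have e : ∀ t : Γ(Y, E), toK _ hf (algebraMap Γ(Y, E) Γ(Y, Y.basicOpen f) t) = toK E hη t :=
      fun t => toK_res (Y.basicOpen_le f) hf t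
    rw [e, e, map_pow] at h
    rw [← h, mul_comm]

theorem toK_ne_zero {E : Y.Opens} (hη : genericPoint Y ∈ E) {f : Γ(Y, E)} (hf : f ≠ 0) :
    toK E hη f ≠ 0 :=
  (map_ne_zero_iff _ (toK_injective E hη)).2 hf

/-- A family of nonzero rational functions `φ z`, one for each point, which locally is constant up
to units of the local rings; it represents a Cartier divisor. -/
def LocPrincipal (φ : Y → Y.functionField) : Prop :=
  (∀ z, φ z ≠ 0) ∧ ∀ z, ∃ V : Y.Opens, z ∈ V ∧ ∀ z' ∈ V, UnitAt z' (φ z' / φ z)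

theorem LocPrincipal.inv {φ : Y → Y.functionField} (h : LocPrincipal φ) :
    LocPrincipal fun z => (φ z)⁻¹ := by
  refine ⟨fun z => inv_ne_zero (h.1 z), fun z => ?_⟩
  obtain ⟨V, hz, hV⟩ := h.2 z
  refine ⟨V, hz, fun z' hz' => ?_⟩
  rw [← inv_div_inv, inv_inv, inv_inv, ← inv_div]
  exact (hV z' hz').inv

theorem LocPrincipal.div_const {φ : Y → Y.functionField} (h : LocPrincipal φ)
    {κ : Y.functionField} (hκ : κ ≠ 0) : LocPrincipal fun z => φ z / κ := by
  refine ⟨fun z => div_ne_zero (h.1 z) hκ, fun z => ?_⟩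
  obtain ⟨V, hz, hV⟩ := h.2 z
  refine ⟨V, hz, fun z' hz' => ?_⟩
  rw [div_div_div_cancel_right₀ hκ]
  exact hV z' hz'

/-- A rational function which on the basic open set `D(h)` of an affine open is a section of the
line bundle given by `φ` becomes a section on the whole affine open after multiplication with a
power of `h`. -/
theorem LocPrincipal.exists_pow {φ : Y → Y.functionField} (hφ : LocPrincipal φ) {E : Y.Opens}
    (hE : IsAffineOpen E) (hη : genericPoint Y ∈ E) (h : Γ(Y, E)) {a : Y.functionField}
    (ha : ∀ z ∈ Y.basicOpen h, a / φ z ∈ regAt z) :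
    ∃ N₀ : ℕ, ∀ N, N₀ ≤ N → ∀ z ∈ E, toK E hη h ^ N * a / φ z ∈ regAt z := by
  suffices hs : ∃ N₀ : ℕ, ∀ N, N₀ ≤ N → ∀ z ∈ E, z ∈ (E : Set Y) →
      toK E hη h ^ N * a / φ z ∈ regAt z by
    obtain ⟨N₀, h0⟩ := hs
    exact ⟨N₀, fun N hN z hz => h0 N hN z hz hz⟩
  refine hE.isCompact.induction_on (p := fun S => ∃ N₀ : ℕ, ∀ N, N₀ ≤ N → ∀ z ∈ E, z ∈ S →
    toK E hη h ^ N * a / φ z ∈ regAt z) ⟨0, fun _ _ _ _ h => h.elim⟩ ?_ ?_ ?_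
  · rintro S T hST ⟨N₀, h0⟩
    exact ⟨N₀, fun N hN z hz hzS => h0 N hN z hz (hST hzS)⟩
  · rintro S T ⟨N₀, h0⟩ ⟨N₁, h1⟩
    refine ⟨max N₀ N₁, fun N hN z hz hzST => ?_⟩
    rcases hzST with hzS | hzT
    · exact h0 N ((le_max_left _ _).trans hN) z hz hzS
    · exact h1 N ((le_max_right _ _).trans hN) z hz hzT
  · intro z₀ hz₀
    obtain ⟨V, hz₀V, hV⟩ := hφ.2 z₀
    obtain ⟨g, hgV, hz₀g⟩ := hE.exists_basicOpen_le ⟨z₀, hz₀V⟩ hz₀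
    have hreg : ∀ z ∈ Y.basicOpen (h * g), a / φ z₀ ∈ regAt z := by
      intro z hz
      rw [Scheme.basicOpen_mul] at hz
      have := mul_mem (ha z hz.1) (hV z (hgV hz.2)).2.1
      rwa [div_mul_div_cancel₀ (hφ.1 z)] at this
    obtain ⟨N₀, r, hr⟩ := exists_pow_mul_eq_toK hE hη (h * g) hreg
    refine ⟨Y.basicOpen g, mem_nhdsWithin_of_mem_nhds ((Y.basicOpen g).isOpen.mem_nhds hz₀g), N₀,
      fun N hN z hz hzg => ?_⟩
    have hg : UnitAt z (toK E hη g) := (unitAt_toK_iff hη g hz).2 hzg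
    have h1 := mul_mem (mul_mem (mul_mem (toK_mem_regAt hη r hz) (hg.pow N₀).2.2)
      (hV z (hgV hzg)).2.2) (toK_mem_regAt hη (h ^ (N - N₀)) hz)
    have e : toK E hη h ^ N = toK E hη h ^ N₀ * toK E hη h ^ (N - N₀) := by
      rw [← pow_add, Nat.add_sub_cancel' hN]
    convert h1 using 1
    rw [hr, map_mul, mul_pow, map_pow, e]
    have := hg.1
    have := hφ.1 z
    have := hφ.1 z₀
    field_simp

/-- Sections of the line bundle given by a Cartier divisor `φ` and of its inverse over an affine
open `E`: if `φ` is trivial on `D(f)`, then after multiplication with a power of `f` they become two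
ideals whose product is generated by a power of `f`. If the first one is principal, then
`φ` is trivial on `E`. -/
theorem LocPrincipal.exists_ideals {φ : Y → Y.functionField} (hφ : LocPrincipal φ) {E : Y.Opens}
    (hE : IsAffineOpen E) (hη : genericPoint Y ∈ E) {f : Γ(Y, E)} (hf : f ≠ 0)
    (h1 : ∀ z ∈ Y.basicOpen f, UnitAt z (φ z)) :
    ∃ (I J : Ideal Γ(Y, E)) (N : ℕ), I * J = Ideal.span {f ^ N} ∧
      ∀ g, I = Ideal.span {g} → ∃ κ : Y.functionField, κ ≠ 0 ∧ ∀ z ∈ E, UnitAt z (φ z / κ) := by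
  obtain ⟨N₁, hN₁⟩ := hφ.exists_pow hE hη f (a := 1) fun z hz => by
    rw [one_div]; exact (h1 z hz).2.2
  obtain ⟨N₂, hN₂⟩ := hφ.inv.exists_pow hE hη f (a := 1) fun z hz => by
    rw [one_div, inv_inv]; exact (h1 z hz).2.1
  set N := max N₁ N₂ with hN
  set F := toK E hη f ^ N with hF
  have hF0 : F ≠ 0 := pow_ne_zero _ (toK_ne_zero hη hf)
  have hFφ : ∀ z ∈ E, F / φ z ∈ regAt z := fun z hz => by
    simpa using hN₁ N (le_max_left _ _) z hz
  have hFφ' : ∀ z ∈ E, F * φ z ∈ regAt z := fun z hz => by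
    simpa using hN₂ N (le_max_right _ _) z hz
  let I : Ideal Γ(Y, E) :=
    { carrier := {r | ∀ z ∈ E, toK E hη r / (F * φ z) ∈ regAt z}
      add_mem' := fun {r s} hr hs z hz => by
        rw [map_add, add_div]; exact add_mem (hr z hz) (hs z hz)
      zero_mem' := fun z _ => by rw [map_zero, zero_div]; exact zero_mem _
      smul_mem' := fun c r hr z hz => by
        rw [smul_eq_mul, map_mul, mul_div_assoc]
        exact mul_mem (toK_mem_regAt hη c hz) (hr z hz) }
  let J : Ideal Γ(Y, E) :=
    { carrier := {r | ∀ z ∈ E, toK E hη r * φ z / F ∈ regAt z}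
      add_mem' := fun {r s} hr hs z hz => by
        rw [map_add, add_mul, add_div]; exact add_mem (hr z hz) (hs z hz)
      zero_mem' := fun z _ => by rw [map_zero, zero_mul, zero_div]; exact zero_mem _
      smul_mem' := fun c r hr z hz => by
        rw [smul_eq_mul, map_mul, mul_assoc, mul_div_assoc]
        exact mul_mem (toK_mem_regAt hη c hz) (hr z hz) }
  -- near any point `z`, multiples of `f ^ N * φ z` by powers of a function not vanishing at `z`
  -- are elements of `I`
  have hI : ∀ z ∈ E, ∀ g : Γ(Y, E), (∀ z' ∈ Y.basicOpen g, UnitAt z' (φ z' / φ z)) →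
      ∃ N₀, ∀ M, N₀ ≤ M → ∃ r ∈ I, toK E hη r = toK E hη g ^ M * (F * φ z) := by
    intro z hz g hg
    obtain ⟨N₀, h0⟩ := hφ.exists_pow hE hη g (a := φ z) fun z' hz' => by
      rw [← inv_div]; exact (hg z' hz').2.2
    refine ⟨N₀, fun M hM => ?_⟩
    obtain ⟨r, hr⟩ := exists_toK_eq (V := E) hη (a := toK E hη g ^ M * (F * φ z)) fun z' hz' => by
      have := mul_mem (h0 M hM z' hz') (hFφ' z' hz')
      convert this using 1
      have := hφ.1 z'
      field_simp
    refine ⟨r, fun z' hz' => ?_, hr⟩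
    rw [hr]
    convert h0 M hM z' hz' using 1
    have := hφ.1 z'
    field_simp
  have hJ : ∀ z ∈ E, ∀ g : Γ(Y, E), (∀ z' ∈ Y.basicOpen g, UnitAt z' (φ z' / φ z)) →
      ∃ N₀, ∀ M, N₀ ≤ M → ∃ r ∈ J, toK E hη r = toK E hη g ^ M * (F / φ z) := by
    intro z hz g hg
    obtain ⟨N₀, h0⟩ := hφ.inv.exists_pow hE hη g (a := (φ z)⁻¹) fun z' hz' => by
      convert (hg z' hz').2.1 using 1
      field_simp
    refine ⟨N₀, fun M hM => ?_⟩
    obtain ⟨r, hr⟩ := exists_toK_eq (V := E) hη (a := toK E hη g ^ M * (F / φ z)) fun z' hz' => by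
      have := mul_mem (h0 M hM z' hz') (hFφ z' hz')
      convert this using 1
      have := hφ.1 z'
      field_simp
    refine ⟨r, fun z' hz' => ?_, hr⟩
    rw [hr]
    convert h0 M hM z' hz' using 1
    have := hφ.1 z'
    have := hφ.1 z
    field_simp
  have hloc : ∀ z ∈ E, ∃ g : Γ(Y, E), z ∈ Y.basicOpen g ∧
      ∀ z' ∈ Y.basicOpen g, UnitAt z' (φ z' / φ z) := by
    intro z hz
    obtain ⟨V, hzV, hV⟩ := hφ.2 z
    obtain ⟨g, hgV, hzg⟩ := hE.exists_basicOpen_le ⟨z, hzV⟩ hz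
    exact ⟨g, hzg, fun z' hz' => hV z' (hgV hz')⟩
  have hIJ : I * J = Ideal.span {f ^ (N + N)} := by
    refine le_antisymm (Ideal.mul_le.2 fun r hr s hs => ?_) ?_
    · obtain ⟨t, ht⟩ := exists_toK_eq (V := E) hη
        (a := toK E hη r * toK E hη s / (F * F)) fun z hz => by
          convert mul_mem (hr z hz) (hs z hz) using 1
          have := hφ.1 z
          field_simp
      refine Ideal.mem_span_singleton.2 ⟨t, toK_injective E hη ?_⟩
      rw [map_mul, map_mul, ht, map_pow, pow_add, ← hF, mul_div_cancel₀]
      exact mul_ne_zero hF0 hF0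
    · rw [Ideal.span_singleton_le_iff_mem]
      by_contra hne
      have hne' : (I * J).colon {f ^ (N + N)} ≠ ⊤ := fun h => hne (by
        have := Submodule.mem_colon_singleton.1 (h ▸ trivial :
          (1 : Γ(Y, E)) ∈ (I * J).colon {f ^ (N + N)})
        simpa using this)
      obtain ⟨m, hm, hle⟩ := Ideal.exists_le_maximal _ hne'
      obtain ⟨z, hz, hzm⟩ := exists_point_of_isPrime hE m
      obtain ⟨g, hzg, hg⟩ := hloc z hz
      obtain ⟨M₁, hM₁⟩ := hI z hz g hg
      obtain ⟨M₂, hM₂⟩ := hJ z hz g hg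
      obtain ⟨r, hrI, hr⟩ := hM₁ (max M₁ M₂) (le_max_left _ _)
      obtain ⟨s, hsJ, hs⟩ := hM₂ (max M₁ M₂) (le_max_right _ _)
      have hrs : g ^ (max M₁ M₂ + max M₁ M₂) * f ^ (N + N) = r * s := by
        refine toK_injective E hη ?_
        rw [map_mul, map_mul, hr, hs, map_pow, map_pow, pow_add, pow_add, ← hF]
        have := hφ.1 z
        field_simp
      refine (hzm g).1 hzg (hm.isPrime.mem_of_pow_mem (max M₁ M₂ + max M₁ M₂)
        (hle (Submodule.mem_colon_singleton.2 ?_)))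
      rw [smul_eq_mul, hrs]
      exact Ideal.mul_mem_mul hrI hsJ
  refine ⟨I, J, N + N, hIJ, fun g hg => ?_⟩
  have hgI : g ∈ I := by rw [hg]; exact Ideal.mem_span_singleton_self g
  have hg0 : g ≠ 0 := by
    rintro rfl
    rw [Ideal.span_singleton_zero] at hg
    rw [hg, Ideal.bot_mul] at hIJ
    exact pow_ne_zero (N + N) hf (Ideal.span_singleton_eq_bot.1 hIJ.symm)
  have hgK := toK_ne_zero hη hg0
  refine ⟨toK E hη g / F, div_ne_zero hgK hF0, fun z hz => ⟨div_ne_zero (hφ.1 z)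
    (div_ne_zero hgK hF0), ?_, ?_⟩⟩
  · obtain ⟨h, hzh, hh⟩ := hloc z hz
    obtain ⟨M, hM⟩ := hI z hz h hh
    obtain ⟨r, hrI, hr⟩ := hM M le_rfl
    rw [hg] at hrI
    obtain ⟨c, hc⟩ := Ideal.mem_span_singleton.1 hrI
    have hu := ((unitAt_toK_iff hη h hz).2 hzh).pow M
    convert mul_mem hu.2.2 (toK_mem_regAt hη c hz) using 1
    rw [hc, map_mul] at hr
    have := hu.1
    field_simp
    linear_combination -hr
  · convert hgI z hz using 1
    have := hφ.1 z
    field_simp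

/-- The line bundle `L` on an integral scheme is represented by the family `φ` of rational
functions: its transition functions are the quotients `φ x / φ y`. -/
def Represents (L : LineBundle Y) (φ : Y → Y.functionField) : Prop :=
  (∀ x, φ x ≠ 0) ∧ ∀ x y, toK (L.U x ⊓ L.U y)
    (mem_inf (genericPoint_mem (L.mem x)) (genericPoint_mem (L.mem y))) (L.g x y) = φ x / φ y

/-- The rational functions are the transition functions to the trivialization at the generic
point. -/
theorem exists_represents (L : LineBundle Y) : ∃ φ, Represents L φ := by
  let o := genericPoint Y
  have hm : ∀ x, genericPoint Y ∈ L.U x := fun x => genericPoint_mem (L.mem x)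
  refine ⟨fun x => toK (L.U x ⊓ L.U o) (mem_inf (hm x) (hm o)) (L.g x o), fun x h => ?_,
    fun x y => ?_⟩
  · have := congrArg (toK (L.U x ⊓ L.U o) (mem_inf (hm x) (hm o)))
      (L.g_mul_g x o le_rfl (inf_comm _ _).le)
    rw [map_mul, toK_res, map_one] at this
    exact left_ne_zero_of_mul_eq_one this h
  · have h0 := congrArg (toK (L.U y ⊓ L.U o) (mem_inf (hm y) (hm o)))
      (L.g_mul_g y o le_rfl (inf_comm _ _).le)
    rw [map_mul, toK_res, map_one] at h0
    have h1 := congrArg (toK (L.U x ⊓ L.U y ⊓ L.U o) (mem_inf (mem_inf (hm x) (hm y)) (hm o)))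
      (L.cocycle x y o)
    rw [map_mul, toK_res, toK_res, toK_res] at h1
    rw [eq_div_iff (left_ne_zero_of_mul_eq_one h0)]
    exact h1

namespace Represents

variable {L L' : LineBundle Y} {φ φ' : Y → Y.functionField}

theorem triv : Represents (LineBundle.triv Y) 1 :=
  ⟨fun _ => one_ne_zero, fun x y => by
    rw [Pi.one_apply, Pi.one_apply, div_one]
    exact map_one _⟩

theorem tensor (h : Represents L φ) (h' : Represents L' φ') :
    Represents (L.tensor L') (φ * φ') := by
  refine ⟨fun x => mul_ne_zero (h.1 x) (h'.1 x), fun x y => ?_⟩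
  rw [Pi.mul_apply, Pi.mul_apply, mul_div_mul_comm, ← h.2, ← h'.2]
  exact (map_mul _ _ _).trans (congrArg₂ _ (toK_res _ _ _) (toK_res _ _ _))

theorem dual (h : Represents L φ) : Represents L.dual φ⁻¹ := by
  refine ⟨fun x => inv_ne_zero (h.1 x), fun x y => ?_⟩
  rw [Pi.inv_apply, Pi.inv_apply, inv_div_inv, ← h.2]
  exact toK_res _ _ _

theorem locPrincipal (h : Represents L φ) : LocPrincipal φ := by
  refine ⟨h.1, fun z => ⟨L.U z, L.mem z, fun z' hz' => ?_⟩⟩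
  rw [← h.2]
  exact UnitAt.of_isUnit _ (IsUnit.of_mul_eq_one _ (by
    have := L.g_mul_g z' z le_rfl (inf_comm _ _).le
    rwa [show res le_rfl (L.g z' z) = L.g z' z from
      congrArg (fun f => f.hom (L.g z' z)) (Y.presheaf.map_id _)] at this)) (mem_inf (L.mem z') hz')

end Represents

theorem UnitAt.exists_units {z : Y} {a : Y.functionField} (h : UnitAt z a) :
    ∃ (V : Y.Opens) (hz : z ∈ V) (s : Γ(Y, V)ˣ), toK V (genericPoint_mem hz) s = a := by
  obtain ⟨V, hz, s, rfl⟩ := mem_regAt.1 h.2.1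
  have hzs := (unitAt_toK_iff _ s hz).1 h
  refine ⟨Y.basicOpen s, hzs, (RingedSpace.isUnit_res_basicOpen _ s).unit, ?_⟩
  exact toK_res (Y.basicOpen_le s) _ s

/-- Families of rational functions that agree up to units of the local rings and a common factor
represent isomorphic line bundles. -/
theorem Represents.iso {L L' : LineBundle Y} {φ φ' : Y → Y.functionField} (hL : Represents L φ)
    (hL' : Represents L' φ') {κ : Y.functionField} (hκ : ∀ z, UnitAt z (φ' z / (κ * φ z))) :
    LineBundle.Iso L L' := by
  choose V hV s hs using fun z => (hκ z).exists_units
  have hm : ∀ z, z ∈ V z ⊓ (L.U z ⊓ L'.U z) := fun z => ⟨hV z, L.mem z, L'.mem z⟩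
  refine ⟨fun z => V z ⊓ (L.U z ⊓ L'.U z), hm, fun z => inf_le_right.trans inf_le_left,
    fun z => inf_le_right.trans inf_le_right,
    fun z => Units.map (res inf_le_left).toMonoidHom (s z), fun x y => ?_⟩
  refine toK_injective _ (mem_inf (genericPoint_mem (hm x)) (genericPoint_mem (hm y))) ?_
  simp only [Units.coe_map, MonoidHom.coe_coe, RingHom.toMonoidHom_eq_coe, map_mul, toK_res,
    hL.2, hL'.2, hs]
  have h1 := hL.1 x
  have h2 := hL.1 y
  have h3 := hL'.1 x
  have h4 := hL'.1 y
  have h5 : κ ≠ 0 := by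
    rintro rfl
    exact (hκ x).1 (by simp)
  field_simp

/-- The family `φ` represents a line bundle in the class `c`. -/
def PicRepresents (c : Pic Y) (φ : Y → Y.functionField) : Prop :=
  ∃ L, Pic.mk L = c ∧ Represents L φ

namespace PicRepresents

variable {c c' : Pic Y} {φ φ' : Y → Y.functionField}

theorem one : PicRepresents (1 : Pic Y) 1 := ⟨_, rfl, .triv⟩

theorem mul : PicRepresents c φ → PicRepresents c' φ' → PicRepresents (c * c') (φ * φ') := by
  rintro ⟨L, rfl, h⟩ ⟨L', rfl, h'⟩
  exact ⟨_, rfl, h.tensor h'⟩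

theorem inv : PicRepresents c φ → PicRepresents c⁻¹ φ⁻¹ := by
  rintro ⟨L, rfl, h⟩
  exact ⟨_, rfl, h.dual⟩

theorem pow (h : PicRepresents c φ) (n : ℕ) : PicRepresents (c ^ n) (φ ^ n) := by
  induction n with
  | zero => rw [pow_zero, pow_zero]; exact one
  | succ n ih => rw [pow_succ, pow_succ]; exact ih.mul h

theorem zpow (h : PicRepresents c φ) (n : ℤ) : PicRepresents (c ^ n) (φ ^ n) := by
  cases n with
  | ofNat n => rw [Int.ofNat_eq_natCast, zpow_natCast, zpow_natCast]; exact h.pow n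
  | negSucc n => rw [zpow_negSucc, zpow_negSucc]; exact (h.pow _).inv

/-- Representing families that agree up to units of the local rings and a common factor belong to
the same class. -/
theorem eq (h : PicRepresents c φ) (h' : PicRepresents c' φ') {κ : Y.functionField}
    (hκ : ∀ z, UnitAt z (φ' z / (κ * φ z))) : c = c' := by
  obtain ⟨L, rfl, h⟩ := h
  obtain ⟨L', rfl, h'⟩ := h'
  exact Quotient.sound (h.iso h' hκ)

end PicRepresents

end FunctionField

/-! ### Functions on the standard charts of projective space -/

/-- Functions pulled back from the base `Spec R`, read off from a factorization of the structure
morphism over the open `U`. -/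
theorem appLE_eq_of_ι_comp_eq {Y : Scheme.{u}} {R : CommRingCat.{u}} (f : Y ⟶ Spec R) (U : Y.Opens)
    (g : R ⟶ Γ(Y, U)) (h : U.ι ≫ f = U.toSpecΓ ≫ Spec.map g) :
    (Scheme.ΓSpecIso R).inv ≫ f.appLE ⊤ U (fun _ _ => trivial) = g := by
  have h1 := congrArg (fun φ => (Scheme.ΓSpecIso R).inv ≫ φ.appTop ≫ U.topIso.hom) h
  simp only [Scheme.Hom.comp_appTop, Scheme.Opens.toSpecΓ_appTop, Category.assoc, Iso.inv_hom_id,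
    Category.comp_id] at h1
  rw [← Scheme.ΓSpecIso_inv_naturality_assoc] at h1
  have h2 := h1.trans ((congrArg (g ≫ ·) (Iso.inv_hom_id _)).trans (Category.comp_id g))
  rw [← h2]
  congr 1
  simp only [Scheme.Hom.appLE, Scheme.Opens.topIso_hom, Scheme.Opens.ι_appTop]
  exact congrArg (f.appTop ≫ ·) (Y.presheaf.map_comp _ _)

/-- The structure morphism of `Proj` over an affine base, on a basic open set, in terms of rings. -/
theorem ι_toSpecZero_comp {σ A : Type u} [CommRing A] [SetLike σ A] [AddSubgroupClass σ A]
    (𝒜 : ℕ → σ) [GradedRing 𝒜] {f : A} {m : ℕ} (hf : f ∈ 𝒜 m) (hm : 0 < m) {R : CommRingCat.{u}}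
    (g : R ⟶ CommRingCat.of (𝒜 0)) :
    (Proj.basicOpen 𝒜 f).ι ≫ Proj.toSpecZero 𝒜 ≫ Spec.map g =
      (Proj.basicOpen 𝒜 f).toSpecΓ ≫ Spec.map (g ≫ CommRingCat.ofHom
        (HomogeneousLocalization.fromZeroRingHom 𝒜 (.powers f)) ≫ Proj.awayToSection 𝒜 f) := by
  have := Proj.awayι_toSpecZero 𝒜 f hf hm
  rw [← Proj.basicOpenIsoSpec_inv_ι, Category.assoc, Iso.inv_comp_eq,
    Proj.basicOpenIsoSpec_hom] at this
  rw [← Category.assoc, this, Proj.basicOpenToSpec]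
  simp only [Spec.map_comp, Category.assoc]

theorem pow_mul_eval₂_of_isHomogeneous {σ R S : Type*} [CommRing R] [CommRing S] (f : R →+* S)
    (g : σ → S) (u : S) {m : ℕ} {x : MvPolynomial σ R} (hx : x.IsHomogeneous m) :
    u ^ m * x.eval₂ f g = x.eval₂ f fun i => u * g i := by
  rw [MvPolynomial.eval₂_eq, MvPolynomial.eval₂_eq, Finset.mul_sum]
  refine Finset.sum_congr rfl fun d hd => ?_
  rw [hx.degree_eq_sum_deg_support hd, ← Finset.prod_pow_eq_pow_sum]
  simp only [mul_pow, Finset.prod_mul_distrib]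
  ring

/-- The quotient `x / f ^ m` is the polynomial `x` evaluated at the quotients of the variables by
`f`. -/
theorem Away_eval₂_eq_mk {n : ℕ} {f : MvPolynomial (Fin n) ℂ} (hf : f ∈ grading n 1)
    (hX : ∀ i, MvPolynomial.X i ∈ grading n (1 • 1)) {m : ℕ} {x : MvPolynomial (Fin n) ℂ}
    (hx : x ∈ grading n (m • 1)) :
    MvPolynomial.eval₂ ((HomogeneousLocalization.fromZeroRingHom (grading n) (.powers f)).comp
      (algebraMap ℂ (grading n 0))) (fun i => HomogeneousLocalization.Away.mk (grading n) hf 1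
        (MvPolynomial.X i) (hX i)) x = HomogeneousLocalization.Away.mk (grading n) hf m x hx := by
  refine HomogeneousLocalization.val_injective _ ?_
  rw [HomogeneousLocalization.Away.val_mk, ← HomogeneousLocalization.algebraMap_apply,
    MvPolynomial.hom_eval₂, Localization.mk_eq_mk', IsLocalization.eq_mk'_iff_mul_eq, mul_comm]
  have hx' : x.IsHomogeneous m := by rwa [smul_eq_mul, mul_one] at hx
  simp only [map_pow]
  rw [pow_mul_eval₂_of_isHomogeneous _ _ _ hx']
  have h1 : ∀ i : Fin n, algebraMap _ (Localization (.powers f)) f *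
      algebraMap _ (Localization (.powers f))
      (HomogeneousLocalization.Away.mk (grading n) hf 1 (MvPolynomial.X i) (hX i)) =
      algebraMap _ (Localization (.powers f)) (MvPolynomial.X i : MvPolynomial (Fin n) ℂ) := by
    intro i
    rw [HomogeneousLocalization.algebraMap_apply, HomogeneousLocalization.Away.val_mk,
      Localization.mk_eq_mk', mul_comm]
    have := IsLocalization.mk'_spec (Localization (.powers f)) (MvPolynomial.X i : MvPolynomial _ ℂ)
      (⟨f ^ 1, 1, rfl⟩ : Submonoid.powers f)
    rw [← this]
    simp only [pow_one]
  simp only [h1]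
  have h2 := MvPolynomial.hom_eval₂ x MvPolynomial.C (algebraMap _ (Localization (.powers f)))
    MvPolynomial.X
  rw [MvPolynomial.eval₂_eta] at h2
  rw [h2]
  congr 1

namespace PSpace

variable {n : ℕ}

theorem X_mem_grading (k : Fin n) : (MvPolynomial.X k : MvPolynomial (Fin n) ℂ) ∈ grading n 1 :=
  MvPolynomial.isHomogeneous_X ℂ k

theorem X_mem_grading_smul (k : Fin n) :
    (MvPolynomial.X k : MvPolynomial (Fin n) ℂ) ∈ grading n (1 • 1) :=
  MvPolynomial.isHomogeneous_X ℂ k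

/-- The isomorphism between the degree zero part of the localization of the polynomial ring at
`xₖ` and the ring of functions on the chart `xₖ ≠ 0`. -/
def awayEquiv (k : Fin n) :
    HomogeneousLocalization.Away (grading n) (MvPolynomial.X k : MvPolynomial (Fin n) ℂ) ≃+*
      Γ(PSpace n, chart k) :=
  (Proj.basicOpenIsoAway (grading n) (MvPolynomial.X k)
    (X_mem_grading k) zero_lt_one).commRingCatIsoToRingEquiv

/-- Constant functions in the localization of the polynomial ring. -/
def awayConst (k : Fin n) : ℂ →+* HomogeneousLocalization.Away (grading n)
    (MvPolynomial.X k : MvPolynomial (Fin n) ℂ) :=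
  (HomogeneousLocalization.fromZeroRingHom (grading n) (.powers (MvPolynomial.X k))).comp
      (algebraMap ℂ (grading n 0))

/-- The quotient `xᵢ / xₖ` in the localization of the polynomial ring. -/
def awayRatio (i k : Fin n) : HomogeneousLocalization.Away (grading n)
    (MvPolynomial.X k : MvPolynomial (Fin n) ℂ) :=
  HomogeneousLocalization.Away.mk (grading n) (X_mem_grading k) 1 (MvPolynomial.X i)
    (X_mem_grading_smul i)

theorem const_chart (k : Fin n) (c : ℂ) :
    const (PSpace.toSpec n) (chart k) c = awayEquiv k (awayConst k c) :=
  congrArg (fun φ => φ.hom c) (appLE_eq_of_ι_comp_eq (PSpace.toSpec n) (chart k)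
    (CommRingCat.ofHom (algebraMap ℂ (grading n 0)) ≫ CommRingCat.ofHom
      (HomogeneousLocalization.fromZeroRingHom (grading n) (.powers (MvPolynomial.X k))) ≫
        Proj.awayToSection (grading n) (MvPolynomial.X k))
    (ι_toSpecZero_comp (grading n) (X_mem_grading k) zero_lt_one _))

theorem ratio_eq (i k : Fin n) : ratio i k = awayEquiv k (awayRatio i k) := rfl

/-- The functions on a standard chart are the polynomials in the ratios of the coordinates. -/
theorem exists_eval₂_ratio (k : Fin n) (a : Γ(PSpace n, chart k)) :
    ∃ x, MvPolynomial.eval₂ (const (PSpace.toSpec n) (chart k)) (fun i => ratio i k) x = a := by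
  obtain ⟨a, rfl⟩ := (awayEquiv k).surjective a
  obtain ⟨m, x, hx, rfl⟩ := HomogeneousLocalization.Away.mk_surjective (grading n)
    (X_mem_grading k) a
  refine ⟨x, ?_⟩
  rw [← Away_eval₂_eq_mk (X_mem_grading k) X_mem_grading_smul hx]
  have := MvPolynomial.hom_eval₂ x (awayConst k) (awayEquiv k).toRingHom fun i => awayRatio i k
  refine Eq.trans ?_ this.symm
  congr 1
  ext1 c
  exact const_chart k c

/-- Functions on a standard chart are freely generated by the ratios of the coordinates. -/
theorem exists_chart_lift (k : Fin n) {S : Type*} [CommRing S] (φ : ℂ →+* S) (s : Fin n → S)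
    (hs : s k = 1) : ∃ ψ : Γ(PSpace n, chart k) →+* S,
      ψ.comp (const (PSpace.toSpec n) (chart k)) = φ ∧ ∀ i, ψ (ratio i k) = s i := by
  have hu : IsUnit (MvPolynomial.eval₂Hom φ s (MvPolynomial.X k)) := by simp [hs]
  let l : Localization.Away (MvPolynomial.X k : MvPolynomial (Fin n) ℂ) →+* S :=
    IsLocalization.Away.lift (MvPolynomial.X k) hu
  have hl : ∀ x, l (algebraMap _ _ x) = MvPolynomial.eval₂Hom φ s x := fun x =>
    IsLocalization.Away.lift_eq _ hu x
  let v : HomogeneousLocalization.Away (grading n) (MvPolynomial.X k) →+*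
    Localization.Away (MvPolynomial.X k : MvPolynomial (Fin n) ℂ) := algebraMap _ _
  refine ⟨(l.comp v).comp (awayEquiv k).symm.toRingHom, ?_, fun i => ?_⟩
  · ext1 c
    change l (v ((awayEquiv k).symm _)) = _
    rw [const_chart, RingEquiv.symm_apply_apply]
    exact (hl (MvPolynomial.C c)).trans (MvPolynomial.eval₂_C _ _ _)
  · change l (v ((awayEquiv k).symm _)) = _
    rw [ratio_eq, RingEquiv.symm_apply_apply]
    have h1 : algebraMap (MvPolynomial (Fin n) ℂ) (Localization.Away
          (MvPolynomial.X k : MvPolynomial (Fin n) ℂ))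
        (MvPolynomial.X k) * v (awayRatio i k) =
        algebraMap (MvPolynomial (Fin n) ℂ) _ (MvPolynomial.X i) := by
      have := IsLocalization.mk'_spec (Localization.Away
          (MvPolynomial.X k : MvPolynomial (Fin n) ℂ))
        (MvPolynomial.X i : MvPolynomial (Fin n) ℂ)
        (⟨MvPolynomial.X k ^ 1, 1, rfl⟩ : Submonoid.powers _)
      rw [← this, mul_comm, ← Localization.mk_eq_mk']
      congr 1
      exact congrArg _ (pow_one _).symm
    have h2 := congrArg l h1
    rw [map_mul, hl, hl] at h2
    simpa [hs] using h2

end PSpace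

/-! ### Products with the standard charts, and the equation of the universal divisor -/

open LinearSystem PSpace

/-- On an affine open the ideal of the zero scheme is generated by any function that generates it at
all points. -/
theorem zeroIdealOn_eq_span_of_zeroStalk {X : Scheme.{u}} {L : LineBundle X} (s : L.sections)
    {W : X.Opens} (hW : IsAffineOpen W) (a : Γ(X, W))
    (h : ∀ z (hz : z ∈ W), LineBundle.zeroStalk s z = Ideal.span {X.presheaf.germ W z hz a}) :
    LineBundle.zeroIdealOn s W = Ideal.span {a} := by
  apply le_antisymm
  · intro c hc
    rw [hW.mem_ideal_iff]
    intro z hz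
    rw [Ideal.map_span, Set.image_singleton]
    have := (LineBundle.mem_zeroIdealOn s W c).1 hc z hz
    rwa [h z hz] at this
  · rw [Ideal.span_singleton_le_iff_mem, LineBundle.mem_zeroIdealOn]
    intro z hz
    rw [h z hz]
    exact Ideal.mem_span_singleton_self _

section Product

variable {X : Scheme.{0}} (p : X ⟶ Spec (.of ℂ)) (n : ℕ)

/-- The product of an open subset of `X` and a standard chart of projective space. -/
def prodOpen (W : X.Opens) (k : Fin n) : (Limits.pullback p (PSpace.toSpec n)).Opens :=
  pr1 p n ⁻¹ᵁ W ⊓ pr2 p n ⁻¹ᵁ chart k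

variable {n} {W : X.Opens} (hW : IsAffineOpen W) (k : Fin n)

theorem prodOpen_le_left : prodOpen p n W k ≤ pr1 p n ⁻¹ᵁ W := inf_le_left

theorem prodOpen_le_right : prodOpen p n W k ≤ pr2 p n ⁻¹ᵁ chart k := inf_le_right

theorem isAffineOpen_chart (k : Fin n) : IsAffineOpen (chart k) :=
  Proj.isAffineOpen_basicOpen (grading n) (MvPolynomial.X k) (X_mem_grading k) zero_lt_one

include hW in
theorem isAffineOpen_prodOpen : IsAffineOpen (prodOpen p n W k) := by
  have H : IsPullback (pr1 p n) (pr2 p n) p (PSpace.toSpec n) := IsPullback.of_hasPullback _ _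
  have : IsAffine _ := hW
  have : IsAffine _ := isAffineOpen_chart k
  have : IsAffine _ := isAffineOpen_top (Spec (.of ℂ))
  exact .of_isIso (Scheme.Hom.isPullback_resLE H (US := ⊤) (UT := chart k) (UX := W)
    (UY := prodOpen p n W k) (fun _ _ => trivial) (fun _ _ => trivial) rfl).isoPullback.hom

include hW in
theorem isPushout_prodOpen :
    IsPushout (p.appLE ⊤ W (fun _ _ => trivial))
      ((PSpace.toSpec n).appLE ⊤ (chart k) (fun _ _ => trivial))
      ((pr1 p n).appLE W (prodOpen p n W k) (prodOpen_le_left p k))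
      ((pr2 p n).appLE (chart k) (prodOpen p n W k) (prodOpen_le_right p k)) := by
  have H : IsPullback (pr1 p n) (pr2 p n) p (PSpace.toSpec n) := IsPullback.of_hasPullback _ _
  exact (isIso_pushoutSection_iff H (US := ⊤) (UT := chart k) (UX := W)
    (UY := prodOpen p n W k) (fun _ _ => trivial) (fun _ _ => trivial) rfl).1
    (isIso_pushoutSection_of_isAffineOpen H _ _ _ (isAffineOpen_top _) (isAffineOpen_chart k) hW)

theorem pull_const {X Y : Scheme.{0}} (f : X ⟶ Y) (p : Y ⟶ Spec (.of ℂ)) {U : Y.Opens}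
    {V : X.Opens} (h : V ≤ f ⁻¹ᵁ U) (c : ℂ) : pull f h (const p U c) = const (f ≫ p) V c := by
  simp only [const, RingHom.comp_apply, pull, ← CommRingCat.comp_apply]
  exact congrArg (fun φ : Γ(Spec (.of ℂ), ⊤) ⟶ Γ(X, V) =>
      φ.hom ((Scheme.ΓSpecIso (.of ℂ)).inv.hom c))
    (Scheme.Hom.appLE_comp_appLE f p ⊤ U V (fun _ _ => trivial) h)

theorem pull_pr1_const (c : ℂ) :
    pull (pr1 p n) (prodOpen_le_left p k) (const p W c) =
      pull (pr2 p n) (prodOpen_le_right p k) (const (PSpace.toSpec n) (chart k) c) := by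
  rw [pull_const, pull_const]
  congr 2
  exact Limits.pullback.condition

include hW in
/-- Functions on the product of an affine open and a standard chart are polynomials in the ratios
of the coordinates. -/
theorem exists_eval₂_prodOpen (a : Γ(Limits.pullback p (PSpace.toSpec n), prodOpen p n W k)) :
    ∃ x, MvPolynomial.eval₂ (pull (pr1 p n) (prodOpen_le_left p k))
      (fun i => pull (pr2 p n) (prodOpen_le_right p k) (ratio i k)) x = a := by
  let F := MvPolynomial.eval₂Hom (pull (pr1 p n) (prodOpen_le_left (W := W) p k))
      (fun i => pull (pr2 p n) (prodOpen_le_right (W := W) p k) (ratio i k))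
  have h := CommRingCat.closure_range_union_range_eq_top_of_isPushout (isPushout_prodOpen p hW k)
  have hle : (⊤ : Subring _) ≤ F.range := by
    rw [← h, Subring.closure_le]
    rintro _ (⟨c, rfl⟩ | ⟨c, rfl⟩)
    · exact ⟨MvPolynomial.C c, MvPolynomial.eval₂_C _ _ _⟩
    · obtain ⟨x, rfl⟩ := exists_eval₂_ratio k c
      refine ⟨MvPolynomial.map (const p W) x, ?_⟩
      have := MvPolynomial.hom_eval₂ x (const (PSpace.toSpec n) (chart k))
        (pull (pr2 p n) (prodOpen_le_right (W := W) p k)) (fun i => ratio i k)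
      refine Eq.trans ?_ this.symm
      refine (MvPolynomial.eval₂_map _ _ _ _).trans ?_
      congr 1
      ext1 c
      exact pull_pr1_const p k c
  exact hle (Subring.mem_top a)

include hW in
/-- Functions on the product of an affine open and a standard chart are freely generated by
functions on the affine open and the ratios of the coordinates. -/
theorem exists_prodOpen_lift {S : Type} [CommRing S] (φ : Γ(X, W) →+* S) (s : Fin n → S)
    (hs : s k = 1) : ∃ ψ : Γ(Limits.pullback p (PSpace.toSpec n), prodOpen p n W k) →+* S,
      (∀ a, ψ (pull (pr1 p n) (prodOpen_le_left p k) a) = φ a) ∧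
        ∀ i, ψ (pull (pr2 p n) (prodOpen_le_right p k) (ratio i k)) = s i := by
  obtain ⟨ψ, hψ, hψs⟩ := exists_chart_lift k (φ.comp (const p W)) s hs
  have H := isPushout_prodOpen p hW k
  let ψ' : Γ(PSpace n, chart k) ⟶ CommRingCat.of S :=
    CommRingCat.ofHom (R := Γ(PSpace n, chart k)) ψ
  have hw : p.appLE ⊤ W (fun _ _ => trivial) ≫ CommRingCat.ofHom φ =
      (PSpace.toSpec n).appLE ⊤ (chart k) (fun _ _ => trivial) ≫ ψ' := by
    rw [← cancel_epi (Scheme.ΓSpecIso (.of ℂ)).inv]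
    ext c
    exact (RingHom.congr_fun hψ c).symm
  refine ⟨(H.desc (CommRingCat.ofHom φ) ψ' hw).hom, fun a => ?_, fun i => ?_⟩
  · exact congrArg (fun f => f.hom a) (H.inl_desc _ _ hw)
  · exact (congrArg (fun f => f.hom (ratio i k)) (H.inr_desc _ _ hw)).trans (hψs i)

end Product

section Divisor

variable {X : Scheme.{0}} {p : X ⟶ Spec (.of ℂ)} (D : LinearSystem p)
  {n : ℕ} (b : Module.Basis (Fin n) ℂ D.V)

/-- The local expression of the basis section `bᵢ` in the trivialization around `x`. -/
def secAt (i : Fin n) (x : X) : Γ(X, D.L.U x) := ((b i).1 : D.L.sections).1 x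

theorem secAt_compat (i : Fin n) (x y : X) {V : X.Opens} (hx : V ≤ D.L.U x) (hy : V ≤ D.L.U y) :
    res hx (secAt D b i x) = res (le_inf hx hy) (D.L.g x y) * res hy (secAt D b i y) :=
  LineBundle.sections_compat (L := D.L) (b i).1 x y hx hy

theorem universalSection_apply (z : ↥(Limits.pullback p (PSpace.toSpec n))) {V : Scheme.Opens _}
    (hV : V ≤ pr1 p n ⁻¹ᵁ D.L.U (pr1 p n z)) (hV' : V ≤ pr2 p n ⁻¹ᵁ chart (chartAt (pr2 p n z))) :
    res (le_inf hV hV') ((D.universalSection b).1 z) =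
      ∑ i, pull (pr1 p n) hV (secAt D b i (pr1 p n z)) *
        pull (pr2 p n) hV' (ratio i (chartAt (pr2 p n z))) := by
  have h : (D.universalSection b).1 z = ∑ i,
      (LineBundle.mulSection (LineBundle.pullbackSection (pr1 p n) (L := D.L) (b i).1)
        (LineBundle.pullbackSection (pr2 p n) (PSpace.coord i))).1 z := by
    rw [universalSection, AddSubgroup.val_finsetSum, Finset.sum_apply]
  refine (congrArg _ h).trans ((map_sum _ _ _).trans (Finset.sum_congr rfl fun i _ => ?_))
  refine (map_mul _ _ _).trans (congrArg₂ _ ?_ ?_)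
  · exact (res_res _ _ _).trans (res_pull _ _ _ _)
  · exact (res_res _ _ _).trans (res_pull _ _ _ _)

variable {W : X.Opens} (hW : IsAffineOpen W) (x : X) (hx : W ≤ D.L.U x) (k : Fin n)

/-- The universal section in the trivializations given by `x` and the chart `xₖ ≠ 0`. -/
def localEquation : Γ(Limits.pullback p (PSpace.toSpec n), prodOpen p n W k) :=
  ∑ i, pull (pr1 p n) (prodOpen_le_left p k) (res hx (secAt D b i x)) *
    pull (pr2 p n) (prodOpen_le_right p k) (ratio i k)

/-- The trivialization of `D.L` around `x` and the chart `xₖ ≠ 0` can be used instead of the ones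
chosen for the point `z`, as the universal section only changes by a unit. -/
theorem zeroStalk_universalSection (z : ↥(Limits.pullback p (PSpace.toSpec n)))
    (hz : z ∈ prodOpen p n W k) :
    LineBundle.zeroStalk (D.universalSection b) z =
      Ideal.span {(Limits.pullback p (PSpace.toSpec n)).presheaf.germ _ z hz
        (localEquation D b x hx k)} := by
  let c := chartAt (pr2 p n z)
  let V := pr1 p n ⁻¹ᵁ D.L.U (pr1 p n z) ⊓ pr2 p n ⁻¹ᵁ chart c ⊓ prodOpen p n W k
  have hzV : z ∈ V := ⟨⟨D.L.mem _, (exists_chart (pr2 p n z)).choose_spec⟩, hz⟩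
  have h1 : V ≤ pr1 p n ⁻¹ᵁ D.L.U (pr1 p n z) := inf_le_left.trans inf_le_left
  have h2 : V ≤ pr2 p n ⁻¹ᵁ chart c := inf_le_left.trans inf_le_right
  have h3 : V ≤ prodOpen p n W k := inf_le_right
  have h4 : V ≤ pr1 p n ⁻¹ᵁ W := h3.trans (prodOpen_le_left p k)
  have h5 : V ≤ pr2 p n ⁻¹ᵁ chart k := h3.trans (prodOpen_le_right p k)
  have h6 : V ≤ pr1 p n ⁻¹ᵁ D.L.U x := fun y hy => hx (h4 hy)
  -- the transition functions of the two trivializations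
  let g := pull (pr1 p n) (le_preimage_inf _ h1 h6) (D.L.g (pr1 p n z) x)
  let t := pull (pr2 p n) h2 (ratio k c)
  have hs : ∀ i, pull (pr1 p n) h1 (secAt D b i (pr1 p n z)) =
      g * pull (pr1 p n) h6 (secAt D b i x) := by
    intro i
    have := congrArg (pull (pr1 p n) (le_preimage_inf _ h1 h6))
      (secAt_compat D b i (pr1 p n z) x inf_le_left inf_le_right)
    rwa [map_mul, pull_res, pull_res, pull_res] at this
  have ht : ∀ i, pull (pr2 p n) h2 (ratio i c) = t * pull (pr2 p n) h5 (ratio i k) := by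
    intro i
    have := congrArg (pull (pr2 p n) (le_preimage_inf _ h2 h5))
      (ratio_mul i c k inf_le_left inf_le_right)
    rwa [map_mul, pull_res, pull_res, pull_res] at this
  have hgu : IsUnit g := by
    have := congrArg (pull (pr1 p n) (le_preimage_inf _ h1 h6))
      (D.L.g_mul_g (pr1 p n z) x le_rfl (inf_comm _ _).le)
    rw [map_mul, pull_res, pull_res, map_one] at this
    exact IsUnit.of_mul_eq_one _ this
  have htu : IsUnit t := by
    have := ht c
    rw [ratio_self, map_one] at this
    exact IsUnit.of_mul_eq_one _ this.symm
  have key : res (le_inf h1 h2) ((D.universalSection b).1 z) =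
      g * t * res h3 (localEquation D b x hx k) := by
    rw [localEquation, map_sum, Finset.mul_sum]
    refine (universalSection_apply D b z h1 h2).trans ?_
    refine Finset.sum_congr rfl fun i _ => ?_
    rw [hs, ht, map_mul, res_pull, res_pull, pull_res]
    ring
  have e := LineBundle.zeroStalk_eq (D.universalSection b) z z (le_inf h1 h2) hzV
  refine e.trans ((congrArg (fun a => Ideal.span
    {(Limits.pullback p (PSpace.toSpec n)).presheaf.germ V z hzV a}) key).trans ?_)
  rw [map_mul, LineBundle.germ_res_eq,
    Ideal.span_singleton_mul_left_unit ((hgu.mul htu).map _)]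

include hW in
theorem zeroIdealOn_universalSection :
    LineBundle.zeroIdealOn (D.universalSection b) (prodOpen p n W k) =
      Ideal.span {localEquation D b x hx k} :=
  zeroIdealOn_eq_span_of_zeroStalk _ (isAffineOpen_prodOpen p hW k) _
    (zeroStalk_universalSection D b x hx k)

end Divisor

/-! ### Charts of the universal divisor -/

section Charts

variable {X : Scheme.{0}} {p : X ⟶ Spec (.of ℂ)} (D : LinearSystem p)
  {n : ℕ} (b : Module.Basis (Fin n) ℂ D.V)

/-- The part of the universal divisor lying over an open subset of `X` and over a standard chart
of projective space. -/
def divOpen (W : X.Opens) (k : Fin n) : (D.universalDivisor b).Opens :=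
  D.toX b ⁻¹ᵁ W ⊓ D.toBase b ⁻¹ᵁ chart k

variable {W : X.Opens} (hW : IsAffineOpen W) (x : X) (hx : W ≤ D.L.U x) (k : Fin n)

theorem divOpen_le_left : divOpen D b W k ≤ D.toX b ⁻¹ᵁ W := inf_le_left

theorem divOpen_le_right : divOpen D b W k ≤ D.toBase b ⁻¹ᵁ chart k := inf_le_right

variable (W) in
theorem divOpen_eq : divOpen D b W k =
    (LineBundle.zeroIdeal (D.universalSection b)).subschemeι ⁻¹ᵁ prodOpen p n W k := rfl

include hW in
theorem isAffineOpen_divOpen : IsAffineOpen (divOpen D b W k) := by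
  rw [divOpen_eq]
  exact (isAffineOpen_prodOpen p hW k).preimage
    (LineBundle.zeroIdeal (D.universalSection b)).subschemeι

/-- Functions on `W` as functions on the part of the universal divisor over `W`. -/
def divCoef (W : X.Opens) (k : Fin n) : Γ(X, W) →+* Γ(D.universalDivisor b, divOpen D b W k) :=
  pull (D.toX b) (divOpen_le_left D b k)

/-- The quotient `xᵢ / xₖ` as a function on a part of the universal divisor. -/
def divRatio (W : X.Opens) (i k : Fin n) : Γ(D.universalDivisor b, divOpen D b W k) :=
  pull (D.toBase b) (divOpen_le_right D b k) (ratio i k)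

/-- Restriction of functions to the universal divisor. -/
def divRes (W : X.Opens) (k : Fin n) :
    Γ(Limits.pullback p (PSpace.toSpec n), prodOpen p n W k) →+*
      Γ(D.universalDivisor b, divOpen D b W k) :=
  pull (LineBundle.zeroIdeal (D.universalSection b)).subschemeι (divOpen_eq D b W k).le

theorem divRes_pr1 (a : Γ(X, W)) :
    divRes D b W k (pull (pr1 p n) (prodOpen_le_left p k) a) = divCoef D b W k a :=
  congrArg (fun φ : Γ(X, W) ⟶ Γ(D.universalDivisor b, divOpen D b W k) => φ.hom a)
    (Scheme.Hom.appLE_comp_appLE (LineBundle.zeroIdeal (D.universalSection b)).subschemeι (pr1 p n)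
      W (prodOpen p n W k) (divOpen D b W k) (prodOpen_le_left p k) (divOpen_eq D b W k).le)

theorem divRes_pr2 (i : Fin n) :
    divRes D b W k (pull (pr2 p n) (prodOpen_le_right p k) (ratio i k)) = divRatio D b W i k :=
  congrArg (fun φ : Γ(PSpace n, chart k) ⟶ Γ(D.universalDivisor b, divOpen D b W k) =>
      φ.hom (ratio i k))
    (Scheme.Hom.appLE_comp_appLE (LineBundle.zeroIdeal (D.universalSection b)).subschemeι (pr2 p n)
      (chart k) (prodOpen p n W k) (divOpen D b W k) (prodOpen_le_right p k)
      (divOpen_eq D b W k).le)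

theorem divRes_eq : divRes D b W k =
    ((LineBundle.zeroIdeal (D.universalSection b)).subschemeι.app (prodOpen p n W k)).hom :=
  congrArg (fun φ : Γ(Limits.pullback p (PSpace.toSpec n), prodOpen p n W k) ⟶
    Γ(D.universalDivisor b, divOpen D b W k) => φ.hom) (Scheme.Hom.appLE_eq_app _)

include hW in
theorem divRes_surjective : Function.Surjective (divRes D b W k) := by
  rw [divRes_eq]
  exact Scheme.IdealSheafData.subschemeι_app_surjective _ ⟨_, isAffineOpen_prodOpen p hW k⟩

include hW in
theorem ker_divRes : RingHom.ker (divRes D b W k) = Ideal.span {localEquation D b x hx k} := by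
  rw [divRes_eq, ← zeroIdealOn_universalSection D b hW x hx k]
  exact Scheme.IdealSheafData.ker_subschemeι_app _ ⟨_, isAffineOpen_prodOpen p hW k⟩

theorem divRatio_self : divRatio D b W k k = 1 := by
  rw [divRatio, ratio_self, map_one]

include hW in
/-- The equation of the universal divisor. -/
theorem sum_divCoef_mul_divRatio :
    ∑ i, divCoef D b W k (res hx (secAt D b i x)) * divRatio D b W i k = 0 := by
  have h : localEquation D b x hx k ∈ RingHom.ker (divRes D b W k) := by
    rw [ker_divRes D b hW x hx k]
    exact Ideal.mem_span_singleton_self _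
  rw [RingHom.mem_ker, localEquation, map_sum] at h
  refine (Finset.sum_congr rfl fun i _ => ?_).trans h
  rw [map_mul, divRes_pr1, divRes_pr2]

include hW in
theorem exists_eval₂_divOpen (a : Γ(D.universalDivisor b, divOpen D b W k)) :
    ∃ P, MvPolynomial.eval₂ (divCoef D b W k) (fun i => divRatio D b W i k) P = a := by
  obtain ⟨a, rfl⟩ := divRes_surjective D b hW k a
  obtain ⟨P, rfl⟩ := exists_eval₂_prodOpen p hW k a
  refine ⟨P, ?_⟩
  rw [MvPolynomial.hom_eval₂]
  congr 1
  · ext1 a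
    exact (divRes_pr1 D b k a).symm
  · ext1 i
    exact (divRes_pr2 D b k i).symm

include hW in
/-- Functions on the charts of the universal divisor are generated by the ratios of the coordinates,
and the equation of the universal divisor is the only relation between them. -/
theorem exists_divOpen_lift {S : Type} [CommRing S] (φ : Γ(X, W) →+* S) (s : Fin n → S)
    (hs : s k = 1) (hφ : ∑ i, φ (res hx (secAt D b i x)) * s i = 0) :
    ∃ ψ : Γ(D.universalDivisor b, divOpen D b W k) →+* S,
      (∀ a, ψ (divCoef D b W k a) = φ a) ∧ ∀ i, ψ (divRatio D b W i k) = s i := by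
  obtain ⟨ψ, hψ, hψs⟩ := exists_prodOpen_lift p hW k φ s hs
  have hker : RingHom.ker (divRes D b W k) ≤ RingHom.ker ψ := by
    rw [ker_divRes D b hW x hx k, Ideal.span_singleton_le_iff_mem, RingHom.mem_ker, localEquation,
      map_sum, ← hφ]
    refine Finset.sum_congr rfl fun i _ => ?_
    rw [map_mul, hψ, hψs]
  have hsurj := divRes_surjective D b hW k
  have key : ∀ a, RingHom.liftOfSurjective (divRes D b W k) hsurj ⟨ψ, hker⟩ (divRes D b W k a) =
      ψ a := fun a => RingHom.liftOfRightInverse_comp_apply _ _ _ _ a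
  refine ⟨RingHom.liftOfSurjective (divRes D b W k) hsurj ⟨ψ, hker⟩, fun a => ?_, fun i => ?_⟩
  · rw [← divRes_pr1, key, hψ]
  · rw [← divRes_pr2, key, hψs]

/-- Polynomials in the ratios `xᵢ / xₖ` with `i` different from `j`, as functions on a chart of the
universal divisor. -/
def divEval (W : X.Opens) (j k : Fin n) :
    MvPolynomial {i : Fin n // i ≠ j ∧ i ≠ k} Γ(X, W) →+*
      Γ(D.universalDivisor b, divOpen D b W k) :=
  MvPolynomial.eval₂Hom (divCoef D b W k) fun i => divRatio D b W i.1 k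

theorem divEval_C (j k : Fin n) (a : Γ(X, W)) :
    divEval D b W j k (MvPolynomial.C a) = divCoef D b W k a :=
  MvPolynomial.eval₂_C _ _ _

theorem divEval_X (j k : Fin n) (i : {i : Fin n // i ≠ j ∧ i ≠ k}) :
    divEval D b W j k (MvPolynomial.X i) = divRatio D b W i.1 k :=
  MvPolynomial.eval₂_X _ _ _

include hW in
/-- If `bⱼ` vanishes nowhere on `W`, then the equation of the universal divisor expresses the
coordinate `xⱼ` by the others. -/
theorem divEval_bijective {j k : Fin n} (hjk : j ≠ k) (hj : IsUnit (res hx (secAt D b j x))) :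
    Function.Bijective (divEval D b W j k) := by
  obtain ⟨β', hβ'⟩ := hj.exists_left_inv
  set β : Fin n → Γ(X, W) := fun i => res hx (secAt D b i x) with hβ
  have hβ' : β' * β j = 1 := hβ'
  constructor
  · -- the inverse homomorphism sends the ratio of index `j` to the expression for `xⱼ` given by the
    -- equation, and the ratio of index `k` to `1`
    let t : Fin n → MvPolynomial {i : Fin n // i ≠ j ∧ i ≠ k} Γ(X, W) := fun i =>
      if h : i ≠ j ∧ i ≠ k then MvPolynomial.X ⟨i, h⟩ else if i = k then 1 else 0
    let s : Fin n → MvPolynomial {i : Fin n // i ≠ j ∧ i ≠ k} Γ(X, W) := fun i =>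
      t i - if i = j then MvPolynomial.C β' * ∑ m, MvPolynomial.C (β m) * t m else 0
    have hsk : s k = 1 := by simp [s, t, hjk.symm]
    have hs : ∑ i, MvPolynomial.C (β i) * s i = 0 := by
      simp only [s, mul_sub, Finset.sum_sub_distrib, mul_ite, mul_zero, Finset.sum_ite_eq',
        Finset.mem_univ, if_true]
      rw [← mul_assoc, ← map_mul, mul_comm (β j), hβ', map_one, one_mul, sub_self]
    obtain ⟨ψ, hψ, hψs⟩ := exists_divOpen_lift D b hW x hx k MvPolynomial.C s hsk hs
    have hcomp : ψ.comp (divEval D b W j k) = RingHom.id _ := by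
      refine MvPolynomial.ringHom_ext (fun a => ?_) fun i => ?_
      · rw [RingHom.comp_apply, divEval_C, hψ, RingHom.id_apply]
      · rw [RingHom.comp_apply, divEval_X, hψs, RingHom.id_apply]
        simp [s, t, i.2]
    exact Function.LeftInverse.injective (g := ψ) fun P => RingHom.congr_fun hcomp P
  · have hc : ∀ a, divCoef D b W k a ∈ (divEval D b W j k).range := fun a =>
      ⟨_, divEval_C D b j k a⟩
    have hr : ∀ i, i ≠ j → divRatio D b W i k ∈ (divEval D b W j k).range := by
      intro i hij
      by_cases hik : i = k
      · rw [hik, divRatio_self]; exact one_mem _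
      · exact ⟨_, divEval_X D b j k ⟨i, hij, hik⟩⟩
    have hrj : divRatio D b W j k ∈ (divEval D b W j k).range := by
      have h := sum_divCoef_mul_divRatio D b hW x hx k
      rw [← Finset.add_sum_erase _ _ (Finset.mem_univ j)] at h
      have h1 : divCoef D b W k β' * divCoef D b W k (β j) = 1 := by
        rw [← map_mul, hβ', map_one]
      have h2 : divRatio D b W j k = - (divCoef D b W k β' * ∑ i ∈ Finset.univ.erase j,
          divCoef D b W k (β i) * divRatio D b W i k) := by
        linear_combination (divCoef D b W k β') * h - divRatio D b W j k * h1
      rw [h2]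
      exact neg_mem (mul_mem (hc _) (sum_mem fun i hi =>
        mul_mem (hc _) (hr i (Finset.ne_of_mem_erase hi))))
    intro a
    obtain ⟨P, rfl⟩ := exists_eval₂_divOpen D b hW k a
    change MvPolynomial.eval₂ _ _ P ∈ (divEval D b W j k).range
    rw [MvPolynomial.eval₂_eq]
    refine sum_mem fun d _ => mul_mem (hc _) (prod_mem fun i _ => pow_mem ?_ _)
    by_cases hij : i = j
    · rw [hij]; exact hrj
    · exact hr i hij

end Charts

/-! ### Integrality of the universal divisor -/

section Integrality

variable {Y : Scheme.{u}}

theorem mem_basicOpen_pull {X : Scheme.{u}} (f : X ⟶ Y) {U : Y.Opens} {V : X.Opens}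
    (h : V ≤ f ⁻¹ᵁ U) (s : Γ(Y, U)) {z : X} (hz : z ∈ V) :
    z ∈ X.basicOpen (pull f h s) ↔ f z ∈ Y.basicOpen s := by
  have e : pull f h s = res h ((f.app U).hom s) := rfl
  rw [e, Scheme.basicOpen_res]
  have := Scheme.preimage_basicOpen f s
  exact ⟨fun hm => (this.ge hm.2 : z ∈ f ⁻¹ᵁ Y.basicOpen s), fun hm => ⟨hz, this.le hm⟩⟩

/-- The generic point of an affine open with integral coordinate ring. -/
theorem exists_mem_of_isDomain {E : Y.Opens} (hE : IsAffineOpen E) [IsDomain Γ(Y, E)] :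
    ∃ z ∈ E, ∀ r : Γ(Y, E), r ≠ 0 → z ∈ Y.basicOpen r := by
  obtain ⟨z, hz, h⟩ := exists_point_of_isPrime hE ⊥
  exact ⟨z, hz, fun r hr => (h r).2 hr⟩

theorem ne_zero_of_mem_basicOpen {E : Y.Opens} {r : Γ(Y, E)} {z : Y} (hz : z ∈ Y.basicOpen r) :
    r ≠ 0 := by
  rintro rfl
  rw [Scheme.basicOpen_zero] at hz
  exact hz

theorem inter_nonempty_of_isDomain {E : Y.Opens} (hE : IsAffineOpen E) [IsDomain Γ(Y, E)]
    {U V : Y.Opens} (hU : ∃ z ∈ E, z ∈ U) (hV : ∃ z ∈ E, z ∈ V) : ∃ z ∈ E, z ∈ U ∧ z ∈ V := by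
  obtain ⟨u, huE, hu⟩ := hU
  obtain ⟨v, hvE, hv⟩ := hV
  obtain ⟨r, hr, hur⟩ := hE.exists_basicOpen_le ⟨u, hu⟩ huE
  obtain ⟨s, hs, hvs⟩ := hE.exists_basicOpen_le ⟨v, hv⟩ hvE
  obtain ⟨z, hz, h⟩ := exists_mem_of_isDomain hE
  exact ⟨z, hz, hr (h r (ne_zero_of_mem_basicOpen hur)), hs (h s (ne_zero_of_mem_basicOpen hvs))⟩

/-- A nonempty scheme covered by spectra of integral domains any two of which meet is integral. -/
theorem isIntegral_of_cover [Nonempty Y] (S : Set Y.Opens)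
    (hS : ∀ E ∈ S, IsAffineOpen E ∧ IsDomain Γ(Y, E)) (hcov : ∀ z, ∃ E ∈ S, z ∈ E)
    (hmeet : ∀ E ∈ S, ∀ E' ∈ S, ∃ z, z ∈ E ∧ z ∈ E') : IsIntegral Y := by
  have : ∀ z, _root_.IsReduced (Y.presheaf.stalk z) := by
    intro z
    obtain ⟨E, hES, hz⟩ := hcov z
    obtain ⟨hE, hd⟩ := hS E hES
    let := TopCat.Presheaf.algebra_section_stalk Y.presheaf ⟨z, hz⟩
    have := hE.isLocalization_stalk ⟨z, hz⟩
    have : IsDomain (Y.presheaf.stalk z) :=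
      IsLocalization.isDomain_of_atPrime _ (hE.primeIdealOf ⟨z, hz⟩).asIdeal
    infer_instance
  have : IsReduced Y := isReduced_of_isReduced_stalk Y
  have : IrreducibleSpace Y :=
    { toNonempty := inferInstance
      isPreirreducible_univ := by
        rintro U V hU hV ⟨u, -, hu⟩ ⟨v, -, hv⟩
        obtain ⟨E, hES, huE⟩ := hcov u
        obtain ⟨E', hES', hvE'⟩ := hcov v
        have := (hS E hES).2
        have := (hS E' hES').2
        obtain ⟨t, htE, htE'⟩ := hmeet E hES E' hES'
        obtain ⟨s, hsE, hsU, hsE'⟩ :=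
          inter_nonempty_of_isDomain (hS E hES).1 (U := ⟨U, hU⟩) (V := E')
            ⟨u, huE, hu⟩ ⟨t, htE, htE'⟩
        obtain ⟨r, -, hr, hr'⟩ := inter_nonempty_of_isDomain (hS E' hES').1 (U := ⟨U, hU⟩)
          (V := ⟨V, hV⟩) ⟨s, hsE', hsU⟩ ⟨v, hvE', hv⟩
        exact ⟨r, trivial, hr, hr'⟩ }
  exact isIntegral_of_irreducibleSpace_of_isReduced Y

end Integrality

/-- The quotient `xᵢ / xⱼ` is invertible exactly where `xᵢ` does not vanish. -/
theorem mem_basicOpen_ratio {n : ℕ} {i j : Fin n} {y : PSpace n} (hy : y ∈ chart j) :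
    y ∈ (PSpace n).basicOpen (ratio i j) ↔ y ∈ chart i := by
  constructor
  · intro h
    obtain ⟨u, hu⟩ :=
      (RingedSpace.isUnit_res_basicOpen (PSpace n).toRingedSpace (ratio i j)).exists_right_inv
    have h1 := congrArg (fun a => evalAt a y h) hu
    have h2 := (evalAt_mul (V := (PSpace n).basicOpen (ratio i j))
      (res ((PSpace n).basicOpen_le (ratio i j)) (ratio i j)) u y h).symm.trans
      (h1.trans (evalAt_one y h))
    rw [evalAt_res, evalAt_ratio, Localization.mk_eq_mk'] at h2
    exact (IsLocalization.AtPrime.isUnit_mk'_iff _ (pt y).asHomogeneousIdeal.toIdeal _ _).1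
      (IsUnit.of_mul_eq_one _ h2)
  · intro h
    have h1 := ratio_mul j j i (V := chart i ⊓ chart j) inf_le_right inf_le_left
    rw [ratio_self, map_one] at h1
    have h2 : IsUnit (res (V := chart i ⊓ chart j) inf_le_right (ratio i j)) :=
      IsUnit.of_mul_eq_one _ h1.symm
    have h3 := Scheme.basicOpen_of_isUnit _ h2
    rw [Scheme.basicOpen_res] at h3
    exact (h3.ge ⟨h, hy⟩ : y ∈ _ ⊓ _).2

section Good

variable {X : Scheme.{0}} {p : X ⟶ Spec (.of ℂ)} (D : LinearSystem p)
  {n : ℕ} (b : Module.Basis (Fin n) ℂ D.V)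

/-- `W` is a nonempty affine open subset of `X` over which the line bundle of the linear system is
trivial and the basis section `bⱼ` vanishes nowhere. -/
def IsTrivializing (W : X.Opens) (j : Fin n) : Prop :=
  IsAffineOpen W ∧ (∃ x, x ∈ W) ∧ ∃ (x : X) (hx : W ≤ D.L.U x), IsUnit (res hx (secAt D b j x))

variable {D b}

theorem IsTrivializing.mono {W W' : X.Opens} {j : Fin n} (h : IsTrivializing D b W j)
    (hW' : IsAffineOpen W') (hne : ∃ x, x ∈ W') (hle : W' ≤ W) : IsTrivializing D b W' j := by
  obtain ⟨-, -, x, hx, hu⟩ := h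
  refine ⟨hW', hne, x, hle.trans hx, ?_⟩
  rw [← res_res hx hle]
  exact hu.map _

/-- Since the sections in `V` have no common zero, neither have the elements of a basis. -/
theorem exists_secAt_unit (hD : D.BasepointFree) (x : X) :
    ∃ j, x ∈ X.basicOpen (secAt D b j x) := by
  by_contra! hne
  obtain ⟨s, hs, hx⟩ := hD x
  rw [Scheme.mem_basicOpen _ _ _ (D.L.mem x)] at hx
  have hm : ∀ j, X.presheaf.germ _ x (D.L.mem x) (secAt D b j x) ∈
      IsLocalRing.maximalIdeal (X.presheaf.stalk x) := fun j hj => hne j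
    ((Scheme.mem_basicOpen _ _ _ (D.L.mem x)).2 hj)
  have hsum : (⟨s, hs⟩ : D.V) = ∑ i, b.repr ⟨s, hs⟩ i • b i := (b.sum_repr _).symm
  have h1 : (s : D.L.sections).1 x = ∑ i, const p (D.L.U x) (b.repr ⟨s, hs⟩ i) * secAt D b i x := by
    have h2 : s = ∑ i, b.repr ⟨s, hs⟩ i • (b i : H0 p D.L) := by
      have := congrArg (Subtype.val) hsum
      rwa [AddSubmonoidClass.coe_finsetSum] at this
    let ev : D.L.sections →+ Γ(X, D.L.U x) :=
      (Pi.evalAddMonoidHom (fun x => Γ(X, D.L.U x)) x).comp D.L.sections.subtype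
    have h3 := congrArg ev h2
    exact h3.trans (map_sum ev _ _)
  refine (IsLocalRing.mem_maximalIdeal _).1 ?_ hx
  have h4 := congrArg (X.presheaf.germ _ x (D.L.mem x)) h1
  rw [map_sum] at h4
  refine h4 ▸ sum_mem fun i _ => ?_
  rw [map_mul]
  exact Ideal.mul_mem_left _ _ (hm i)

theorem exists_isTrivializing (hD : D.BasepointFree) {x : X} {V : X.Opens} (hV : x ∈ V) :
    ∃ W ≤ V, x ∈ W ∧ ∃ j, IsTrivializing D b W j := by
  obtain ⟨j, hj⟩ := exists_secAt_unit (b := b) hD x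
  obtain ⟨_, ⟨W, hW, rfl⟩, hxW, hle⟩ := X.isBasis_affineOpens.exists_subset_of_mem_open
    (mem_inf hj hV) (X.basicOpen (secAt D b j x) ⊓ V).isOpen
  have hle1 : W ≤ X.basicOpen (secAt D b j x) := fun y hy => (hle hy).1
  refine ⟨W, fun y hy => (hle hy).2, hxW, j, hW, ⟨x, hxW⟩, x, hle1.trans (X.basicOpen_le _), ?_⟩
  rw [← res_res (X.basicOpen_le _) hle1]
  exact (RingedSpace.isUnit_res_basicOpen X.toRingedSpace (secAt D b j x)).map _

theorem IsTrivializing.affine_divOpen {W : X.Opens} {j : Fin n} (h : IsTrivializing D b W j)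
    (k : Fin n) : IsAffineOpen (divOpen D b W k) :=
  isAffineOpen_divOpen D b h.1 k

theorem IsTrivializing.bijective {W : X.Opens} {j k : Fin n} (h : IsTrivializing D b W j)
    (hjk : j ≠ k) : Function.Bijective (divEval D b W j k) := by
  obtain ⟨hW, -, x, hx, hu⟩ := h
  exact divEval_bijective D b hW x hx hjk hu

theorem mem_basicOpen_divRatio {W : X.Opens} {i k : Fin n} {z : D.universalDivisor b}
    (hz : z ∈ divOpen D b W k) : z ∈ (D.universalDivisor b).basicOpen (divRatio D b W i k) ↔
      D.toBase b z ∈ chart i := by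
  rw [divRatio, mem_basicOpen_pull (D.toBase b) (divOpen_le_right D b k) (ratio i k) hz]
  exact mem_basicOpen_ratio (divOpen_le_right D b k hz)

/-- The charts of the universal divisor with `k ≠ j` suffice to cover it: not all of the `xₖ` with
`k ≠ j` can vanish where `bⱼ` does not vanish. -/
theorem IsTrivializing.exists_mem_divOpen {W : X.Opens} {j : Fin n} (h : IsTrivializing D b W j)
    {z : D.universalDivisor b} (hz : D.toX b z ∈ W) : ∃ k, j ≠ k ∧ z ∈ divOpen D b W k := by
  obtain ⟨m, hm⟩ := exists_chart (D.toBase b z)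
  have hzm : z ∈ divOpen D b W m := ⟨hz, hm⟩
  by_cases hjm : j = m
  · subst hjm
    by_contra! hne
    obtain ⟨hW, -, x, hx, hu⟩ := h
    have hrel := sum_divCoef_mul_divRatio D b hW x hx j
    rw [← Finset.add_sum_erase _ _ (Finset.mem_univ j), divRatio_self, mul_one] at hrel
    have h1 := congrArg ((D.universalDivisor b).presheaf.germ _ z hzm) hrel
    rw [map_add, map_sum, map_zero] at h1
    refine (IsLocalRing.mem_maximalIdeal _).1 ?_ ((hu.map (divCoef D b W j)).map
      ((D.universalDivisor b).presheaf.germ _ z hzm).hom)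
    refine (eq_neg_of_add_eq_zero_left h1) ▸ neg_mem (sum_mem fun i hi => ?_)
    rw [map_mul]
    refine Ideal.mul_mem_left _ _ fun hi' => hne i (Finset.ne_of_mem_erase hi).symm ⟨hz, ?_⟩
    exact (mem_basicOpen_divRatio hzm).1 ((Scheme.mem_basicOpen _ _ _ hzm).2 hi')
  · exact ⟨m, hjm, hzm⟩

variable [IsIntegral X]

/-- On an integral scheme a nonzero section of a line bundle vanishes on no nonempty open subset. -/
theorem IsTrivializing.secAt_ne_zero {W : X.Opens} {j : Fin n} (h : IsTrivializing D b W j)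
    (i : Fin n) {x : X} (hx : W ≤ D.L.U x) : res hx (secAt D b i x) ≠ 0 := by
  intro h0
  refine b.ne_zero i (Subtype.ext (Subtype.ext (funext fun y => ?_)))
  change secAt D b i y = 0
  obtain ⟨w, hw⟩ := h.2.1
  have hWη : genericPoint X ∈ W ⊓ D.L.U y :=
    mem_inf (genericPoint_mem hw) (genericPoint_mem (D.L.mem y))
  have hc := secAt_compat D b i y x (V := W ⊓ D.L.U y) inf_le_right (inf_le_left.trans hx)
  rw [← res_res hx inf_le_left, h0, map_zero, mul_zero] at hc
  refine toK_injective _ (genericPoint_mem (D.L.mem y)) ?_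
  rw [map_zero, ← toK_res (inf_le_right : W ⊓ D.L.U y ≤ _) hWη, hc, map_zero]

theorem IsTrivializing.isDomain_coef {W : X.Opens} {j : Fin n} (h : IsTrivializing D b W j) :
    IsDomain Γ(X, W) := by
  obtain ⟨-, ⟨x, hx⟩, -⟩ := h
  have : Nonempty W := ⟨⟨x, hx⟩⟩
  infer_instance

theorem IsTrivializing.isDomain {W : X.Opens} {j k : Fin n} (h : IsTrivializing D b W j)
    (hjk : j ≠ k) : IsDomain Γ(D.universalDivisor b, divOpen D b W k) := by
  have := h.isDomain_coef
  exact MulEquiv.isDomain _ (RingEquiv.ofBijective _ (h.bijective hjk)).symm.toMulEquiv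

/-- For `i ≠ j` this is a variable of the polynomial ring or `1`. As for `i = j`, the equation of
the universal divisor gives `-bₖ / bⱼ` for this function at the point where the other variables
vanish. -/
theorem IsTrivializing.divRatio_ne_zero {W : X.Opens} {j k : Fin n} (h : IsTrivializing D b W j)
    (hjk : j ≠ k) (i : Fin n) : divRatio D b W i k ≠ 0 := by
  have := h.isDomain_coef
  by_cases hik : i = k
  · rw [hik, divRatio_self]
    have := h.isDomain hjk
    exact one_ne_zero
  obtain ⟨β', hβ'⟩ := h.2.2.choose_spec.choose_spec.exists_left_inv
  have hx := h.2.2.choose_spec.choose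
  set x := h.2.2.choose
  by_cases hij : i = j
  · -- the point where only `xⱼ` and `xₖ` are different from zero
    obtain ⟨ψ, -, hψ⟩ := exists_divOpen_lift D b h.1 x hx k (RingHom.id _)
      (fun m => if m = k then 1 else
        if m = j then - (β' * res hx (secAt D b k x)) else 0) (if_pos rfl) (by
        rw [← Finset.add_sum_erase _ _ (Finset.mem_univ k),
          ← Finset.add_sum_erase _ _ (Finset.mem_erase.2 ⟨hjk, Finset.mem_univ j⟩),
          Finset.sum_eq_zero]
        · simp only [if_pos, if_neg hjk, RingHom.id_apply]
          linear_combination (-res hx (secAt D b k x)) * hβ'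
        · intro m hm
          rw [Finset.mem_erase, Finset.mem_erase] at hm
          rw [if_neg hm.2.1, if_neg hm.1, mul_zero])
    intro h0
    have := hψ i
    rw [h0, map_zero, if_neg hik, if_pos hij] at this
    refine h.secAt_ne_zero k hx ?_
    linear_combination (- res hx (secAt D b k x)) * hβ' +
      (res hx (secAt D b j x)) * this
  · rw [← divEval_X D b j k ⟨i, hij, hik⟩]
    exact (map_ne_zero_iff _ (h.bijective hjk).1).2 (MvPolynomial.X_ne_zero _)

/-- All the standard charts meet over every trivializing open subset, hence any two charts of the
universal divisor meet. -/
theorem IsTrivializing.exists_mem {W : X.Opens} {j k : Fin n} (h : IsTrivializing D b W j)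
    (hjk : j ≠ k) : ∃ z, z ∈ divOpen D b W k ∧ ∀ i, D.toBase b z ∈ chart i := by
  have := h.isDomain hjk
  obtain ⟨z, hz, hz'⟩ := exists_mem_of_isDomain (h.affine_divOpen k)
  exact ⟨z, hz, fun i => (mem_basicOpen_divRatio hz).1 (hz' _ (h.divRatio_ne_zero hjk i))⟩

/-- The universal divisor of a linear system of dimension at least one is integral. -/
theorem isIntegral_universalDivisor (hD : D.BasepointFree) (hn : 2 ≤ n) :
    IsIntegral (D.universalDivisor b) := by
  have hex : ∀ j : Fin n, ∃ k, j ≠ k := fun j => by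
    have : Nontrivial (Fin n) := Fin.nontrivial_iff_two_le.2 hn
    obtain ⟨k, hk⟩ := exists_ne j
    exact ⟨k, hk.symm⟩
  have : Nonempty (D.universalDivisor b) := by
    obtain ⟨W, -, -, j, hj⟩ := exists_isTrivializing (b := b) hD (x := genericPoint X) (V := ⊤)
      trivial
    obtain ⟨k, hk⟩ := hex j
    obtain ⟨z, -⟩ := hj.exists_mem hk
    exact ⟨z⟩
  refine isIntegral_of_cover {E | ∃ W j k, IsTrivializing D b W j ∧ j ≠ k ∧ E = divOpen D b W k}
    ?_ ?_ ?_
  · rintro _ ⟨W, j, k, h, hjk, rfl⟩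
    exact ⟨h.affine_divOpen k, h.isDomain hjk⟩
  · intro z
    obtain ⟨W, -, hz, j, hj⟩ := exists_isTrivializing (b := b) hD (x := D.toX b z) (V := ⊤) trivial
    obtain ⟨k, hjk, hk⟩ := hj.exists_mem_divOpen hz
    exact ⟨_, ⟨W, j, k, hj, hjk, rfl⟩, hk⟩
  · rintro _ ⟨W, j, k, h, hjk, rfl⟩ _ ⟨W', j', k', h', hjk', rfl⟩
    obtain ⟨w, hw⟩ := h.2.1
    obtain ⟨w', hw'⟩ := h'.2.1
    obtain ⟨_, ⟨V, hV, rfl⟩, hηV, hle⟩ := X.isBasis_affineOpens.exists_subset_of_mem_open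
      (mem_inf (genericPoint_mem hw) (genericPoint_mem hw')) (W ⊓ W').isOpen
    obtain ⟨z, hz, hz'⟩ := (h.mono hV ⟨_, hηV⟩ fun y hy => (hle hy).1).exists_mem hjk
    have hzV : D.toX b z ∈ W ⊓ W' := hle hz.1
    exact ⟨z, ⟨hzV.1, hz.2⟩, ⟨hzV.2, hz' k'⟩⟩

end Good

/-! ### Coordinates as rational functions on the universal divisor -/

section Homogenization

open Polynomial

/-- Homogenizing a polynomial with constant term `1` by a new variable `t` yields a monic polynomial
in `t`. -/
theorem exists_monic_homogenization {σ A B K : Type*} [CommRing A] [CommRing B] [Nontrivial B]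
    [Field K] (f : A →+* B) (g : σ → B) {h : MvPolynomial σ A}
    (h0 : MvPolynomial.constantCoeff h = 1) : ∃ (Q : B[X]) (N : ℕ), Q.Monic ∧
      ∀ Ψ : B[X] →+* K, Ψ X ≠ 0 → Ψ Q = Ψ X ^ N *
        h.eval₂ ((Ψ.comp C).comp f) fun i => Ψ (C (g i)) / Ψ X := by
  classical
  let N := h.totalDegree + 1
  have hdeg : ∀ d ∈ h.support, d.sum (fun _ e => e) < N := fun d hd =>
    Nat.lt_succ_of_le (MvPolynomial.le_totalDegree hd)
  have h0s : (0 : σ →₀ ℕ) ∈ insert 0 h.support := Finset.mem_insert_self _ _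
  let c : (σ →₀ ℕ) → B := fun d => f (h.coeff d) * d.prod fun i e => g i ^ e
  let q : B[X] := ∑ d ∈ h.support.erase 0, C (c d) * X ^ (N - d.sum fun _ e => e)
  refine ⟨X ^ N + q, N, ?_, fun Ψ hΨ => ?_⟩
  · refine monic_X_pow_add ?_
    refine (degree_sum_le _ _).trans_lt
      ((Finset.sup_lt_iff (WithBot.bot_lt_coe N)).2 fun d hd => ?_)
    refine (degree_C_mul_X_pow_le _ _).trans_lt ?_
    refine WithBot.coe_lt_coe.2 (Nat.sub_lt (Nat.succ_pos _) (Nat.pos_of_ne_zero fun hs =>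
      Finset.ne_of_mem_erase hd ?_))
    rw [Finsupp.sum, Finset.sum_eq_zero_iff] at hs
    ext i
    by_contra hi
    exact hi (hs i (Finsupp.mem_support_iff.2 hi))
  · have hterm : ∀ d, d.sum (fun _ e => e) ≤ N → Ψ (C (c d) * X ^ (N - d.sum fun _ e => e)) =
        Ψ X ^ N * (((Ψ.comp C).comp f) (h.coeff d) *
          d.prod fun i e => (Ψ (C (g i)) / Ψ X) ^ e) := by
      intro d hd
      have e1 : (d.prod fun i e => (Ψ (C (g i)) / Ψ X) ^ e) * Ψ X ^ (d.sum fun _ e => e) =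
          Ψ (C (d.prod fun i e => g i ^ e)) := by
        simp only [Finsupp.prod, Finsupp.sum, map_prod, map_pow, ← Finset.prod_pow_eq_pow_sum,
          ← Finset.prod_mul_distrib, ← mul_pow, div_mul_cancel₀ _ hΨ]
      have e2 : Ψ X ^ N = Ψ X ^ (d.sum fun _ e => e) * Ψ X ^ (N - d.sum fun _ e => e) := by
        rw [← pow_add, Nat.add_sub_cancel' hd]
      simp only [c, map_mul, map_pow, RingHom.comp_apply] at e1 ⊢
      rw [← e1, e2]
      ring
    have hX : (X : B[X]) ^ N = C (c 0) * X ^ (N - (0 : σ →₀ ℕ).sum fun _ e => e) := by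
      have : h.coeff 0 = 1 := h0
      simp [c, this]
    have hs : MvPolynomial.eval₂ ((Ψ.comp C).comp f) (fun i => Ψ (C (g i)) / Ψ X) h =
        ∑ d ∈ insert 0 h.support, ((Ψ.comp C).comp f) (h.coeff d) *
          d.prod fun i e => (Ψ (C (g i)) / Ψ X) ^ e := by
      rw [MvPolynomial.eval₂_eq]
      refine Finset.sum_subset (Finset.subset_insert _ _) fun d _ hd => ?_
      rw [MvPolynomial.notMem_support_iff.1 hd, map_zero, zero_mul]
    rw [hs, ← Finset.insert_erase h0s, Finset.sum_insert (Finset.notMem_erase _ _), mul_add,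
      Finset.erase_insert_eq_erase, map_add, hX, hterm 0 (by simp), map_sum, Finset.mul_sum]
    congr 1
    exact Finset.sum_congr rfl fun d hd => hterm d (hdeg d (Finset.mem_of_mem_erase hd)).le

/-- A polynomial ring as a ring of polynomials in one of the variables. -/
def splitVariable {σ : Type*} [DecidableEq σ] (A : Type*) [CommRing A] (l : σ) :
    MvPolynomial σ A ≃ₐ[A] (MvPolynomial {i : σ // i ≠ l} A)[X] :=
  (MvPolynomial.renameEquiv A (Equiv.optionSubtypeNe l).symm).trans
    (MvPolynomial.optionEquivLeft A _)

section

variable {σ : Type*} [DecidableEq σ] {A : Type*} [CommRing A] (l : σ)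

theorem splitVariable_X_self : splitVariable A l (MvPolynomial.X l) = X := by
  rw [splitVariable, AlgEquiv.trans_apply, MvPolynomial.renameEquiv_apply, MvPolynomial.rename_X,
    Equiv.optionSubtypeNe_symm_self, MvPolynomial.optionEquivLeft_X_none]

theorem splitVariable_X_of_ne {i : σ} (hi : i ≠ l) :
    splitVariable A l (MvPolynomial.X i) = C (MvPolynomial.X ⟨i, hi⟩) := by
  rw [splitVariable, AlgEquiv.trans_apply, MvPolynomial.renameEquiv_apply, MvPolynomial.rename_X,
    Equiv.optionSubtypeNe_symm_of_ne hi, MvPolynomial.optionEquivLeft_X_some]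

theorem splitVariable_C (a : A) :
    splitVariable A l (MvPolynomial.C a) = C (MvPolynomial.C a) :=
  (splitVariable A l).commutes a

end

end Homogenization

theorem isUnit_res_basicOpen {X : Scheme.{u}} {W : X.Opens} (c : Γ(X, W)) :
    IsUnit (res (X.basicOpen_le c) c) :=
  RingedSpace.isUnit_res_basicOpen X.toRingedSpace c

section Coordinates

variable {X : Scheme.{0}} {p : X ⟶ Spec (.of ℂ)} {D : LinearSystem p}
  {n : ℕ} {b : Module.Basis (Fin n) ℂ D.V} [IsIntegral (D.universalDivisor b)]

variable (D b) in
/-- The generic point of the universal divisor lies over every nonempty open subset of `X` and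
over every standard chart of projective space. -/
def GenericOver : Prop :=
  (∀ k, genericPoint (D.universalDivisor b) ∈ D.toBase b ⁻¹ᵁ chart k) ∧
    ∀ W : X.Opens, (∃ x, x ∈ W) → genericPoint (D.universalDivisor b) ∈ D.toX b ⁻¹ᵁ W

theorem genericOver [IsIntegral X] (hD : D.BasepointFree) (hn : 2 ≤ n) : GenericOver D b := by
  have key : ∀ V : X.Opens, (∃ x, x ∈ V) → ∃ z, D.toX b z ∈ V ∧ ∀ k, D.toBase b z ∈ chart k := by
    rintro V ⟨x, hx⟩
    obtain ⟨W, hWV, -, j, hj⟩ := exists_isTrivializing (b := b) hD hx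
    have : Nontrivial (Fin n) := Fin.nontrivial_iff_two_le.2 hn
    obtain ⟨k, hk⟩ := exists_ne j
    obtain ⟨z, hz, hz'⟩ := hj.exists_mem hk.symm
    exact ⟨z, hWV hz.1, hz'⟩
  refine ⟨fun k => ?_, fun W hW => ?_⟩
  · obtain ⟨z, -, hz⟩ := key ⊤ ⟨genericPoint X, trivial⟩
    exact genericPoint_mem (hz k : z ∈ D.toBase b ⁻¹ᵁ chart k)
  · obtain ⟨z, hz, -⟩ := key W hW
    exact genericPoint_mem (hz : z ∈ D.toX b ⁻¹ᵁ W)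

namespace GenericOver

variable (H : GenericOver D b)

include H in
theorem mem_divOpen {W : X.Opens} (hW : ∃ x, x ∈ W) (k : Fin n) :
    genericPoint (D.universalDivisor b) ∈ divOpen D b W k :=
  mem_inf (H.2 W hW) (H.1 k)

/-- The rational function `xᵢ / xₖ` on the universal divisor. -/
def coord (i k : Fin n) : (D.universalDivisor b).functionField :=
  toK (D.toBase b ⁻¹ᵁ chart k) (H.1 k) (pull (D.toBase b) le_rfl (ratio i k))

theorem toK_divRatio {W : X.Opens} (hW : ∃ x, x ∈ W) (i k : Fin n) :
    toK (divOpen D b W k) (H.mem_divOpen hW k) (divRatio D b W i k) = H.coord i k := by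
  rw [coord, ← toK_res (divOpen_le_right D b k) (H.mem_divOpen hW k)]
  exact congrArg _ (res_pull _ _ _ _).symm

theorem toK_pull_ratio {V : (D.universalDivisor b).Opens} {i k : Fin n} {U : (PSpace n).Opens}
    (hU : U ≤ chart k) (hV : V ≤ D.toBase b ⁻¹ᵁ U)
    (hη : genericPoint (D.universalDivisor b) ∈ V) :
    toK V hη (pull (D.toBase b) hV (res hU (ratio i k))) = H.coord i k := by
  have hV' : V ≤ D.toBase b ⁻¹ᵁ chart k := fun z hz => hU (hV hz)
  rw [coord, ← toK_res hV' hη, pull_res]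
  exact congrArg _ (res_pull _ _ _ _).symm

theorem coord_self (k : Fin n) : H.coord k k = 1 := by
  rw [coord, ratio_self, map_one, map_one]

theorem coord_mul (i k m : Fin n) : H.coord k m * H.coord i k = H.coord i m := by
  have hV : genericPoint (D.universalDivisor b) ∈
      D.toBase b ⁻¹ᵁ (chart m ⊓ chart k) := mem_inf (H.1 m) (H.1 k)
  have := congrArg (toK _ hV) (congrArg (pull (D.toBase b) le_rfl)
    (ratio_mul i m k (V := chart m ⊓ chart k) inf_le_left inf_le_right))
  rw [map_mul, map_mul, toK_pull_ratio, toK_pull_ratio, toK_pull_ratio] at this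
  exact this.symm

theorem coord_ne_zero (i k : Fin n) : H.coord i k ≠ 0 := by
  have := H.coord_mul k i k
  rw [coord_self] at this
  exact left_ne_zero_of_mul_eq_one this

theorem coord_inv (i k : Fin n) : (H.coord i k)⁻¹ = H.coord k i := by
  refine inv_eq_of_mul_eq_one_right ?_
  rw [coord_mul, coord_self]

theorem coord_div (i k m : Fin n) : H.coord i m / H.coord k m = H.coord i k := by
  rw [div_eq_iff (H.coord_ne_zero k m), mul_comm, coord_mul]

theorem unitAt_coord_iff {z : D.universalDivisor b} {i k : Fin n} (hk : D.toBase b z ∈ chart k) :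
    UnitAt z (H.coord i k) ↔ D.toBase b z ∈ chart i := by
  exact (unitAt_toK_iff (H.1 k) _ (hk : z ∈ D.toBase b ⁻¹ᵁ chart k)).trans
    ((mem_basicOpen_pull (D.toBase b) le_rfl (ratio i k) (hk : z ∈ D.toBase b ⁻¹ᵁ chart k)).trans
      (mem_basicOpen_ratio hk))

/-- Functions on an open subset of `X` as rational functions on the universal divisor. -/
def coef (W : X.Opens) (hW : ∃ x, x ∈ W) : Γ(X, W) →+* (D.universalDivisor b).functionField :=
  (toK (D.toX b ⁻¹ᵁ W) (H.2 W hW)).comp (pull (D.toX b) le_rfl)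

theorem toK_pull {W : X.Opens} (hW : ∃ x, x ∈ W) {V : (D.universalDivisor b).Opens}
    (hV : V ≤ D.toX b ⁻¹ᵁ W) (hη : genericPoint (D.universalDivisor b) ∈ V) (a : Γ(X, W)) :
    toK V hη (pull (D.toX b) hV a) = H.coef W hW a := by
  rw [coef, RingHom.comp_apply, ← toK_res hV hη]
  exact congrArg _ (res_pull _ _ _ _).symm

theorem coef_res {W W' : X.Opens} (h : W' ≤ W) (hW' : ∃ x, x ∈ W') (hW : ∃ x, x ∈ W)
    (a : Γ(X, W)) : H.coef W' hW' (res h a) = H.coef W hW a := by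
  rw [← H.toK_pull hW (V := D.toX b ⁻¹ᵁ W') (fun z hz => h hz) (H.2 W' hW')]
  exact congrArg _ (pull_res _ _ _ _)

theorem unitAt_coef {W : X.Opens} (hW : ∃ x, x ∈ W) {a : Γ(X, W)} (ha : IsUnit a)
    {z : D.universalDivisor b} (hz : D.toX b z ∈ W) : UnitAt z (H.coef W hW a) :=
  UnitAt.of_isUnit _ (ha.map _) (hz : z ∈ D.toX b ⁻¹ᵁ W)

/-- Polynomials in the quotients `xᵢ / xₖ` as rational functions. -/
def evalK (W : X.Opens) (hW : ∃ x, x ∈ W) (j k : Fin n) :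
    MvPolynomial {i : Fin n // i ≠ j ∧ i ≠ k} Γ(X, W) →+* (D.universalDivisor b).functionField :=
  MvPolynomial.eval₂Hom (H.coef W hW) fun i => H.coord i.1 k

theorem toK_divEval {W : X.Opens} (hW : ∃ x, x ∈ W) (j k : Fin n)
    (P : MvPolynomial {i : Fin n // i ≠ j ∧ i ≠ k} Γ(X, W)) :
    toK (divOpen D b W k) (H.mem_divOpen hW k) (divEval D b W j k P) = H.evalK W hW j k P := by
  have : (toK (divOpen D b W k) (H.mem_divOpen hW k)).comp (divEval D b W j k) =
      H.evalK W hW j k := by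
    refine MvPolynomial.ringHom_ext (fun a => ?_) fun i => ?_
    · rw [RingHom.comp_apply, divEval_C, evalK, MvPolynomial.eval₂Hom_C]
      exact H.toK_pull hW _ _ a
    · rw [RingHom.comp_apply, divEval_X, evalK, MvPolynomial.eval₂Hom_X']
      exact H.toK_divRatio hW i.1 k
  exact RingHom.congr_fun this P

theorem evalK_map {W W' : X.Opens} (h : W' ≤ W) (hW' : ∃ x, x ∈ W') (hW : ∃ x, x ∈ W)
    (j k : Fin n) (P : MvPolynomial {i : Fin n // i ≠ j ∧ i ≠ k} Γ(X, W)) :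
    H.evalK W' hW' j k (MvPolynomial.map (res h) P) = H.evalK W hW j k P := by
  refine (MvPolynomial.eval₂_map _ _ _ _).trans ?_
  refine congrArg (fun f => MvPolynomial.eval₂ f _ P) (RingHom.ext fun a => ?_)
  exact H.coef_res h hW' hW a

theorem evalK_injective [IsIntegral X] {W : X.Opens} {j k : Fin n} (h : IsTrivializing D b W j)
    (hjk : j ≠ k) : Function.Injective (H.evalK W h.2.1 j k) := by
  intro P Q hPQ
  rw [← toK_divEval, ← toK_divEval] at hPQ
  exact (h.bijective hjk).1 (toK_injective _ _ hPQ)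

end GenericOver

end Coordinates

/-! ### Cartier divisors on the charts -/

section Local

variable {X : Scheme.{0}} {p : X ⟶ Spec (.of ℂ)} {D : LinearSystem p}
  {n : ℕ} {b : Module.Basis (Fin n) ℂ D.V} [IsIntegral (D.universalDivisor b)]

namespace GenericOver

variable (H : GenericOver D b) {φ : D.universalDivisor b → (D.universalDivisor b).functionField}

/-- The Cartier divisor `φ` is trivial on the part of a chart of the universal divisor where a
certain polynomial with constant term `1` does not vanish; in particular it is trivial
along the section on which all the quotients `xᵢ / xₗ`, `i ≠ j, l`, vanish. -/
def TrivialNear (φ : D.universalDivisor b → (D.universalDivisor b).functionField) (W : X.Opens)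
    (j l : Fin n) : Prop :=
  ∃ (hW : ∃ x, x ∈ W) (κ : (D.universalDivisor b).functionField) (_ : κ ≠ 0)
    (h : MvPolynomial {i : Fin n // i ≠ j ∧ i ≠ l} Γ(X, W)), MvPolynomial.constantCoeff h = 1 ∧
      ∀ z ∈ divOpen D b W l, UnitAt z (H.evalK W hW j l h) → UnitAt z (φ z / κ)

theorem TrivialNear.mono {W W' : X.Opens} {j l : Fin n} (h : H.TrivialNear φ W j l)
    (hle : W' ≤ W) (hW' : ∃ x, x ∈ W') : H.TrivialNear φ W' j l := by
  obtain ⟨hW, κ, hκ, P, hP, hz⟩ := h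
  refine ⟨hW', κ, hκ, MvPolynomial.map (res hle) P, ?_, fun z hzW hu => hz z ⟨hle hzW.1, hzW.2⟩ ?_⟩
  · rw [MvPolynomial.constantCoeff_map, hP, map_one]
  · rwa [H.evalK_map hle hW' hW] at hu

/-- The point over `x` at which all the quotients `xᵢ / xₗ`, `i ≠ j, l`, vanish has a basic open
neighbourhood on which `φ` is principal. It is defined by a polynomial whose constant term does not
vanish at `x`, and over a smaller neighbourhood of `x` one can divide by this term. -/
theorem exists_trivialNear (hφ : LocPrincipal φ) {W : X.Opens} {j l : Fin n}
    (h : IsTrivializing D b W j) (hjl : j ≠ l) {x : X} (hx : x ∈ W) :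
    ∃ W' ≤ W, x ∈ W' ∧ IsTrivializing D b W' j ∧ H.TrivialNear φ W' j l := by
  let e := RingEquiv.ofBijective _ (h.bijective hjl)
  let P₀ : Ideal Γ(X, W) := (IsLocalRing.maximalIdeal (X.presheaf.stalk x)).comap
    (X.presheaf.germ W x hx).hom
  have hP₀ : ∀ a, a ∉ P₀ → x ∈ X.basicOpen a := by
    intro a ha
    rw [Scheme.mem_basicOpen _ _ _ hx]
    by_contra hu
    exact ha ((IsLocalRing.mem_maximalIdeal _).2 hu)
  let P : Ideal Γ(D.universalDivisor b, divOpen D b W l) :=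
    P₀.comap ((MvPolynomial.constantCoeff).comp e.symm.toRingHom)
  have : P₀.IsPrime := Ideal.comap_isPrime _ _
  have : P.IsPrime := Ideal.comap_isPrime _ _
  obtain ⟨z, hz, hzP⟩ := exists_point_of_isPrime (h.affine_divOpen l) P
  obtain ⟨V, hzV, hV⟩ := hφ.2 z
  obtain ⟨r, hrV, hzr⟩ := (h.affine_divOpen l).exists_basicOpen_le ⟨z, hzV⟩ hz
  set c := MvPolynomial.constantCoeff (e.symm r) with hc
  have hxc : x ∈ X.basicOpen c := hP₀ c ((hzP r).1 hzr)
  have hle := X.basicOpen_le c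
  obtain ⟨c', hc'⟩ := (isUnit_res_basicOpen c).exists_left_inv
  refine ⟨X.basicOpen c, hle, hxc, h.mono (h.1.basicOpen c) ⟨x, hxc⟩ hle, ⟨x, hxc⟩, φ z, hφ.1 z,
    MvPolynomial.C c' * MvPolynomial.map (res hle) (e.symm r), ?_, fun z' hz' hu => ?_⟩
  · rw [map_mul, MvPolynomial.constantCoeff_C, MvPolynomial.constantCoeff_map, ← hc, hc']
  · refine hV z' (hrV ((unitAt_toK_iff (H.mem_divOpen h.2.1 l) r ⟨hle hz'.1, hz'.2⟩).1 ?_))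
    have e1 : toK _ (H.mem_divOpen h.2.1 l) r = H.evalK W h.2.1 j l (e.symm r) := by
      rw [← toK_divEval]
      exact congrArg _ (e.apply_symm_apply r).symm
    rw [map_mul, H.evalK_map hle ⟨x, hxc⟩ h.2.1, ← e1] at hu
    have e2 : H.evalK (X.basicOpen c) ⟨x, hxc⟩ j l (MvPolynomial.C c') =
        H.coef (X.basicOpen c) ⟨x, hxc⟩ c' := MvPolynomial.eval₂Hom_C _ _ _
    have e3 : UnitAt z' (H.coef (X.basicOpen c) ⟨x, hxc⟩ c') :=
      H.unitAt_coef _ (IsUnit.of_mul_eq_one _ hc') hz'.1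
    rw [e2] at hu
    have := hu.div e3
    rwa [mul_div_cancel_left₀ _ e3.1] at this

/-- Finitely many shrinkings of `W` serve for all the charts. -/
theorem exists_forall_trivialNear (hφ : LocPrincipal φ) {W : X.Opens} {j : Fin n}
    (h : IsTrivializing D b W j) {x : X} (hx : x ∈ W) :
    ∃ W' ≤ W, x ∈ W' ∧ IsTrivializing D b W' j ∧ ∀ l, j ≠ l → H.TrivialNear φ W' j l := by
  classical
  suffices hs : ∀ S : Finset (Fin n), ∃ W' ≤ W, x ∈ W' ∧ IsTrivializing D b W' j ∧
      ∀ l ∈ S, j ≠ l → H.TrivialNear φ W' j l by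
    obtain ⟨W', hle, hxW, hW', hl⟩ := hs Finset.univ
    exact ⟨W', hle, hxW, hW', fun l => hl l (Finset.mem_univ l)⟩
  intro S
  induction S using Finset.induction_on with
  | empty => exact ⟨W, le_rfl, hx, h, fun l hl => absurd hl (Finset.notMem_empty l)⟩
  | insert m S _ ih =>
    obtain ⟨W', hle, hxW, hW', hl⟩ := ih
    by_cases hjm : j = m
    · refine ⟨W', hle, hxW, hW', fun l hlS hjl => ?_⟩
      rcases Finset.mem_insert.1 hlS with rfl | hlS
      · exact absurd hjm hjl
      · exact hl l hlS hjl
    · obtain ⟨W'', hle', hxW', hW'', hm⟩ := H.exists_trivialNear hφ hW' hjm hxW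
      refine ⟨W'', hle'.trans hle, hxW', hW'', fun l hlS hjl => ?_⟩
      rcases Finset.mem_insert.1 hlS with rfl | hlS
      · exact hm
      · exact (hl l hlS hjl).mono H hle' ⟨x, hxW'⟩

/-- A Cartier divisor is principal on the charts of the universal divisor over a sufficiently
small open subset of `X`. Homogenizing the polynomial for the chart `xₗ ≠ 0`, one finds a monic
polynomial in `xₗ / xₖ` outside of whose zero set the Cartier divisor is principal. -/
theorem exists_forall_unitAt_divOpen [IsIntegral X] (hφ : LocPrincipal φ) {W : X.Opens}
    {j k : Fin n} (h : IsTrivializing D b W j)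
    (hl : ∀ l, j ≠ l → H.TrivialNear φ W j l) (hjk : j ≠ k) :
    ∃ κ : (D.universalDivisor b).functionField, κ ≠ 0 ∧
      ∀ z ∈ divOpen D b W k, UnitAt z (φ z / κ) := by
  classical
  have := h.isDomain_coef
  by_cases hex : ∃ l, j ≠ l ∧ k ≠ l
  · obtain ⟨l, hjl, hkl⟩ := hex
    obtain ⟨hW, κ, hκ, P, hP, hz⟩ := hl l hjl
    -- `xₗ / xₖ` is the variable `t` of the polynomial ring in which the given polynomial is monic
    let l' : {i : Fin n // i ≠ j ∧ i ≠ k} := ⟨l, hjl.symm, hkl.symm⟩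
    let E := splitVariable Γ(X, W) l'
    let Θ : Γ(D.universalDivisor b, divOpen D b W k) ≃+*
        Polynomial (MvPolynomial {i // i ≠ l'} Γ(X, W)) :=
      (RingEquiv.ofBijective _ (h.bijective hjk)).symm.trans E.toRingEquiv
    let Ψ : Polynomial (MvPolynomial {i // i ≠ l'} Γ(X, W)) →+*
        (D.universalDivisor b).functionField :=
      (toK _ (H.mem_divOpen hW k)).comp Θ.symm.toRingHom
    have hΨ : ∀ Q, Ψ (E Q) = H.evalK W hW j k Q := by
      intro Q
      rw [← toK_divEval]
      refine congrArg (toK _ (H.mem_divOpen hW k)) (Θ.symm_apply_eq.2 ?_)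
      exact congrArg E ((RingEquiv.ofBijective _ (h.bijective hjk)).symm_apply_apply Q).symm
    have hΨX : Ψ Polynomial.X = H.coord l k := by
      rw [← splitVariable_X_self l', hΨ]
      exact MvPolynomial.eval₂Hom_X' _ _ _
    have hΨXi : ∀ i hi, Ψ (Polynomial.C (MvPolynomial.X ⟨i, hi⟩)) = H.coord i.1 k := by
      intro i hi
      rw [← splitVariable_X_of_ne l' hi, hΨ]
      exact MvPolynomial.eval₂Hom_X' _ _ _
    have hΨC : ∀ a, Ψ (Polynomial.C (MvPolynomial.C a)) = H.coef W hW a := by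
      intro a
      rw [← splitVariable_C l', hΨ]
      exact MvPolynomial.eval₂Hom_C _ _ _
    let g : {i : Fin n // i ≠ j ∧ i ≠ l} → MvPolynomial {i // i ≠ l'} Γ(X, W) := fun i =>
      if hi : i.1 = k then 1 else
        MvPolynomial.X ⟨⟨i.1, i.2.1, hi⟩, fun he => i.2.2 (congrArg Subtype.val he)⟩
    obtain ⟨Q, N, hQ, hQΨ⟩ := exists_monic_homogenization
      (K := (D.universalDivisor b).functionField)
      (MvPolynomial.C : Γ(X, W) →+* MvPolynomial {i // i ≠ l'} Γ(X, W)) g hP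
    have hQK : Ψ Q = H.coord l k ^ N * H.evalK W hW j l P := by
      rw [hQΨ Ψ (by rw [hΨX]; exact H.coord_ne_zero _ _), hΨX]
      have e1 : (Ψ.comp Polynomial.C).comp MvPolynomial.C = H.coef W hW := RingHom.ext hΨC
      have e2 : (fun i => Ψ (Polynomial.C (g i)) / H.coord l k) = fun i => H.coord i.1 l := by
        ext1 i
        by_cases hi : i.1 = k
        · simp only [g, dif_pos hi]
          rw [map_one, map_one, one_div, coord_inv, hi]
        · simp only [g, dif_neg hi]
          rw [hΨXi, coord_div]
      rw [e1, e2]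
      rfl
    -- the factor `t` makes sure that the complement of the zero set lies in the chart `xₗ ≠ 0`
    have hXQ : (Polynomial.X * Q).Monic := Polynomial.monic_X.mul hQ
    have hf : Θ.symm (Polynomial.X * Q) ≠ 0 := (map_ne_zero_iff _ Θ.symm.injective).2 hXQ.ne_zero
    obtain ⟨I, J, M, hIJ, hI⟩ := (hφ.div_const hκ).exists_ideals (h.affine_divOpen k)
      (H.mem_divOpen hW k) hf fun z hzf => by
        have hzk : z ∈ divOpen D b W k := (Scheme.basicOpen_le _ _) hzf
        rw [map_mul, Scheme.basicOpen_mul] at hzf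
        have h1 : UnitAt z (Ψ Polynomial.X) := (unitAt_toK_iff (H.mem_divOpen hW k) _ hzk).2 hzf.1
        have h2 : UnitAt z (Ψ Q) := (unitAt_toK_iff (H.mem_divOpen hW k) _ hzk).2 hzf.2
        rw [hΨX] at h1
        have h3 := h2.div (h1.pow N)
        rw [hQK, mul_div_cancel_left₀ _ (h1.pow N).1] at h3
        exact hz z ⟨hzk.1, (H.unitAt_coord_iff hzk.2).1 h1⟩ h3
    have hIJ' : I.map Θ.toRingHom * J.map Θ.toRingHom =
        Ideal.span {(Polynomial.X * Q) ^ M} := by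
      rw [← Ideal.map_mul, hIJ, Ideal.map_span, Set.image_singleton]
      simp
    obtain ⟨g₀, hg₀⟩ := isPrincipal_of_mul_eq_span_monic (hXQ.pow M) hIJ'
    obtain ⟨κ', hκ', hκ''⟩ := hI (Θ.symm g₀) (by
      have h1 := congrArg (Ideal.map Θ.symm.toRingHom) hg₀
      rw [Ideal.map_span, Set.image_singleton, Ideal.map_map] at h1
      simpa using h1)
    refine ⟨κ * κ', mul_ne_zero hκ hκ', fun z hz' => ?_⟩
    rw [← div_div]
    exact hκ'' z hz'
  · -- if `k` is the only index different from `j`, there are no variables and the polynomial is `1`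
    push Not at hex
    obtain ⟨hW, κ, hκ, P, hP, hz⟩ := hl k hjk
    have : IsEmpty {i : Fin n // i ≠ j ∧ i ≠ k} := ⟨fun i => i.2.2 (hex i.1 i.2.1.symm).symm⟩
    refine ⟨κ, hκ, fun z hzk => hz z hzk ?_⟩
    rw [MvPolynomial.eq_C_of_isEmpty P]
    have : P.coeff 0 = 1 := hP
    rw [this, map_one, map_one]
    exact UnitAt.one

end GenericOver

end Local

/-! ### Transition between charts -/

section Transition

variable {X : Scheme.{0}} {p : X ⟶ Spec (.of ℂ)} {D : LinearSystem p}
  {n : ℕ} {b : Module.Basis (Fin n) ℂ D.V} [IsIntegral X] [IsIntegral (D.universalDivisor b)]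

namespace GenericOver

variable (H : GenericOver D b) {φ : D.universalDivisor b → (D.universalDivisor b).functionField}
  {W : X.Opens} {j k l m : Fin n}

/-- Evaluate the corresponding identity of polynomials in the quotients `xᵢ / xₖ` at the point with
`xₗ = 0` and all other coordinates `1`. The index `m = k` is allowed. -/
theorem exponent_eq_zero_of_pow (h : IsTrivializing D b W j) (hjk : j ≠ k) (hjl : j ≠ l)
    (hkl : k ≠ l) (hjm : j ≠ m) (hlm : l ≠ m) (u : Γ(X, W)ˣ) {N a c : ℕ}
    (hu : H.coef W h.2.1 u * H.coord l k ^ N * H.coord m k ^ a = H.coord m k ^ c) : N = 0 := by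
  have := h.isDomain_coef
  let l' : {i : Fin n // i ≠ j ∧ i ≠ k} := ⟨l, hjl.symm, hkl.symm⟩
  obtain ⟨P, hP, hP1⟩ : ∃ P, H.evalK W h.2.1 j k P = H.coord m k ∧
      MvPolynomial.eval (fun i => if i = l' then 0 else 1) P = 1 := by
    by_cases hmk : m = k
    · exact ⟨1, by rw [map_one, hmk, coord_self], map_one _⟩
    · refine ⟨MvPolynomial.X ⟨m, hjm.symm, hmk⟩, MvPolynomial.eval₂Hom_X' _ _ _, ?_⟩
      rw [MvPolynomial.eval_X, if_neg fun he => hlm (congrArg Subtype.val he).symm]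
  have hl : H.evalK W h.2.1 j k (MvPolynomial.X l') = H.coord l k :=
    MvPolynomial.eval₂Hom_X' _ _ _
  have hC : H.evalK W h.2.1 j k (MvPolynomial.C (u : Γ(X, W))) = H.coef W h.2.1 u :=
    MvPolynomial.eval₂Hom_C _ _ _
  rw [← hP, ← hl, ← hC, ← map_pow, ← map_pow, ← map_pow, ← map_mul, ← map_mul] at hu
  have h1 := congrArg (MvPolynomial.eval fun i => if i = l' then 0 else 1)
    (H.evalK_injective h hjk hu)
  rw [map_mul, map_mul, map_pow, map_pow, map_pow, hP1, MvPolynomial.eval_C, MvPolynomial.eval_X,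
    if_pos rfl, one_pow, one_pow, mul_one] at h1
  by_contra hN
  rw [zero_pow hN, mul_zero] at h1
  exact zero_ne_one h1

/-- Powers of different coordinates are multiplicatively independent modulo units of `Γ(X, W)`. -/
theorem exponent_eq_zero (h : IsTrivializing D b W j) (hjk : j ≠ k) (hjl : j ≠ l)
    (hkl : k ≠ l) (hjm : j ≠ m) (hlm : l ≠ m) (u : Γ(X, W)ˣ) {d e : ℤ}
    (hu : H.coef W h.2.1 u * H.coord l k ^ d = H.coord m k ^ e) : d = 0 := by
  have key : ∀ (N : ℕ) (e : ℤ) (u : Γ(X, W)ˣ),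
      H.coef W h.2.1 u * H.coord l k ^ N = H.coord m k ^ e → N = 0 := by
    intro N e u hu
    have hm := H.coord_ne_zero m k
    refine H.exponent_eq_zero_of_pow h hjk hjl hkl hjm hlm u (N := N) (a := (-e).toNat)
      (c := e.toNat) ?_
    rw [hu, ← zpow_natCast, ← zpow_natCast, ← zpow_add₀ hm]
    congr 1
    omega
  obtain ⟨N, rfl | rfl⟩ := d.eq_nat_or_neg
  · rw [zpow_natCast] at hu
    rw [key N e u hu, Nat.cast_zero]
  · have h1 : H.coef W h.2.1 (u : Γ(X, W)) * H.coef W h.2.1 (↑u⁻¹ : Γ(X, W)) = 1 := by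
      rw [← map_mul, Units.mul_inv, map_one]
    have hl := pow_ne_zero N (H.coord_ne_zero l k)
    rw [key N (-e) u⁻¹ ?_, Nat.cast_zero, neg_zero]
    rw [zpow_neg, ← hu, zpow_neg, zpow_natCast, mul_inv, inv_inv,
      eq_inv_of_mul_eq_one_right h1]

/-- Rational functions invertible on a chart of the universal divisor are invertible functions
on `X`. -/
theorem exists_coef_eq (h : IsTrivializing D b W j) (hjk : j ≠ k)
    {a : (D.universalDivisor b).functionField} (ha : ∀ z ∈ divOpen D b W k, UnitAt z a) :
    ∃ u : Γ(X, W)ˣ, H.coef W h.2.1 u = a := by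
  have := h.isDomain_coef
  obtain ⟨s, rfl⟩ := exists_units_toK_eq (H.mem_divOpen h.2.1 k) ha
  let e := RingEquiv.ofBijective _ (h.bijective hjk)
  obtain ⟨c, hc, hcs⟩ := MvPolynomial.isUnit_iff_eq_C_of_isReduced.1 (s.isUnit.map e.symm)
  refine ⟨hc.unit, ?_⟩
  have h1 : divEval D b W j k (e.symm s) = s := e.apply_symm_apply _
  rw [← h1, toK_divEval, hcs]
  exact (MvPolynomial.eval₂Hom_C _ _ _).symm

/-- Two trivializations of a Cartier divisor on charts differ by an invertible function on `X` and
a power of the quotient of the two coordinates. -/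
theorem exists_transition (h : IsTrivializing D b W j) (hjk : j ≠ k) (hjl : j ≠ l)
    (hkl : k ≠ l) {κ κ' : (D.universalDivisor b).functionField}
    (hκ : ∀ z ∈ divOpen D b W k, UnitAt z (φ z / κ))
    (hκ' : ∀ z ∈ divOpen D b W l, UnitAt z (φ z / κ')) :
    ∃ (u : Γ(X, W)ˣ) (d : ℤ), κ = κ' * H.coef W h.2.1 u * H.coord l k ^ d := by
  have := h.isDomain_coef
  have hη := H.mem_divOpen h.2.1 k
  have ha : ∀ z ∈ (D.universalDivisor b).basicOpen (divRatio D b W l k), UnitAt z (κ / κ') := by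
    intro z hz
    have hzk : z ∈ divOpen D b W k := Scheme.basicOpen_le _ _ hz
    have hzl : D.toBase b z ∈ chart l := (mem_basicOpen_divRatio hzk).1 hz
    have h1 := hκ z hzk
    have := (hκ' z ⟨hzk.1, hzl⟩).div h1
    rwa [div_div_div_cancel_left' _ _ fun h0 => h1.1 (by rw [h0, zero_div])] at this
  have h0 : κ / κ' ≠ 0 := (ha _ ((unitAt_toK_iff hη _ hη).1
    ((H.toK_divRatio h.2.1 l k).symm ▸ ((H.unitAt_coord_iff (H.1 k)).2 (H.1 l))))).1
  obtain ⟨N, r, hr⟩ := exists_pow_mul_eq_toK (h.affine_divOpen k) hη _ fun z hz => (ha z hz).2.1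
  obtain ⟨M, s, hs⟩ := exists_pow_mul_eq_toK (h.affine_divOpen k) hη _ fun z hz => (ha z hz).2.2
  obtain ⟨P, rfl⟩ := (h.bijective hjk).2 r
  obtain ⟨Q, rfl⟩ := (h.bijective hjk).2 s
  let l' : {i : Fin n // i ≠ j ∧ i ≠ k} := ⟨l, hjl.symm, hkl.symm⟩
  have hl : H.evalK W h.2.1 j k (MvPolynomial.X l') = H.coord l k :=
    MvPolynomial.eval₂Hom_X' _ _ _
  rw [H.toK_divEval h.2.1, H.toK_divRatio h.2.1] at hr hs
  have hy := H.coord_ne_zero l k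
  have hPQ : P * Q = MvPolynomial.X l' ^ (N + M) := by
    refine H.evalK_injective h hjk ?_
    rw [map_mul, hr, hs, map_pow, hl, pow_add, mul_mul_mul_comm, mul_inv_cancel₀ h0, mul_one]
  obtain ⟨u, i, rfl⟩ := exists_eq_C_mul_X_pow hPQ
  refine ⟨u, i - N, ?_⟩
  rw [map_mul, map_pow, hl] at hr
  have hC : H.evalK W h.2.1 j k (MvPolynomial.C (u : Γ(X, W))) = H.coef W h.2.1 u :=
    MvPolynomial.eval₂Hom_C _ _ _
  have hκ'0 : κ' ≠ 0 := fun h' => h0 (by rw [h', div_zero])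
  rw [hC] at hr
  rw [zpow_sub₀ hy, zpow_natCast, zpow_natCast, mul_assoc, ← mul_div_assoc, hr]
  field_simp

/-- On the part of the universal divisor over `W`, the Cartier divisor `φ` agrees with the `d`-th
power of the pull-back of `𝒪(-1)`, which is represented by the rational functions `xₘ / xᵣ`. -/
def IsTwistOn (r : Fin n) (φ : D.universalDivisor b → (D.universalDivisor b).functionField)
    (d : ℤ) (W : X.Opens) (κ : (D.universalDivisor b).functionField) : Prop :=
  κ ≠ 0 ∧ ∀ z, D.toX b z ∈ W → ∀ m, D.toBase b z ∈ chart m →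
    UnitAt z (φ z / (κ * H.coord m r ^ d))

/-- Trivializations on the charts over `W` combine to a description of a Cartier divisor as a
twist. The exponents of the transition functions agree, by comparing them on triple
intersections. -/
theorem exists_isTwistOn (r : Fin n) (h : IsTrivializing D b W j) (hjl : j ≠ l)
    (hκ : ∀ k, j ≠ k → ∃ κ : (D.universalDivisor b).functionField, κ ≠ 0 ∧
      ∀ z ∈ divOpen D b W k, UnitAt z (φ z / κ)) :
    ∃ d κ, (n = 2 → d = 0) ∧ H.IsTwistOn r φ d W κ := by
  choose! κ hκ0 hκ using hκ
  have htr : ∀ k, j ≠ k → l ≠ k → ∃ (u : Γ(X, W)ˣ) (d : ℤ),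
      κ k = κ l * H.coef W h.2.1 u * H.coord l k ^ d := fun k hjk hlk =>
    H.exists_transition h hjk hjl hlk.symm (hκ k hjk) (hκ l hjl)
  obtain ⟨d, hd2, hd⟩ : ∃ d : ℤ, (n = 2 → d = 0) ∧ ∀ k, j ≠ k → ∃ u : Γ(X, W)ˣ,
      κ k = κ l * H.coef W h.2.1 u * H.coord l k ^ d := by
    by_cases hex : ∃ m, j ≠ m ∧ l ≠ m
    · obtain ⟨m, hjm, hlm⟩ := hex
      obtain ⟨v, d, hv⟩ := htr m hjm hlm
      refine ⟨d, fun hn => ?_, fun k hjk => ?_⟩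
      · subst hn
        omega
      by_cases hlk : l = k
      · subst hlk
        exact ⟨1, by rw [coord_self, one_zpow, Units.val_one, map_one, mul_one, mul_one]⟩
      by_cases hmk : m = k
      · exact ⟨v, hmk ▸ hv⟩
      obtain ⟨u, e, hu⟩ := htr k hjk hlk
      obtain ⟨w, f, hw⟩ := H.exists_transition h hjk hjm (Ne.symm hmk) (hκ k hjk) (hκ m hjm)
      refine ⟨u, ?_⟩
      have hlk0 := H.coord_ne_zero l k
      have hmk0 := H.coord_ne_zero m k
      -- on the chart `xₖ ≠ 0`, the cocycle condition for `k`, `l`, `m` equates a power of `xₗ / xₖ`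
      -- with a power of `xₘ / xₖ`, up to a unit
      have hed : e - d = 0 := by
        refine H.exponent_eq_zero h hjk hjl (Ne.symm hlk) hjm hlm (u / (v * w)) (e := f - d) ?_
        have hunit : ∀ t : Γ(X, W)ˣ, H.coef W h.2.1 t ≠ 0 := fun t =>
          (t.isUnit.map (H.coef W h.2.1)).ne_zero
        have h1 : H.coef W h.2.1 (↑(u / (v * w)) : Γ(X, W)) * (H.coef W h.2.1 v *
            H.coef W h.2.1 w) = H.coef W h.2.1 u := by
          rw [← map_mul, ← map_mul, ← Units.val_mul, ← Units.val_mul, div_mul_cancel]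
        have h2 : H.coord l m = H.coord l k / H.coord m k := (H.coord_div l m k).symm
        rw [hu, hv, h2, div_zpow] at hw
        have h3 := hκ0 l hjl
        have h4 := hunit v
        have h5 := hunit w
        rw [zpow_sub₀ hlk0, zpow_sub₀ hmk0]
        have h6 := zpow_ne_zero d hlk0
        have h7 := zpow_ne_zero d hmk0
        rw [← h1] at hw
        field_simp at hw ⊢
        exact hw
      rw [hu, sub_eq_zero.1 hed]
    · push Not at hex
      refine ⟨0, fun _ => rfl, fun k hjk => ⟨1, ?_⟩⟩
      rw [← hex k hjk, Units.val_one, map_one, mul_one, zpow_zero, mul_one]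
  refine ⟨-d, κ l * H.coord l r ^ d, fun hn => by rw [hd2 hn, neg_zero],
    mul_ne_zero (hκ0 l hjl) (zpow_ne_zero _ (H.coord_ne_zero _ _)), fun z hz m hm => ?_⟩
  obtain ⟨k, hjk, hzk⟩ := h.exists_mem_divOpen hz
  obtain ⟨u, hu⟩ := hd k hjk
  have h1 := (hκ k hjk z hzk).mul ((H.unitAt_coef h.2.1 u.isUnit hz).mul
    (((H.unitAt_coord_iff hzk.2).2 hm).zpow d))
  convert h1 using 1
  have h2 : H.coord l k = H.coord l m * H.coord m k := by rw [mul_comm, coord_mul]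
  have h3 : H.coord l r = H.coord m r * H.coord l m := by rw [coord_mul]
  have h4 := zpow_ne_zero d (H.coord_ne_zero m r)
  have h5 := zpow_ne_zero d (H.coord_ne_zero l m)
  have h6 := zpow_ne_zero d (H.coord_ne_zero m k)
  have h7 := (u.isUnit.map (H.coef W h.2.1)).ne_zero
  have h8 := hκ0 l hjl
  rw [hu, h2, h3, mul_zpow, mul_zpow, zpow_neg]
  field_simp

/-- The exponent of the twist does not depend on the open subset. -/
theorem IsTwistOn.exponent_eq {r : Fin n} {W' : X.Opens} {d d' : ℤ}
    {κ κ' : (D.universalDivisor b).functionField} (hD : D.BasepointFree) (hn : 3 ≤ n)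
    (h : H.IsTwistOn r φ d W κ) (hW : ∃ x, x ∈ W) (h' : H.IsTwistOn r φ d' W' κ')
    (hW' : ∃ x, x ∈ W') : d = d' := by
  obtain ⟨w, hw⟩ := hW
  obtain ⟨w', hw'⟩ := hW'
  obtain ⟨V, hV, -, j, hj⟩ := exists_isTrivializing (b := b) hD
    (mem_inf (genericPoint_mem hw) (genericPoint_mem hw'))
  obtain ⟨k, hk⟩ : ∃ k, k ∉ ({j} : Finset (Fin n)) := by
    by_contra! hc
    have := Finset.card_le_card (fun k _ => hc k : Finset.univ ⊆ _)
    rw [Finset.card_univ, Fintype.card_fin, Finset.card_singleton] at this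
    omega
  obtain ⟨l, hl⟩ : ∃ l, l ∉ ({j, k} : Finset (Fin n)) := by
    by_contra! hc
    have := (Finset.card_le_card (fun k _ => hc k : Finset.univ ⊆ _)).trans Finset.card_le_two
    rw [Finset.card_univ, Fintype.card_fin] at this
    omega
  simp only [Finset.mem_insert, Finset.mem_singleton, not_or] at hk hl
  have hy := H.coord_ne_zero
  -- comparing the expressions for two different `k`, a power of `xₖ / xₗ` is a unit on `V`
  have key : ∀ k, j ≠ k → ∃ u : Γ(X, V)ˣ,
      H.coef V hj.2.1 u = κ' / κ * H.coord k r ^ (d' - d) := by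
    intro k hjk
    refine H.exists_coef_eq hj hjk fun z hz => ?_
    have hzV := hV hz.1
    have := (h.2 z hzV.1 k hz.2).div (h'.2 z hzV.2 k hz.2)
    convert this using 1
    have h0 : φ z ≠ 0 := fun h0 => (h.2 z hzV.1 k hz.2).1 (by rw [h0, zero_div])
    have h1 := h.1
    have h2 := h'.1
    have h3 := zpow_ne_zero d (hy k r)
    have h4 := zpow_ne_zero d' (hy k r)
    rw [zpow_sub₀ (hy k r)]
    field_simp
  obtain ⟨u, hu⟩ := key k (Ne.symm hk)
  obtain ⟨v, hv⟩ := key l (Ne.symm hl.1)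
  have h1 : H.coef V hj.2.1 (↑(v / u) : Γ(X, V)) * H.coef V hj.2.1 u = H.coef V hj.2.1 v := by
    rw [← map_mul, ← Units.val_mul, div_mul_cancel]
  have h2 := H.exponent_eq_zero hj (k := l) (l := k) (m := l) (Ne.symm hl.1) (Ne.symm hk) hl.2
    (Ne.symm hl.1) (Ne.symm hl.2) (v / u) (d := d' - d) (e := 0) (by
      have h3 := H.coord_div k l r
      have h4 := zpow_ne_zero (d' - d) (hy l r)
      have h5 := zpow_ne_zero (d' - d) (hy k r)
      have h6 := h.1
      have h7 := h'.1
      rw [hu, hv] at h1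
      rw [← h3, div_zpow, zpow_zero]
      field_simp at h1 ⊢
      exact h1)
  omega

/-- Every Cartier divisor on the universal divisor is, locally over `X`, a twist, with a globally
constant exponent. For `n = 2`, when `𝒪(1)` is trivial locally over `X`, the exponent is not
unique, and `0` is chosen everywhere. -/
theorem exists_forall_isTwistOn (r : Fin n) (hD : D.BasepointFree) (hn : 2 ≤ n)
    (hφ : LocPrincipal φ) :
    ∃ d, ∀ x, ∃ W κ, x ∈ W ∧ H.IsTwistOn r φ d W κ := by
  have hloc : ∀ x : X, ∃ d W κ, x ∈ W ∧ (n = 2 → d = 0) ∧ H.IsTwistOn r φ d W κ := by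
    intro x
    obtain ⟨W, -, hx, j, hj⟩ := exists_isTrivializing (b := b) hD (x := x) (V := ⊤) trivial
    obtain ⟨W', -, hx', hj', hl⟩ := H.exists_forall_trivialNear hφ hj hx
    have : Nontrivial (Fin n) := Fin.nontrivial_iff_two_le.2 hn
    obtain ⟨l, hjl⟩ := exists_ne j
    obtain ⟨d, κ, hd, hκ⟩ := H.exists_isTwistOn r hj' hjl.symm fun k hjk =>
      H.exists_forall_unitAt_divOpen hφ hj' hl hjk
    exact ⟨d, W', κ, hx', hd, hκ⟩
  choose d W κ hx hd hκ using hloc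
  refine ⟨d (genericPoint X), fun x => ⟨W x, κ x, hx x, ?_⟩⟩
  have : d (genericPoint X) = d x := by
    by_cases h2 : n = 2
    · rw [hd _ h2, hd _ h2]
    · exact (hκ _).exponent_eq H hD (by omega) ⟨_, hx _⟩ (hκ x) ⟨_, hx x⟩
  rw [this]
  exact hκ x

end GenericOver

end Transition

/-! ### Line bundles on the universal divisor -/

section Global

variable {X : Scheme.{0}} {p : X ⟶ Spec (.of ℂ)} {D : LinearSystem p}
  {n : ℕ} {b : Module.Basis (Fin n) ℂ D.V} [IsIntegral (D.universalDivisor b)]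

namespace GenericOver

variable (H : GenericOver D b) {φ : D.universalDivisor b → (D.universalDivisor b).functionField}

/-- The pull-back of `𝒪(1)` to the universal divisor is represented by the rational functions
`xᵣ / xₘ`, where `m` is the index of a chart containing the point. -/
theorem represents_twist (r : Fin n) : Represents ((twist n).pullback (D.toBase b))
    fun z => (H.coord (chartAt (D.toBase b z)) r)⁻¹ := by
  refine ⟨fun z => inv_ne_zero (H.coord_ne_zero _ _), fun z w => ?_⟩
  rw [inv_div_inv, coord_div]
  exact H.toK_pull_ratio _ _ _

/-- Rational functions `κ x` on the universal divisor, one for each point of `X`, whose quotients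
are functions on `X`, are transition functions of a line bundle on `X`. -/
theorem exists_lineBundle (W : X → X.Opens) (hW : ∀ x, x ∈ W x)
    (hinj : ∀ V hV, Function.Injective (H.coef V hV)) (η : X)
    (hη : ∀ V : X.Opens, (∃ x, x ∈ V) → η ∈ V)
    (κ : X → (D.universalDivisor b).functionField) (hκ : ∀ x, κ x ≠ 0)
    (h : ∀ x y, ∃ g : Γ(X, W x ⊓ W y),
      H.coef _ ⟨η, mem_inf (hη _ ⟨x, hW x⟩) (hη _ ⟨y, hW y⟩)⟩ g = κ x / κ y) :
    ∃ N : LineBundle X, Represents (N.pullback (D.toX b)) fun z => κ (D.toX b z) := by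
  choose g hg using h
  have hη' : ∀ x, η ∈ W x := fun x => hη _ ⟨x, hW x⟩
  let N : LineBundle X :=
    { U := W
      mem := hW
      g := g
      g_self := fun x => hinj _ ⟨η, mem_inf (hη' x) (hη' x)⟩ (by
        rw [hg, map_one, div_self (hκ x)])
      cocycle := fun x y z => by
        have hxyz : ∃ t, t ∈ W x ⊓ W y ⊓ W z := ⟨η, mem_inf (mem_inf (hη' x) (hη' y)) (hη' z)⟩
        refine hinj _ hxyz ?_
        rw [map_mul, H.coef_res _ hxyz ⟨η, mem_inf (hη' x) (hη' y)⟩,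
          H.coef_res _ hxyz ⟨η, mem_inf (hη' y) (hη' z)⟩,
          H.coef_res _ hxyz ⟨η, mem_inf (hη' x) (hη' z)⟩, hg, hg, hg,
          div_mul_div_cancel₀ (hκ y)] }
  refine ⟨N, fun z => hκ _, fun z w => ?_⟩
  rw [← hg]
  exact H.toK_pull _ _ _ _

variable [IsIntegral X]

/-- Functions on `X` are determined by their pull-backs to the universal divisor, which locally
are the constants of a polynomial ring. -/
theorem coef_injective (hD : D.BasepointFree) (hn : 2 ≤ n) (V : X.Opens) (hV : ∃ x, x ∈ V) :
    Function.Injective (H.coef V hV) := by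
  obtain ⟨x, hx⟩ := hV
  obtain ⟨W, hWV, -, j, hj⟩ := exists_isTrivializing (b := b) hD hx
  have : Nontrivial (Fin n) := Fin.nontrivial_iff_two_le.2 hn
  obtain ⟨k, hk⟩ := exists_ne j
  have h1 : Function.Injective (H.coef W hj.2.1) := by
    intro a a' haa'
    refine MvPolynomial.C_injective _ _ (H.evalK_injective hj hk.symm ?_)
    exact (MvPolynomial.eval₂Hom_C _ _ _).trans (haa'.trans (MvPolynomial.eval₂Hom_C _ _ _).symm)
  intro a a' haa'
  obtain ⟨w, hw⟩ := hj.2.1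
  rw [← H.coef_res hWV hj.2.1, ← H.coef_res hWV hj.2.1] at haa'
  have h2 := congrArg (toK W (genericPoint_mem hw)) (h1 haa')
  rw [toK_res, toK_res] at h2
  exact toK_injective _ _ h2

/-- A rational function on the universal divisor which is invertible over an open subset of `X` is
a function on this open subset. -/
theorem exists_coef_eq_of_forall (hD : D.BasepointFree) (hn : 2 ≤ n) (V : X.Opens)
    (hV : ∃ x, x ∈ V) {a : (D.universalDivisor b).functionField}
    (ha : ∀ z, D.toX b z ∈ V → UnitAt z a) : ∃ s, H.coef V hV s = a := by
  obtain ⟨x, hx⟩ := hV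
  refine exists_section_of_local (η := genericPoint X) (fun V hV => H.coef V ⟨_, hV⟩)
    (fun _ _ h hW' s => H.coef_res h _ _ s) (fun V hV => H.coef_injective hD hn V _)
    (genericPoint_mem hx) a fun y hy => ?_
  obtain ⟨W, hWV, hyW, j, hj⟩ := exists_isTrivializing (b := b) hD hy
  have : Nontrivial (Fin n) := Fin.nontrivial_iff_two_le.2 hn
  obtain ⟨k, hk⟩ := exists_ne j
  obtain ⟨u, hu⟩ := H.exists_coef_eq hj hk.symm (a := a) fun z hz => ha z (hWV hz.1)
  exact ⟨W, hyW, genericPoint_mem hyW, u, hu⟩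

include H in
/-- The factors `κ x` of the local descriptions as twists differ by units and define the line
bundle on `X`. The rational functions `xₘ / xᵣ` represent the pull-back of `𝒪(-1)`, hence the
exponent `-d`. -/
theorem exists_pic_eq (hD : D.BasepointFree) (hn : 2 ≤ n) (c : Pic (D.universalDivisor b)) :
    ∃ (N : Pic X) (M : Pic (PSpace n)), c = Pic.map (D.toX b) N * Pic.map (D.toBase b) M := by
  obtain ⟨L, rfl⟩ : ∃ L, Pic.mk L = c := Quotient.exists_rep c
  obtain ⟨φ, hφ⟩ := exists_represents L
  let r : Fin n := ⟨0, by omega⟩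
  obtain ⟨d, hd⟩ := H.exists_forall_isTwistOn r hD hn hφ.locPrincipal
  choose W κ hW hκ using hd
  obtain ⟨N, hN⟩ := H.exists_lineBundle W hW (H.coef_injective hD hn) (genericPoint X)
    (fun V hV => genericPoint_mem hV.choose_spec) κ (fun x => (hκ x).1) fun x y =>
      H.exists_coef_eq_of_forall hD hn _ _ fun z hz => by
        obtain ⟨m, hm⟩ := exists_chart (D.toBase b z)
        have h1 := (hκ x).2 z hz.1 m hm
        have h2 := ((hκ y).2 z hz.2 m hm).div h1
        convert h2 using 1
        have h3 : φ z ≠ 0 := hφ.1 z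
        have h4 := zpow_ne_zero d (H.coord_ne_zero m r)
        have h5 := (hκ x).1
        have h6 := (hκ y).1
        field_simp
  refine ⟨Pic.mk N, Pic.mk (twist n) ^ (-d), ?_⟩
  have h1 : PicRepresents (Pic.map (D.toX b) (Pic.mk N)) fun z => κ (D.toX b z) := ⟨_, rfl, hN⟩
  have h2 : PicRepresents (Pic.map (D.toBase b) (Pic.mk (twist n))) fun z =>
    (H.coord (chartAt (D.toBase b z)) r)⁻¹ := ⟨_, rfl, H.represents_twist r⟩
  rw [map_zpow]
  refine ((h1.mul (h2.zpow (-d))).eq (κ := 1) ⟨L, rfl, hφ⟩ fun z => ?_).symm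
  have h3 := (hκ (D.toX b z)).2 z (hW _) _ (exists_chart (D.toBase b z)).choose_spec
  rw [one_mul, Pi.mul_apply, Pi.pow_apply, inv_zpow, zpow_neg, inv_inv]
  exact h3

end GenericOver

end Global

section Main

variable {X : Scheme.{0}} {p : X ⟶ Spec (.of ℂ)} {D : LinearSystem p} {n : ℕ}

/-- Over an empty scheme all line bundles are isomorphic. -/
theorem subsingleton_pic_of_isEmpty {Y : Scheme.{u}} [IsEmpty Y] : Subsingleton (Pic Y) := by
  refine ⟨fun c c' => ?_⟩
  obtain ⟨L, rfl⟩ : ∃ L, Pic.mk L = c := Quotient.exists_rep c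
  obtain ⟨L', rfl⟩ : ∃ L, Pic.mk L = c' := Quotient.exists_rep c'
  exact Quotient.sound ⟨isEmptyElim, isEmptyElim, isEmptyElim, isEmptyElim, isEmptyElim,
    isEmptyElim⟩

/-- Every line bundle on the universal divisor is a product of line bundles pulled back from the
two factors. -/
theorem exists_eq_map_mul_map [IsIntegral X] (hD : D.BasepointFree)
    (b : Module.Basis (Fin n) ℂ D.V) (c : Pic (D.universalDivisor b)) :
    ∃ (N : Pic X) (M : Pic (PSpace n)), c = Pic.map (D.toX b) N * Pic.map (D.toBase b) M := by
  by_cases hn : 2 ≤ n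
  · have := isIntegral_universalDivisor (b := b) hD hn
    exact (genericOver (b := b) hD hn).exists_pic_eq hD hn c
  · -- a chart with `k ≠ j` would contain any point, but there are no two indices
    have : IsEmpty (D.universalDivisor b) := by
      refine ⟨fun z => ?_⟩
      obtain ⟨W, -, hz, j, hj⟩ := exists_isTrivializing (b := b) hD (x := D.toX b z) (V := ⊤)
        trivial
      obtain ⟨k, hjk, -⟩ := hj.exists_mem_divOpen hz
      omega
    have := subsingleton_pic_of_isEmpty (Y := D.universalDivisor b)
    exact ⟨1, 1, Subsingleton.elim _ _⟩

end Main

end LinSys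

end

theorem lemma1 {X : AlgebraicGeometry.Scheme.{0}}
    (p : X ⟶ AlgebraicGeometry.Spec (CommRingCat.of ℂ)) (hX : LinSys.IsProjectiveVariety p)
    (D : LinSys.LinearSystem p) (hD : D.BasepointFree)
    (n : ℕ) (b : Module.Basis (Fin n) ℂ D.V) :
    Subgroup.closure (Set.range (D.picToRelPic b)) = ⊤ := by
  have := hX.isIntegral
  rw [eq_top_iff]
  rintro c -
  obtain ⟨c, rfl⟩ := QuotientGroup.mk'_surjective _ c
  obtain ⟨N, M, rfl⟩ := LinSys.exists_eq_map_mul_map hD b c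
  refine Subgroup.subset_closure ⟨N, ?_⟩
  refine QuotientGroup.eq.2 ?_
  rw [inv_mul_cancel_left]
  exact ⟨M, rfl⟩
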